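/- **Setting.** Let $d,k\ge 1$ and let $X\subset\mathbb R^d$ be a finite set of $n$ points. For centers $C=\{c_1,\dots,c_k\}\subset\mathbb R^d$ put $\mathrm{Cost}(X,C)=\sum_{x\in X}\min_{c\in C}\|x-c\|_2$. Let $C^*=\{c_1^*,\dots,c_k^*\}$ minimize this cost, and let $X_1^*,\dots,X_k^*$ be a corresponding optimal partition of $X$ (every point lies in the cluster of a nearest center). A predictor with label error rate $\alpha$ supplies a partition of $X$ into nonempty sets $\tilde X_1,\dots,\tilde X_k$ with $|\tilde X_i\cap X_i^*|\ge(1-\alpha)\max(|\tilde X_i|,|X_i^*|)$ for all $i$. **Algorithm (Sample-and-Search).** The input is $\tilde X_1,\dots,\tilde X_k$, $\alpha,\epsilon,\delta$; put $\zeta=1/13$. For each $i=1,\dots,k$ start with $C_i=\emptyset$ and repeat $\lceil\log(\delta/k)/\log 0.975\rceil$ times: draw a point $y$, a sample $Q$ of size $\lceil\frac{2}{(1-\alpha)\zeta}\rceil$ and a sample $R$ of size $\lceil\frac{4\ln(1/(\alpha\epsilon/2))}{(1-\alpha)(\alpha\epsilon/2)^3}\rceil$ independently and uniformly with replacement from $\tilde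 X_i$; for every sub-sample $S\subseteq Q$ of size $1/\zeta$ let $v=\sum_{s\in S}\|s-y\|_2$, $a=v\zeta^3/2$, $b=v/\zeta$, and for every $t=2^l$ with $l\in\mathbb Z$, $\lfloor\log_2a\rfloor\le l\le\lceil\log_2b\rceil$ (only $t=0$ if $v=0$), add to $C_i$ the set $\bigcup_{r\in R}G_r\cap B(r,2t)$. Here $B(r,2t)$ is the closed ball and $G_r$ is the grid on the linear span of $R$ (along an orthonormal basis of it) centered at $r$ with side length $\alpha\epsilon t/(4|R|)$, where $|R|$ is the sample size; for $t=0$ both are $\{r\}$. Finally choose $\hat c_i\in C_i$ minimizing $\sum_{x\in N_i(c)}\|x-c\|_2$ over $c\in C_i$, where $N_i(c)$ is the set of the $\lceil(1-\alpha)|\tilde X_i|\rceil$ points of $\tilde X_i$ closest to $c$. Output $\hat C=\{\hat c_1,\dots,\hat c_k\}$. **Theorem 2.1.** There is an absolute constant $K>0$ such that the following holds for all $d,k\ge1$, all $0<\alpha<\frac12$, $0<\epsilon<1$, $0<\delta<1$, and all $X$, $X_i^*$, $C^*$, $\tilde X_i$ as above. 1. With probability at least $1-\delta$, the output $\hat C$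 of Sample-and-Search satisfies $$\mathrm{Cost}(X,\hat C)\le\left(1+\frac{6\alpha-4\alpha^2+\epsilon\alpha}{(1-\alpha)(1-2\alpha)}\right)\mathrm{Cost}(X,C^*).$$ 2. For every outcome of the random choices, the number of steps of Sample-and-Search (real-RAM steps: arithmetic operations, comparisons, square roots, logarithms, powers of two and roundings of real numbers, random draws, and elementary list operations; operations on vectors of $\mathbb R^d$ are charged by coordinates) is at most $$K\cdot 2^{K/(\alpha\epsilon)^4}\cdot n\,d\cdot\max\{1,\log(k/\delta)\}.$$ In particular, there is no exponential dependence on $d$. -/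

import Mathlib

noncomputable section

/-! ### The `k`-median problem with a predictor -/

/-- The space `ℝ^d` with the Euclidean norm. -/
abbrev Pt (d : ℕ) : Type := EuclideanSpace ℝ (Fin d)

/-- `Cost(X, C) = ∑_{x ∈ X} min_{c ∈ C} ‖x - c‖`, where the set `C` of centers is listed by `Fin k`. -/
def kMedianCost {d k : ℕ} (X : Finset (Pt d)) (C : Fin k → Pt d) : ℝ :=
  ∑ x ∈ X, Metric.infDist x (Set.range C)

/-- The labeled sets `P 0, …, P (k-1)` are pairwise disjoint and their union is `X`. -/
structure IsLabeledPartition {d k : ℕ} (X : Finset (Pt d)) (P : Fin k → Finset (Pt d)) : Prop where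
  disjoint : ∀ i j, i ≠ j → Disjoint (P i) (P j)
  cover : ∀ x, x ∈ X ↔ ∃ i, x ∈ P i

/-- `cs` is an optimal set of `k` centers for `X`, and `Xs` is a partition of `X` into the
corresponding optimal clusters: every point lies in the cluster of a nearest center. -/
structure IsOptimalClustering {d k : ℕ} (X : Finset (Pt d)) (Xs : Fin k → Finset (Pt d))
    (cs : Fin k → Pt d) : Prop where
  partition : IsLabeledPartition X Xs
  nearest : ∀ i, ∀ x ∈ Xs i, ∀ j, dist x (cs i) ≤ dist x (cs j)
  optimal : ∀ C : Fin k → Pt d, kMedianCost X cs ≤ kMedianCost X C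

open scoped Classical in
/-- The predicted clusters `Xt` have label error rate (at most) `α` with respect to `Xs`. -/
def HasErrorRate {d k : ℕ} (α : ℝ) (Xt Xs : Fin k → Finset (Pt d)) : Prop :=
  ∀ i, (1 - α) * max ((Xt i).card : ℝ) ((Xs i).card : ℝ) ≤ ((Xt i ∩ Xs i).card : ℝ)

/-! ### Programs with a step count

Real-RAM cost model: one step for an arithmetic operation, comparison, square root, logarithm,
power of two or rounding of a real number, for a random draw, and for an elementary list operation.
Programs below are built from such steps. -/

/-- The result of a computation together with the number of steps that it took. -/
structure Timed (A : Type) where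
  val : A
  time : ℕ

instance : Monad Timed where
  pure a := ⟨a, 0⟩
  bind x f := ⟨(f x.val).val, x.time + (f x.val).time⟩

/-- The value `a`, obtained in `n` elementary steps. -/
def ops {A : Type} (n : ℕ) (a : A) : Timed A := ⟨a, n⟩

/-- Run `f` on the members of a list and concatenate the resulting lists. -/
def collect {A B : Type} (f : A → Timed (List B)) : List A → Timed (List B)
  | [] => pure []
  | a :: l => do
      let x ← f a
      let y ← collect f l
      ops (x.length + 1) (x ++ y)

/-- Run `f` on the members of a list and return the list of results. -/
def mapTimed {A B : Type} (f : A → Timed B) : List A → Timed (List B)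
  | [] => pure []
  | a :: l => do
      let x ← f a
      let y ← mapTimed f l
      ops 1 (x :: y)

/-- Run `f` on the members of a list and add up the results. -/
def sumTimed {A : Type} (f : A → Timed ℝ) : List A → Timed ℝ
  | [] => pure 0
  | a :: l => do
      let x ← f a
      let y ← sumTimed f l
      ops 1 (x + y)

/-- The loop `for i ← 1 to k`, storing one result for each `i`. -/
def forFin {k : ℕ} {A : Type} (f : Fin k → Timed A) : Timed (Fin k → A) :=
  ⟨fun i => (f i).val, ∑ i, ((f i).time + 1)⟩

/-- All sublists of length `m` of a list (subsets by position). -/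
def subsetsTimed {A : Type} : ℕ → List A → Timed (List (List A))
  | 0, _ => ops 1 [[]]
  | _ + 1, [] => ops 1 []
  | m + 1, a :: l => do
      let u ← subsetsTimed (m + 1) l
      let w ← subsetsTimed m l
      let w' ← mapTimed (fun s => ops 1 (a :: s)) w
      ops (u.length + 1) (u ++ w')

/-- The first member of a nonempty list at which `f` is smallest, given the best member so far
and the value of `f` there. -/
def argminFrom {A : Type} (f : A → Timed ℝ) (best : A) (bestVal : ℝ) : List A → Timed A
  | [] => pure best
  | a :: l => do
      let x ← f a
      let better ← ops 1 (decide (x < bestVal))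
      if better then argminFrom f a x l else argminFrom f best bestVal l

/-- A member of a list at which `f` is smallest (`z` for the empty list). -/
def argminTimed {A : Type} (z : A) (f : A → Timed ℝ) : List A → Timed A
  | [] => pure z
  | a :: l => do
      let x ← f a
      argminFrom f a x l

/-! Selection in linear time, by medians of groups of five. -/

def insertTimed (x : ℝ) : List ℝ → Timed (List ℝ)
  | [] => ops 1 [x]
  | y :: l => do
      let le ← ops 1 (decide (x ≤ y))
      if le then ops 1 (x :: y :: l) else do
        let l' ← insertTimed x l
        ops 1 (y :: l')

/-- Insertion sort. -/
def sortTimed : List ℝ → Timed (List ℝ)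
  | [] => pure []
  | x :: l => do
      let l' ← sortTimed l
      insertTimed x l'

/-- The medians of the consecutive groups of five (an incomplete last group is skipped). -/
def mediansOfFive : List ℝ → Timed (List ℝ)
  | a :: b :: c :: d :: e :: l => do
      let s ← sortTimed [a, b, c, d, e]
      let r ← mediansOfFive l
      ops 8 (s.getD 2 0 :: r)
  | _ => ops 1 []

/-- The members of a list that are smaller than `p`, equal to `p`, larger than `p`. -/
def splitTimed (p : ℝ) : List ℝ → Timed (List ℝ × List ℝ × List ℝ)
  | [] => pure ([], [], [])
  | x :: l => do
      let s ← splitTimed p l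
      let lt ← ops 1 (decide (x < p))
      let eq ← ops 1 (decide (x = p))
      if lt then ops 1 (x :: s.1, s.2.1, s.2.2)
      else if eq then ops 1 (s.1, x :: s.2.1, s.2.2)
      else ops 1 (s.1, s.2.1, x :: s.2.2)

/-- The entry with index `j` (from `0`) of the sorted list; the first argument bounds the depth of
the recursion, and the length of the list is large enough for it. -/
def selectTimed : ℕ → List ℝ → ℕ → Timed ℝ
  | 0, _, _ => pure 0
  | fuel + 1, l, j => do
      let len ← ops (l.length + 1) l.length
      if len ≤ 50 then do
        let s ← sortTimed l
        ops (j + 1) (s.getD j 0)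
      else do
        let meds ← mediansOfFive l
        let h ← ops (meds.length + 1) (meds.length / 2)
        let p ← selectTimed fuel meds h
        let s ← splitTimed p l
        let n₁ ← ops (s.1.length + 1) s.1.length
        let n₂ ← ops (s.2.1.length + 1) s.2.1.length
        if j < n₁ then selectTimed fuel s.1 j
        else if j < n₁ + n₂ then ops 2 p
        else selectTimed fuel s.2.2 (j - n₁ - n₂)

/-- The sum of the `m` smallest entries of a list (`1 ≤ m ≤` length), counted with multiplicity:
the entries below the `m`-th smallest one `p`, and as many copies of `p` as are missing. -/
def sumSmallest (m : ℕ) (l : List ℝ) : Timed ℝ := do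
  let len ← ops (l.length + 1) l.length
  let p ← selectTimed len l (m - 1)
  let s ← splitTimed p l
  let c ← ops (s.1.length + 1) s.1.length
  let x ← sumTimed (fun y => ops 1 y) s.1
  ops 3 (x + ((m : ℝ) - (c : ℝ)) * p)

/-! Vector operations, charged by the number of operations on coordinates. -/

def addTimed {d : ℕ} (x y : Pt d) : Timed (Pt d) := ops d (x + y)

def subTimed {d : ℕ} (x y : Pt d) : Timed (Pt d) := ops d (x - y)

def smulTimed {d : ℕ} (c : ℝ) (x : Pt d) : Timed (Pt d) := ops d (c • x)

def innerTimed {d : ℕ} (x y : Pt d) : Timed ℝ := ops (2 * d) (inner ℝ x y)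

def normTimed {d : ℕ} (x : Pt d) : Timed ℝ := ops (2 * d) ‖x‖

def distTimed {d : ℕ} (x y : Pt d) : Timed ℝ := ops (3 * d) (dist x y)

/-- Subtract from `v` its projection on the orthonormal vectors of a list. -/
def subtractProj {d : ℕ} : List (Pt d) → Pt d → Timed (Pt d)
  | [], v => pure v
  | e :: B, v => do
      let c ← innerTimed e v
      let w ← smulTimed c e
      let u ← subTimed v w
      subtractProj B u

/-- Gram-Schmidt: extends the orthonormal list `B` to an orthonormal basis of the linear span
of `B` and a further list of vectors. -/
def orthoBasis {d : ℕ} (B : List (Pt d)) : List (Pt d) → Timed (List (Pt d))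
  | [] => pure B
  | v :: l => do
      let u ← subtractProj B v
      let a ← normTimed u
      let isZero ← ops 1 (decide (a = 0))
      if isZero then orthoBasis B l else do
        let c ← ops 1 a⁻¹
        let e ← smulTimed c u
        orthoBasis (e :: B) l

/-- The points `p + ∑ θ z_e e` (`e` in the list), with integers `z_e ∈ [-K, K]`. -/
def gridBox {d : ℕ} (θ : ℝ) (K : ℕ) : List (Pt d) → Pt d → Timed (List (Pt d))
  | [], p => ops 1 [p]
  | e :: B, p =>
      collect (fun z : ℕ => do
        let c ← ops 3 (θ * ((z : ℝ) - (K : ℝ)))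
        let w ← smulTimed c e
        let q ← addTimed p w
        gridBox θ K B q) (List.range (2 * K + 1))

/-! ### The algorithm -/

/-- Candidate Set Construction: the union over `r ∈ R` of `G_r ∩ B(r, 2t)`, where `G_r` is the grid
on `span R` centered at `r` with side length `θ = α ε t / (4 |R|)`.
A point `r + ∑ θ z_e e` of the grid that lies in `B(r, 2t)` has `|z_e| ≤ 2t/θ = 8 |R| / (α ε)` if
`t > 0`, so a finite box is enough; for `t = 0` grid and ball shrink to `{r}`. -/
def candidateSet {d : ℕ} (α ε : ℝ) (R : List (Pt d)) (t : ℝ) : Timed (List (Pt d)) := do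
  let N ← ops (R.length + 1) R.length
  let θ ← ops 5 (α * ε * t / (4 * (N : ℝ)))
  let K ← ops 4 ⌊8 * (N : ℝ) / (α * ε)⌋₊
  let B ← orthoBasis [] R
  collect (fun r => do
    let G ← gridBox θ K B r
    collect (fun q => do
      let s ← distTimed q r
      let keep ← ops 2 (decide (s ≤ 2 * t))
      if keep then ops 1 [q] else ops 1 []) G) R

/-- `1/ζ` for the constant `ζ = 1/13`. -/
def zetaInv : ℕ := 13

/-- The number of repetitions for each cluster. -/
def numTrials (k : ℕ) (δ : ℝ) : ℕ := ⌈Real.log (δ / k) / Real.log 0.975⌉₊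

/-- The size of the samples `Q`. -/
def sizeQ (α : ℝ) : ℕ := ⌈2 / ((1 - α) * (1 / (zetaInv : ℝ)))⌉₊

/-- The size of the samples `R`. -/
def sizeR (α ε : ℝ) : ℕ :=
  ⌈4 * Real.log (1 / (α * ε / 2)) / ((1 - α) * (α * ε / 2) ^ 3)⌉₊

/-- The numbers `t = 2^l`, `⌊log₂ a⌋ ≤ l ≤ ⌈log₂ b⌉`, for `a = v ζ³ / 2` and `b = v / ζ`.
If `v = 0` then `a = b = 0`, `l = -∞` and `t = 0`. -/
def scales (v : ℝ) : Timed (List ℝ) := do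
  let isZero ← ops 1 (decide (v = 0))
  if isZero then ops 1 [0] else do
    let a ← ops 4 (v * (1 / (zetaInv : ℝ)) ^ 3 / 2)
    let b ← ops 2 (v / (1 / (zetaInv : ℝ)))
    let lo ← ops 2 ⌊Real.logb 2 a⌋
    let hi ← ops 2 ⌈Real.logb 2 b⌉
    mapTimed (fun i : ℕ => ops 2 ((2 : ℝ) ^ (lo + (i : ℤ)))) (List.range (hi - lo + 1).toNat)

/-- The random choices of one trial on a predicted cluster `P`: the point `y` and the samples
`Q` and `R`, all drawn with replacement. -/
abbrev TrialSample {d : ℕ} (α ε : ℝ) (P : Finset (Pt d)) : Type :=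
  P × (Fin (sizeQ α) → P) × (Fin (sizeR α ε) → P)

/-- The random choices of a run of the algorithm. -/
abbrev Tape {d k : ℕ} (α ε δ : ℝ) (Xt : Fin k → Finset (Pt d)) : Type :=
  (i : Fin k) → Fin (numTrials k δ) → TrialSample α ε (Xt i)

/-- The candidates that one trial contributes. -/
def trial {d : ℕ} (α ε : ℝ) (P : Finset (Pt d)) (ω : TrialSample α ε P) :
    Timed (List (Pt d)) := do
  let y : Pt d ← ops 1 (ω.1 : Pt d)
  let Q : List (Pt d) ← ops (4 + sizeQ α) (List.ofFn fun a => (ω.2.1 a : Pt d))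
  let R : List (Pt d) ← ops (12 + sizeR α ε) (List.ofFn fun a => (ω.2.2 a : Pt d))
  let Qs ← subsetsTimed zetaInv Q
  collect (fun S => do
    let v ← sumTimed (fun s => distTimed s y) S
    let ts ← scales v
    collect (fun t => candidateSet α ε R t) ts) Qs

/-- `∑_{x ∈ N(c)} ‖x - c‖`, where `N(c)` consists of the `m` points of `P` closest to `c`. -/
def trimmedCost {d : ℕ} (P : Finset (Pt d)) (m : ℕ) (c : Pt d) : Timed ℝ := do
  let D ← mapTimed (fun x => distTimed x c) P.toList
  sumSmallest m D

/-- The center chosen for one predicted cluster `P`, with `J` trials. -/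
def chooseCenter {d J : ℕ} (α ε : ℝ) (P : Finset (Pt d))
    (ω : Fin J → TrialSample α ε P) : Timed (Pt d) := do
  let C ← collect (fun j => trial α ε P (ω j)) (List.finRange J)
  let m ← ops (P.card + 3) ⌈(1 - α) * (P.card : ℝ)⌉₊
  argminTimed 0 (trimmedCost P m) C

/-- The run of Sample-and-Search with the random choices `ω`. -/
def sampleAndSearchRun {d k : ℕ} (α ε δ : ℝ) (Xt : Fin k → Finset (Pt d))
    (ω : Tape α ε δ Xt) : Timed (Fin k → Pt d) := do
  let _ ← ops 5 (numTrials k δ)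
  forFin fun i => chooseCenter α ε (Xt i) (ω i)

/-- Sample-and-Search as a randomized algorithm: the joint law of the output (the list of centers)
and the number of steps, when all random choices are independent and uniform. -/
def sampleAndSearch {d k : ℕ} (α ε δ : ℝ) (Xt : Fin k → Finset (Pt d))
    [∀ i, Nonempty (Xt i)] : PMF (Timed (Fin k → Pt d)) :=
  (PMF.uniformOfFintype (Tape α ε δ Xt)).map (sampleAndSearchRun α ε δ Xt)

end

/-! Fix a predicted cluster `P` and its optimal cluster `Y` with center `c`; let `T = P ∩ Y`, let
`C` be the sum of the distances from `T` to `c`, and `μ = C / |T|`. A candidate `q` is judged by its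
`excess`, the sum over `T` of the positive parts of `dist x q - dist x c`.
`sum_dist_le_of_isGoodCenter` shows that a single candidate of small excess suffices. The chosen
center `z` has no larger trimmed cost, and its trimmed set shares at least `(1 - 2α) max(|P|, |Y|)`
points with `Y`; so `z` is far neither from `q` nor from `c`, and the triangle inequality pays for
the points wrongly included or left out.

Small excess comes from a potential argument that never sees the dimension. Let `q` be the point of
a subspace `F` nearest to `c`. If `x` is farther from `q` than from `c`, the line through `q` and
`x` passes closer to `c`, and the squared distance drops by at least the square of the difference
(`exists_sq_dist_add_sq_excess_le`). By Cauchy–Schwarz, as long as the nearest point has large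
excess, adjoining a random point of `P` lowers the expected squared distance by a fixed amount. This
cannot go on for long, so a large sample probably spans a point of small excess
(`uprob_forall_excess_mul_le`). Starting from a sample point `r` within `19/10 μ` of `c` keeps the
initial potential of order `μ ^ 2`.

To reach that point by a grid, a scale `t` comparable to `μ` is needed. A random `y` is often within
`10 μ` of `c`. Let `ρ` be the 9/10-quantile of the distances from `T` to `y`; with constant
probability some 13 points of `Q` give a sum `v` with `ρ ≤ v ≤ 4394 μ` (`uprob_exists_scale`). If `μ
≤ 13 v`, a tested scale lies in `[μ, 2μ]`. Otherwise `ρ` is tiny compared with `μ`. Then either `y`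
is within `24 v` of `c` and a scale near `13 v` works, or most of `T` is concentrated far from `c`.
In the latter case optimality of `c` for `Y` forces `α > 2/5`, and the term `2α²` in `IsGoodCenter`
is generous enough to accept `r` itself (`exists_isGoodCenter_mem_candidateSet`).

So a trial succeeds with probability at least `1/40 = 1 - 0.975` (`uprob_trial`); the repetitions
push the failure probability of a cluster below `δ / k`, and a union bound finishes the first claim.

The number of steps is governed by the grids, with at most `(2m + 1) ^ N` points each, where `N =
|R|` is of order `(αε)⁻³ log(1/(αε))` and `m` of order `N / (αε)`. Two logarithms enter the
exponent, each absorbed by a factor `(αε)^(-1/2)`, which gives `(αε)⁻⁴`. Selection in linear time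
evaluates a trimmed cost in `O(|P| d)` steps, and the sizes `|P|` add up to `n`. -/

/-! ### Uniform averages and probabilities on finite types -/

/-- The average of a function on a finite type. -/
noncomputable def avg {Ω : Type*} [Fintype Ω] (f : Ω → ℝ) : ℝ := (∑ ω, f ω) / Fintype.card Ω

open scoped Classical in
/-- The probability of an event under the uniform distribution. -/
noncomputable def uprob {Ω : Type*} [Fintype Ω] (p : Ω → Prop) : ℝ :=
  avg fun ω => if p ω then 1 else 0

section UniformProbability

variable {Ω Ω' : Type*} [Fintype Ω] [Fintype Ω']

theorem avg_mono {f g : Ω → ℝ} (h : ∀ ω, f ω ≤ g ω) : avg f ≤ avg g := by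
  unfold avg
  gcongr
  exact h _

theorem avg_nonneg {f : Ω → ℝ} (h : ∀ ω, 0 ≤ f ω) : 0 ≤ avg f :=
  div_nonneg (Finset.sum_nonneg fun ω _ => h ω) (Nat.cast_nonneg _)

theorem avg_const [Nonempty Ω] (a : ℝ) : avg (fun _ : Ω => a) = a := by
  have : (Fintype.card Ω : ℝ) ≠ 0 := by exact_mod_cast Fintype.card_ne_zero
  simp [avg, this]

theorem avg_add (f g : Ω → ℝ) : avg (fun ω => f ω + g ω) = avg f + avg g := by
  simp [avg, Finset.sum_add_distrib, add_div]

theorem avg_const_mul (a : ℝ) (f : Ω → ℝ) : avg (fun ω => a * f ω) = a * avg f := by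
  simp [avg, ← Finset.mul_sum, mul_div_assoc]

theorem avg_sum {ι : Type*} (s : Finset ι) (f : ι → Ω → ℝ) :
    avg (fun ω => ∑ i ∈ s, f i ω) = ∑ i ∈ s, avg (f i) := by
  simp only [avg, Finset.sum_div]
  exact Finset.sum_comm

theorem avg_equiv (e : Ω ≃ Ω') (f : Ω' → ℝ) : avg (fun ω => f (e ω)) = avg f := by
  simp only [avg, Fintype.card_congr e]
  rw [e.sum_comp]

theorem avg_prod (f : Ω × Ω' → ℝ) : avg f = avg fun a => avg fun b => f (a, b) := by
  simp only [avg, Fintype.card_prod, Nat.cast_mul, ← Finset.sum_div, Fintype.sum_prod_type]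
  rw [div_div, mul_comm]

theorem avg_cons {n : ℕ} (f : (Fin (n + 1) → Ω) → ℝ) :
    avg f = avg fun a => avg fun R => f (Fin.cons a R) := by
  rw [← avg_equiv (Fin.consEquiv fun _ => Ω), avg_prod]
  rfl

/-- Independence of the coordinates, in the form of distributivity of a product over sums. -/
theorem avg_pi_prod {ι : Type*} [Fintype ι] [DecidableEq ι] {A : ι → Type*} [∀ i, Fintype (A i)]
    (f : ∀ i, A i → ℝ) : avg (fun ω : ∀ i, A i => ∏ i, f i (ω i)) = ∏ i, avg (f i) := by
  simp only [avg, Finset.prod_div_distrib, Fintype.prod_sum, Fintype.card_pi, Nat.cast_prod]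

theorem avg_pi_coord {ι : Type*} [Fintype ι] [DecidableEq ι] {A : ι → Type*} [∀ i, Fintype (A i)]
    [∀ i, Nonempty (A i)] (i : ι) (f : A i → ℝ) : avg (fun ω : ∀ i, A i => f (ω i)) = avg f := by
  have h := avg_pi_prod (A := A) (Function.update (fun j _ => (1 : ℝ)) i f)
  have h1 : ∀ ω : ∀ i, A i,
      ∏ j, (Function.update (fun j (_ : A j) => (1 : ℝ)) i f) j (ω j) = f (ω i) := by
    intro ω
    rw [Finset.prod_eq_single i]
    · simp
    · intro j _ hj
      simp [hj]
    · simp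
  have h2 : ∏ j, avg ((Function.update (fun j (_ : A j) => (1 : ℝ)) i f) j) = avg f := by
    rw [Finset.prod_eq_single i]
    · simp
    · intro j _ hj
      simp [hj, avg_const]
    · simp
  rw [h2] at h
  rw [← h]
  congr 1
  ext ω
  rw [h1]

theorem avg_pi_sum {n : ℕ} [Nonempty Ω] (f : Ω → ℝ) :
    avg (fun ω : Fin n → Ω => ∑ i, f (ω i)) = n * avg f := by
  rw [avg_sum]
  simp [avg_pi_coord (A := fun _ : Fin n => Ω)]

theorem avg_pi_pow {n : ℕ} (f : Ω → ℝ) :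
    avg (fun ω : Fin n → Ω => ∏ i, f (ω i)) = avg f ^ n := by
  rw [avg_pi_prod (A := fun _ : Fin n => Ω) (fun _ => f)]
  simp

theorem uprob_mono {p q : Ω → Prop} (h : ∀ ω, p ω → q ω) : uprob p ≤ uprob q := by
  classical
  refine avg_mono fun ω => ?_
  by_cases hp : p ω
  · simp [hp, h ω hp]
  · simp only [hp, if_false]
    split_ifs <;> norm_num

theorem uprob_nonneg (p : Ω → Prop) : 0 ≤ uprob p :=
  avg_nonneg fun ω => by split_ifs <;> norm_num

theorem uprob_le_one (p : Ω → Prop) : uprob p ≤ 1 := by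
  unfold uprob avg
  refine div_le_one_of_le₀ ?_ (Nat.cast_nonneg _)
  calc _ ≤ ∑ _ω : Ω, (1 : ℝ) := Finset.sum_le_sum fun ω _ => by split_ifs <;> norm_num
    _ = _ := by simp

theorem uprob_or_le (p q : Ω → Prop) : uprob (fun ω => p ω ∨ q ω) ≤ uprob p + uprob q := by
  unfold uprob
  rw [← avg_add]
  refine avg_mono fun ω => ?_
  by_cases hp : p ω <;> by_cases hq : q ω <;> simp [hp, hq]

theorem uprob_exists_le {ι : Type*} [Fintype ι] (p : ι → Ω → Prop) :
    uprob (fun ω => ∃ i, p i ω) ≤ ∑ i, uprob (p i) := by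
  classical
  unfold uprob
  rw [← avg_sum]
  refine avg_mono fun ω => ?_
  split_ifs with h
  · obtain ⟨i, hi⟩ := h
    refine le_trans ?_ (Finset.single_le_sum (fun j _ => ?_) (Finset.mem_univ i))
    · simp [hi]
    · split_ifs <;> norm_num
  · exact Finset.sum_nonneg fun j _ => by split_ifs <;> norm_num

theorem uprob_eq_zero {p : Ω → Prop} (h : ∀ ω, ¬ p ω) : uprob p = 0 := by
  simp [uprob, avg, h]

theorem uprob_not [Nonempty Ω] (p : Ω → Prop) : uprob (fun ω => ¬ p ω) = 1 - uprob p := by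
  have h : uprob (fun ω => ¬ p ω) + uprob p = 1 := by
    unfold uprob
    rw [← avg_add, ← avg_const (Ω := Ω) 1]
    congr 1
    ext ω
    by_cases hp : p ω <;> simp [hp, avg_const]
  linarith

theorem uprob_prod (p : Ω × Ω' → Prop) : uprob p = avg fun a => uprob fun b => p (a, b) :=
  avg_prod _

theorem uprob_cons {n : ℕ} (p : (Fin (n + 1) → Ω) → Prop) :
    uprob p = avg fun a => uprob fun R => p (Fin.cons a R) :=
  avg_cons _

theorem uprob_pi_forall {ι : Type*} [Fintype ι] [DecidableEq ι] {A : ι → Type*}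
    [∀ i, Fintype (A i)] (p : ∀ i, A i → Prop) :
    uprob (fun ω : ∀ i, A i => ∀ i, p i (ω i)) = ∏ i, uprob (p i) := by
  classical
  unfold uprob
  rw [← avg_pi_prod]
  congr 1
  ext ω
  rw [Finset.prod_ite_zero]
  simp

theorem uprob_pi_coord {ι : Type*} [Fintype ι] [DecidableEq ι] {A : ι → Type*}
    [∀ i, Fintype (A i)] [∀ i, Nonempty (A i)] (i : ι) (p : A i → Prop) :
    uprob (fun ω : ∀ i, A i => p (ω i)) = uprob p := by
  classical
  exact avg_pi_coord (A := A) i fun a => if p a then (1 : ℝ) else 0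

/-- Markov's inequality. -/
theorem uprob_le_avg_div {f : Ω → ℝ} (hf : ∀ ω, 0 ≤ f ω) {t : ℝ} (ht : 0 < t) :
    uprob (fun ω => t ≤ f ω) ≤ avg f / t := by
  rw [le_div_iff₀ ht, mul_comm]
  unfold uprob
  rw [← avg_const_mul]
  refine avg_mono fun ω => ?_
  split_ifs with h
  · simpa using h
  · simpa using hf ω

/-- Independent events: a lower bound for the probability of an event on a product, from a lower
bound for the conditional probabilities. -/
theorem mul_le_uprob_prod {p : Ω × Ω' → Prop} {q : Ω → Prop} {b : ℝ}
    (h : ∀ a, q a → b ≤ uprob fun c => p (a, c)) : uprob q * b ≤ uprob p := by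
  classical
  rw [uprob_prod, mul_comm]
  unfold uprob
  rw [← avg_const_mul]
  refine avg_mono fun a => ?_
  by_cases ha : q a
  · simpa [ha, uprob] using h a ha
  · simpa [ha, uprob] using uprob_nonneg fun c => p (a, c)

theorem uprob_prod_and (p : Ω → Prop) (q : Ω' → Prop) :
    uprob p * uprob q ≤ uprob fun ω : Ω × Ω' => p ω.1 ∧ q ω.2 :=
  mul_le_uprob_prod fun a ha => by simp [ha]

theorem uprob_coe {A : Type*} (P : Finset A) (p : A → Prop) [DecidablePred p] :
    uprob (fun x : P => p x) = ((P.filter p).card : ℝ) / P.card := by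
  classical
  unfold uprob avg
  rw [Fintype.card_coe]
  have h := Finset.sum_coe_sort P (fun x => if p x then (1 : ℝ) else 0)
  rw [Finset.sum_boole (fun x => p x) P] at h
  rw [← h]
  congr!

theorem avg_coe {A : Type*} (P : Finset A) (f : A → ℝ) :
    avg (fun x : P => f x) = (∑ x ∈ P, f x) / P.card := by
  unfold avg
  rw [Fintype.card_coe, Finset.sum_coe_sort P f]

end UniformProbability

/-! ### Basic facts on timed programs -/

section TimedBasics

variable {A B : Type}

@[simp] theorem Timed.bind_val (x : Timed A) (f : A → Timed B) :
    (x >>= f).val = (f x.val).val := rfl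

@[simp] theorem Timed.bind_time (x : Timed A) (f : A → Timed B) :
    (x >>= f).time = x.time + (f x.val).time := rfl

@[simp] theorem Timed.pure_val (a : A) : (pure a : Timed A).val = a := rfl

@[simp] theorem Timed.pure_time (a : A) : (pure a : Timed A).time = 0 := rfl

@[simp] theorem ops_val (n : ℕ) (a : A) : (ops n a).val = a := rfl

@[simp] theorem ops_time (n : ℕ) (a : A) : (ops n a).time = n := rfl

theorem collect_val (f : A → Timed (List B)) (l : List A) :
    (collect f l).val = l.flatMap fun a => (f a).val := by
  induction l with
  | nil => rfl
  | cons a l ih => simp [collect, ih]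

theorem mem_collect_val {f : A → Timed (List B)} {l : List A} {b : B} :
    b ∈ (collect f l).val ↔ ∃ a ∈ l, b ∈ (f a).val := by
  rw [collect_val, List.mem_flatMap]

theorem length_collect_le (f : A → Timed (List B)) (l : List A) (L : ℕ)
    (h : ∀ a ∈ l, (f a).val.length ≤ L) : (collect f l).val.length ≤ l.length * L := by
  induction l with
  | nil => simp [collect]
  | cons a l ih =>
    have h1 := h a (by simp)
    have h2 := ih fun b hb => h b (by simp [hb])
    simp only [collect, Timed.bind_val, ops_val, List.length_append, List.length_cons]
    rw [Nat.add_mul]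
    omega

theorem time_collect_le (f : A → Timed (List B)) (l : List A) (T L : ℕ)
    (hT : ∀ a ∈ l, (f a).time ≤ T) (hL : ∀ a ∈ l, (f a).val.length ≤ L) :
    (collect f l).time ≤ l.length * (T + L + 1) := by
  induction l with
  | nil => simp [collect]
  | cons a l ih =>
    have h1 := hT a (by simp)
    have h2 := hL a (by simp)
    have h3 := ih (fun b hb => hT b (by simp [hb])) fun b hb => hL b (by simp [hb])
    simp only [collect, Timed.bind_time, ops_time, List.length_cons]
    rw [Nat.add_mul]
    omega

theorem mapTimed_val (f : A → Timed B) (l : List A) :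
    (mapTimed f l).val = l.map fun a => (f a).val := by
  induction l with
  | nil => rfl
  | cons a l ih => simp [mapTimed, ih]

theorem time_mapTimed_le (f : A → Timed B) (l : List A) (T : ℕ) (hT : ∀ a ∈ l, (f a).time ≤ T) :
    (mapTimed f l).time ≤ l.length * (T + 1) := by
  induction l with
  | nil => simp [mapTimed]
  | cons a l ih =>
    have h1 := hT a (by simp)
    have h3 := ih fun b hb => hT b (by simp [hb])
    simp only [mapTimed, Timed.bind_time, ops_time, List.length_cons]
    rw [Nat.add_mul l.length]
    omega

theorem sumTimed_val (f : A → Timed ℝ) (l : List A) :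
    (sumTimed f l).val = (l.map fun a => (f a).val).sum := by
  induction l with
  | nil => rfl
  | cons a l ih => simp [sumTimed, ih]

theorem time_sumTimed_le (f : A → Timed ℝ) (l : List A) (T : ℕ) (hT : ∀ a ∈ l, (f a).time ≤ T) :
    (sumTimed f l).time ≤ l.length * (T + 1) := by
  induction l with
  | nil => simp [sumTimed]
  | cons a l ih =>
    have h1 := hT a (by simp)
    have h3 := ih fun b hb => hT b (by simp [hb])
    simp only [sumTimed, Timed.bind_time, ops_time, List.length_cons]
    rw [Nat.add_mul l.length]
    omega

theorem argminFrom_spec (f : A → Timed ℝ) (l : List A) (best : A) (v : ℝ)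
    (hv : v = (f best).val) :
    ((argminFrom f best v l).val = best ∨ (argminFrom f best v l).val ∈ l) ∧
      (f (argminFrom f best v l).val).val ≤ v ∧
      ∀ a ∈ l, (f (argminFrom f best v l).val).val ≤ (f a).val := by
  induction l generalizing best v with
  | nil => simp [argminFrom, hv]
  | cons a l ih =>
    by_cases h : (f a).val < v
    · have := ih a (f a).val rfl
      simp only [argminFrom, Timed.bind_val, ops_val, h, decide_true, if_true, List.mem_cons]
      refine ⟨?_, this.2.1.trans h.le, ?_⟩
      · tauto
      · rintro b (rfl | hb)
        · exact this.2.1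
        · exact this.2.2 b hb
    · have := ih best v hv
      simp only [argminFrom, Timed.bind_val, ops_val, h, decide_false, List.mem_cons]
      refine ⟨?_, this.2.1, ?_⟩
      · have := this.1
        simp only [Bool.false_eq_true, if_false]
        tauto
      · rintro b (rfl | hb)
        · exact this.2.1.trans (not_lt.1 h)
        · exact this.2.2 b hb

theorem argminTimed_spec (z : A) (f : A → Timed ℝ) {l : List A} (hl : l ≠ []) :
    (argminTimed z f l).val ∈ l ∧
      ∀ a ∈ l, (f (argminTimed z f l).val).val ≤ (f a).val := by
  match l, hl with
  | a :: l, _ =>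
    have h := argminFrom_spec f l a (f a).val rfl
    simp only [argminTimed, Timed.bind_val, List.mem_cons]
    refine ⟨h.1, ?_⟩
    rintro b (rfl | hb)
    · exact h.2.1
    · exact h.2.2 b hb

theorem time_argminFrom_le (f : A → Timed ℝ) (l : List A) (best : A) (v : ℝ) (T : ℕ)
    (hT : ∀ a, (f a).time ≤ T) : (argminFrom f best v l).time ≤ l.length * (T + 1) := by
  induction l generalizing best v with
  | nil => simp [argminFrom]
  | cons a l ih =>
    have h1 := hT a
    have h2 := ih a (f a).val
    have h3 := ih best v
    simp only [argminFrom, Timed.bind_time, ops_time, List.length_cons, ops_val]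
    rw [Nat.add_mul l.length]
    by_cases h : (f a).val < v
    · simp only [h, decide_true, if_true]
      omega
    · simp only [h, decide_false, Bool.false_eq_true, if_false]
      omega

theorem time_argminTimed_le (z : A) (f : A → Timed ℝ) (l : List A) (T : ℕ)
    (hT : ∀ a, (f a).time ≤ T) : (argminTimed z f l).time ≤ l.length * (T + 1) := by
  cases l with
  | nil => simp [argminTimed]
  | cons a l =>
    have h1 := hT a
    have h2 := time_argminFrom_le f l a (f a).val T hT
    simp only [argminTimed, Timed.bind_time, List.length_cons]
    rw [Nat.add_mul l.length]
    omega

theorem subsetsTimed_val (m : ℕ) (l : List A) (S : List A) :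
    S ∈ (subsetsTimed m l).val ↔ S.Sublist l ∧ S.length = m := by
  induction l generalizing m S with
  | nil =>
    cases m with
    | zero => simp [subsetsTimed]
    | succ m =>
      simp only [subsetsTimed, ops_val, List.not_mem_nil, List.sublist_nil, false_iff]
      rintro ⟨rfl, h⟩
      simp at h
  | cons a l ih =>
    cases m with
    | zero =>
      simp only [subsetsTimed, ops_val, List.mem_singleton, List.length_eq_zero_iff]
      exact ⟨fun h => by simp [h], fun h => h.2⟩
    | succ m =>
      simp only [subsetsTimed, Timed.bind_val, ops_val, List.mem_append, mapTimed_val, ih,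
        List.mem_map]
      constructor
      · rintro (⟨h1, h2⟩ | ⟨S', ⟨h1, h2⟩, rfl⟩)
        · exact ⟨h1.cons a, h2⟩
        · exact ⟨h1.cons_cons a, by simp [h2]⟩
      · rintro ⟨h1, h2⟩
        cases h1 with
        | cons _ h => exact Or.inl ⟨h, h2⟩
        | cons_cons _ h => exact Or.inr ⟨_, ⟨h, by simpa using h2⟩, rfl⟩

theorem length_subsetsTimed_le (m : ℕ) (l : List A) :
    (subsetsTimed m l).val.length ≤ 2 ^ l.length := by
  induction l generalizing m with
  | nil => cases m <;> simp [subsetsTimed]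
  | cons a l ih =>
    cases m with
    | zero => simpa [subsetsTimed] using Nat.one_le_two_pow
    | succ m =>
      have h1 := ih m
      have h2 := ih (m + 1)
      simp only [subsetsTimed, Timed.bind_val, ops_val, List.length_append, mapTimed_val,
        List.length_map, List.length_cons, pow_succ]
      omega

/-- An exponential bound is harmless here: the lists in question are the samples `Q`, of length at
most 53. -/
theorem time_subsetsTimed_le (m : ℕ) (l : List A) :
    (subsetsTimed m l).time ≤ 4 ^ (l.length + 1) := by
  induction l generalizing m with
  | nil => cases m <;> simp [subsetsTimed]
  | cons a l ih =>
    cases m with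
    | zero => simpa [subsetsTimed] using Nat.one_le_pow _ _ (by norm_num)
    | succ m =>
      have h1 := ih m
      have h2 := ih (m + 1)
      have h3 := length_subsetsTimed_le m l
      have h4 := length_subsetsTimed_le (m + 1) l
      have h5 := time_mapTimed_le (fun s => ops 1 (a :: s)) (subsetsTimed m l).val 1
        fun _ _ => le_rfl
      have h6 : 2 ^ l.length ≤ 4 ^ l.length := Nat.pow_le_pow_left (by norm_num) _
      have h7 : 1 ≤ 4 ^ l.length := Nat.one_le_pow _ _ (by norm_num)
      simp only [subsetsTimed, Timed.bind_time, ops_time, List.length_cons, pow_succ] at *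
      omega

end TimedBasics

/-! ### Selection in linear time -/

/-- `p` is the entry with index `j` of the sorted list: it has at most `j` smaller entries, and more
than `j` entries are at most `p`. -/
def IsRank (l : List ℝ) (j : ℕ) (p : ℝ) : Prop :=
  l.countP (fun x => decide (x < p)) ≤ j ∧ j < l.countP fun x => decide (x ≤ p)

theorem List.countP_lt_add_count_eq (l : List ℝ) (p : ℝ) :
    l.countP (fun x => decide (x < p)) + l.countP (fun x => decide (x = p)) =
      l.countP fun x => decide (x ≤ p) := by
  induction l with
  | nil => rfl
  | cons a l ih =>
    simp only [List.countP_cons, decide_eq_true_eq]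
    rcases lt_trichotomy a p with h | h | h
    · simp only [h, h.ne, h.le, if_true, if_false]; omega
    · simp only [h, lt_irrefl, le_refl, if_true, if_false]; omega
    · simp only [h.not_gt, h.ne', h.not_ge, if_false]; omega

theorem IsRank.mem {l : List ℝ} {j : ℕ} {p : ℝ} (h : IsRank l j p) : p ∈ l := by
  have h1 := l.countP_lt_add_count_eq p
  have h2 : 0 < l.countP fun x => decide (x = p) := by
    have := h.1
    have := h.2
    omega
  obtain ⟨x, hx, hxp⟩ := List.countP_pos_iff.1 h2
  have : x = p := by simpa using hxp
  exact this ▸ hx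

theorem insertTimed_val (x : ℝ) (l : List ℝ) :
    (insertTimed x l).val = l.orderedInsert (· ≤ ·) x := by
  induction l with
  | nil => rfl
  | cons y l ih =>
    by_cases h : x ≤ y <;> simp [insertTimed, List.orderedInsert, h, ih]

theorem time_insertTimed_le (x : ℝ) (l : List ℝ) : (insertTimed x l).time ≤ 2 * l.length + 1 := by
  induction l with
  | nil => simp [insertTimed]
  | cons y l ih =>
    by_cases h : x ≤ y <;> simp [insertTimed, h] <;> omega

theorem sortTimed_val (l : List ℝ) : (sortTimed l).val = l.insertionSort (· ≤ ·) := by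
  induction l with
  | nil => rfl
  | cons x l ih => simp [sortTimed, ih, insertTimed_val]

theorem time_sortTimed_le (l : List ℝ) : (sortTimed l).time ≤ l.length ^ 2 := by
  induction l with
  | nil => simp [sortTimed]
  | cons x l ih =>
    have h := time_insertTimed_le x (sortTimed l).val
    rw [sortTimed_val] at h
    simp only [List.length_insertionSort] at h
    simp only [sortTimed, Timed.bind_time, List.length_cons, sortTimed_val]
    nlinarith

theorem isRank_sortTimed {l : List ℝ} {j : ℕ} (hj : j < l.length) :
    IsRank l j ((sortTimed l).val.getD j 0) := by
  rw [sortTimed_val]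
  have hp : (l.insertionSort (· ≤ ·)).Perm l := List.perm_insertionSort _ l
  have hs : (l.insertionSort (· ≤ ·)).Pairwise (· ≤ ·) := List.pairwise_insertionSort _ l
  unfold IsRank
  rw [← hp.countP_eq, ← hp.countP_eq]
  rw [← hp.length_eq] at hj
  generalize l.insertionSort (· ≤ ·) = s at hj hs
  rw [List.getD_eq_getElem s 0 hj]
  have hsd : s = s.take j ++ s[j] :: s.drop (j + 1) := by
    rw [← List.drop_eq_getElem_cons hj, List.take_append_drop]
  have hs' := hs
  rw [hsd, List.pairwise_append, List.pairwise_cons] at hs'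
  obtain ⟨-, ⟨h2, -⟩, h3⟩ := hs'
  have hl : (s.take j).length = j := by simp; omega
  generalize s[j] = q at *
  constructor
  · conv_lhs => rw [hsd]
    rw [List.countP_append]
    have : (q :: s.drop (j + 1)).countP (fun x => decide (x < q)) = 0 := by
      rw [List.countP_eq_zero]
      intro x hx
      rcases List.mem_cons.1 hx with rfl | hx
      · simp
      · simpa using h2 x hx
    rw [this]
    exact (Nat.add_zero _).trans_le (List.countP_le_length.trans hl.le)
  · conv_rhs => rw [hsd]
    rw [List.countP_append, List.countP_cons]
    have : (s.take j).countP (fun x => decide (x ≤ q)) = (s.take j).length := by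
      rw [List.countP_eq_length]
      intro x hx
      simpa using h3 x hx q (by simp)
    rw [this, hl]
    simp

theorem median_of_five_le (a b c d e p : ℝ) (l : List ℝ) (hl : l = [a, b, c, d, e])
    (h : (sortTimed l).val.getD 2 0 ≤ p) : 3 ≤ l.countP fun x => decide (x ≤ p) := by
  have hr := (isRank_sortTimed (l := l) (j := 2) (by simp [hl])).2
  refine hr.trans_le (List.countP_mono_left fun x _ hx => ?_)
  simp only [decide_eq_true_eq] at hx ⊢
  exact hx.trans h

theorem le_median_of_five (a b c d e p : ℝ) (l : List ℝ) (hl : l = [a, b, c, d, e])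
    (h : p ≤ (sortTimed l).val.getD 2 0) : l.countP (fun x => decide (x < p)) ≤ 2 := by
  have hr := (isRank_sortTimed (l := l) (j := 2) (by simp [hl])).1
  refine (List.countP_mono_left fun x _ hx => ?_).trans hr
  simp only [decide_eq_true_eq] at hx ⊢
  exact hx.trans_le h

/-- A group with median at most `p` contributes three entries at most `p`; a group with median at
least `p` contributes at most two entries below `p`. The last inequality is arranged to avoid
subtraction, and the skipped incomplete group enters only through its size, at most 4. -/
theorem mediansOfFive_spec (l : List ℝ) (p : ℝ) :
    5 * (mediansOfFive l).val.length ≤ l.length ∧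
      l.length ≤ 5 * (mediansOfFive l).val.length + 4 ∧
      (mediansOfFive l).time ≤ 7 * l.length + 1 ∧
      3 * (mediansOfFive l).val.countP (fun x => decide (x ≤ p)) ≤
        l.countP (fun x => decide (x ≤ p)) ∧
      3 * (mediansOfFive l).val.length + l.countP (fun x => decide (x < p)) ≤
        3 * (mediansOfFive l).val.countP (fun x => decide (x < p)) + l.length := by
  induction l using mediansOfFive.induct with
  | case1 a b c d e l ih =>
    obtain ⟨h1, h2, h3, h4, h5⟩ := ih
    have hs := time_sortTimed_le [a, b, c, d, e]
    have hm := fun h => median_of_five_le a b c d e p _ rfl h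
    have hm' := fun h => le_median_of_five a b c d e p _ rfl h
    have hc : ∀ f : ℝ → Bool, (a :: b :: c :: d :: e :: l).countP f =
        [a, b, c, d, e].countP f + l.countP f := fun f => by
      rw [← List.countP_append]; rfl
    have hlen : [a, b, c, d, e].countP (fun x => decide (x < p)) ≤ 5 := List.countP_le_length
    rw [hc, hc]
    generalize hM : mediansOfFive l = M at *
    generalize hS : sortTimed [a, b, c, d, e] = S at *
    simp only [mediansOfFive, hM, hS, Timed.bind_val, ops_val, Timed.bind_time, ops_time,
      List.length_cons, List.countP_cons (l := M.val), decide_eq_true_eq]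
    simp only [List.length_cons, List.length_nil] at hs
    refine ⟨by omega, by omega, by omega, ?_, ?_⟩
    · split_ifs with h
      · have := hm h
        omega
      · omega
    · split_ifs with h
      · omega
      · have := hm' (not_lt.1 h)
        omega
  | case2 l hl =>
    rw [mediansOfFive.eq_2 l hl]
    simp only [ops_val, ops_time, List.length_nil, List.countP_nil]
    have hlen : l.countP (fun x => decide (x < p)) ≤ l.length := List.countP_le_length
    refine ⟨by omega, ?_, by omega, by omega, by omega⟩
    match l, hl with
    | [], _ | [_], _ | [_, _], _ | [_, _, _], _ | [_, _, _, _], _ => simp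
    | a :: b :: c :: d :: e :: l, h => exact absurd rfl (h a b c d e l)

theorem splitTimed_val (p : ℝ) (l : List ℝ) :
    (splitTimed p l).val = (l.filter fun x => decide (x < p), l.filter fun x => decide (x = p),
      l.filter fun x => decide (p < x)) := by
  induction l with
  | nil => rfl
  | cons x l ih =>
    simp only [splitTimed, Timed.bind_val, ops_val, ih, List.filter_cons]
    rcases lt_trichotomy x p with h | h | h
    · simp [h, h.ne, h.not_gt]
    · simp [h]
    · simp [h, h.ne', h.not_gt]

theorem time_splitTimed_le (p : ℝ) (l : List ℝ) : (splitTimed p l).time ≤ 3 * l.length := by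
  induction l with
  | nil => simp [splitTimed]
  | cons x l ih =>
    simp only [splitTimed, Timed.bind_time, ops_time, ops_val, List.length_cons]
    rcases lt_trichotomy x p with h | h | h
    · simp [h]; omega
    · simp [h]; omega
    · simp [h.ne', h.not_gt]; omega

/-- Both counts in the rank of `q` concern only entries at most `q`, and these all survive the
filter because `q < p`. -/
theorem isRank_of_filter_lt {l : List ℝ} {p q : ℝ} {j : ℕ}
    (h : IsRank (l.filter fun x => decide (x < p)) j q) : IsRank l j q := by
  have hq : q < p := by simpa using (List.mem_filter.1 h.mem).2
  have key : ∀ f : ℝ → Bool, (∀ x, f x = true → x < p) →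
      (l.filter fun x => decide (x < p)).countP f = l.countP f := by
    intro f hf
    rw [List.countP_filter]
    congr 1
    ext x
    by_cases hx : f x = true
    · simp [hx, hf x hx]
    · simp [hx]
  unfold IsRank at h ⊢
  rw [key (fun x => decide (x < q)) fun x hx => ?_,
    key (fun x => decide (x ≤ q)) fun x hx => ?_] at h
  · exact h
  · simp only [decide_eq_true_eq] at hx
    linarith
  · simp only [decide_eq_true_eq] at hx
    linarith

theorem isRank_of_filter_gt {l : List ℝ} {p q : ℝ} {j : ℕ}
    (h : IsRank (l.filter fun x => decide (p < x)) j q) :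
    IsRank l (l.countP (fun x => decide (x ≤ p)) + j) q := by
  have hq : p < q := by simpa using (List.mem_filter.1 h.mem).2
  have key : ∀ f : ℝ → Bool, (∀ x, x ≤ p → f x = true) → l.countP f =
      l.countP (fun x => decide (x ≤ p)) +
        (l.filter fun x => decide (p < x)).countP f := by
    intro f hf
    rw [List.countP_eq_countP_filter_add l f fun x => decide (x ≤ p)]
    congr 1
    · rw [List.countP_filter]
      congr 1
      ext x
      by_cases hx : x ≤ p
      · simp [hx, hf x hx]
      · simp [hx]
    · congr 2
      ext x
      rcases le_or_gt x p with h | h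
      · simp [h, h.not_gt]
      · simp [h, h.not_ge]
  unfold IsRank at h ⊢
  rw [key _ fun x hx => ?_, key (fun x => decide (x ≤ q)) fun x hx => ?_]
  · omega
  · simp only [decide_eq_true_eq]
    linarith
  · simp only [decide_eq_true_eq]
    linarith

theorem length_filter_lt_eq_gt (l : List ℝ) (p : ℝ) :
    (l.filter fun x => decide (x < p)).length + (l.filter fun x => decide (x = p)).length +
      (l.filter fun x => decide (p < x)).length = l.length := by
  induction l with
  | nil => rfl
  | cons a l ih =>
    simp only [List.filter_cons, decide_eq_true_eq]
    rcases lt_trichotomy a p with h | h | h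
    · simp [h, h.ne, h.not_gt]; omega
    · simp [h]; omega
    · simp [h, h.ne', h.not_gt]; omega

/-- About three tenths of the entries are at most the pivot and about as many are at least the
pivot. So the two recursive calls concern roughly `n/5` and at most roughly `7n/10` entries, and a
linear bound closes because `1/5 + 7/10 < 1`; the threshold 50 absorbs the additive constants. -/
theorem selectTimed_spec (fuel : ℕ) (l : List ℝ) (j : ℕ) (hj : j < l.length)
    (hfuel : l.length ≤ fuel) :
    IsRank l j (selectTimed fuel l j).val ∧ (selectTimed fuel l j).time ≤ 200 * l.length := by
  induction fuel generalizing l j with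
  | zero => omega
  | succ fuel ih =>
    rw [selectTimed]
    simp only [Timed.bind_val, Timed.bind_time]
    by_cases hsmall : l.length ≤ 50
    · rw [if_pos (show (ops (l.length + 1) l.length).val ≤ 50 from hsmall)]
      refine ⟨isRank_sortTimed hj, ?_⟩
      have := time_sortTimed_le l
      simp only [Timed.bind_time, ops_time]
      nlinarith
    · rw [if_neg (show ¬ (ops (l.length + 1) l.length).val ≤ 50 from hsmall)]
      have hm := fun q => mediansOfFive_spec l q
      simp only [Timed.bind_val, Timed.bind_time]
      generalize mediansOfFive l = M at *
      obtain ⟨hp, ht⟩ := ih M.val (M.val.length / 2) (by have := hm 0; omega)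
        (by have := hm 0; omega)
      rw [show (ops (M.val.length + 1) (M.val.length / 2)).val = M.val.length / 2 from rfl]
      generalize selectTimed fuel M.val (M.val.length / 2) = p at *
      obtain ⟨h1, h2, h3, h4, h5⟩ := hm p.val
      have hs := time_splitTimed_le p.val l
      have hlen := length_filter_lt_eq_gt l p.val
      have hsum := l.countP_lt_add_count_eq p.val
      have hlt := l.countP_eq_length_filter (p := fun x => decide (x < p.val))
      have heq := l.countP_eq_length_filter (p := fun x => decide (x = p.val))
      have hv := splitTimed_val p.val l
      generalize splitTimed p.val l = s at *
      obtain ⟨⟨a, b, c⟩, st⟩ := s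
      obtain ⟨rfl, rfl, rfl⟩ : a = _ ∧ b = _ ∧ c = _ := by simpa using hv
      have hp1 := hp.1
      have hp2 := hp.2
      split_ifs with c1 c2
      · simp only [ops_val, ops_time] at *
        obtain ⟨hr, htime⟩ := ih (l.filter fun x => decide (x < p.val)) j c1 (by omega)
        refine ⟨isRank_of_filter_lt hr, ?_⟩
        omega
      · simp only [ops_val, ops_time] at *
        exact ⟨⟨by omega, by omega⟩, by omega⟩
      · simp only [ops_val, ops_time] at *
        obtain ⟨hr, htime⟩ := ih (l.filter fun x => decide (p.val < x))
          (j - (l.filter fun x => decide (x < p.val)).length -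
            (l.filter fun x => decide (x = p.val)).length) (by omega) (by omega)
        refine ⟨?_, by omega⟩
        have := isRank_of_filter_gt hr
        convert this using 1
        omega

theorem sumSmallest_time_le {m : ℕ} {l : List ℝ} (hm : 1 ≤ m) (hml : m ≤ l.length) :
    (sumSmallest m l).time ≤ 220 * l.length := by
  have h1 := (selectTimed_spec l.length l (m - 1) (by omega) le_rfl).2
  have h2 := time_splitTimed_le (selectTimed l.length l (m - 1)).val l
  have h3 := length_filter_lt_eq_gt l (selectTimed l.length l (m - 1)).val
  have h4 := time_sumTimed_le (fun y : ℝ => ops 1 y)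
    (l.filter fun x => decide (x < (selectTimed l.length l (m - 1)).val)) 1 fun _ _ => le_rfl
  simp only [sumSmallest, Timed.bind_time, ops_time, ops_val, splitTimed_val]
  omega

/-- `sumSmallest` computes the least total value of `m` elements. -/
theorem sumSmallest_val {A : Type} (P : Finset A) (f : A → ℝ) {m : ℕ} (hm : 1 ≤ m)
    (hmP : m ≤ P.card) :
    (∃ S ⊆ P, S.card = m ∧ (sumSmallest m (P.toList.map f)).val = ∑ x ∈ S, f x) ∧
      ∀ S ⊆ P, S.card = m → (sumSmallest m (P.toList.map f)).val ≤ ∑ x ∈ S, f x := by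
  classical
  obtain ⟨hr1, hr2⟩ := (selectTimed_spec (P.toList.map f).length (P.toList.map f) (m - 1)
    (by simp; omega) le_rfl).1
  simp only [sumSmallest, Timed.bind_val, ops_val, splitTimed_val]
  generalize (selectTimed (P.toList.map f).length (P.toList.map f) (m - 1)).val = p at *
  have hcount : ∀ g : ℝ → Prop, (P.toList.map f).countP (fun x => decide (g x)) =
      (P.filter fun x => g (f x)).card := by
    intro g
    rw [List.countP_map, Finset.card_def, Finset.filter_val, ← Multiset.countP_eq_card_filter,
      ← Finset.coe_toList P, Multiset.coe_countP]
    rfl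
  have hlen : ((P.toList.map f).filter fun x => decide (x < p)).length =
      (P.filter fun x => f x < p).card := by
    rw [← List.countP_eq_length_filter, hcount fun x => x < p]
  have hsum : (sumTimed (fun y : ℝ => ops 1 y)
      ((P.toList.map f).filter fun x => decide (x < p))).val =
      ∑ x ∈ P.filter (fun x => f x < p), f x := by
    rw [sumTimed_val, List.filter_map, List.map_map, Finset.sum_eq_multiset_sum, Finset.filter_val]
    conv_rhs => rw [← Finset.coe_toList P, Multiset.filter_coe, Multiset.map_coe, Multiset.sum_coe]
    rfl
  rw [hcount fun x => x < p] at hr1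
  rw [hcount fun x => x ≤ p] at hr2
  rw [hlen, hsum]
  have hle : (P.filter fun x => f x ≤ p).card =
      (P.filter fun x => f x < p).card + (P.filter fun x => f x = p).card := by
    rw [← Finset.card_union_of_disjoint]
    · congr 1
      ext x
      simp only [Finset.mem_filter, Finset.mem_union, le_iff_lt_or_eq]
      tauto
    · rw [Finset.disjoint_filter]
      intro x _ h1 h2
      exact h1.ne h2
  constructor
  -- Ties at `p` are broken arbitrarily: `U` fills up the entries below `p` to exactly `m` members.
  · obtain ⟨U, hU, hUc⟩ := Finset.exists_subset_card_eq
      (s := P.filter fun x => f x = p) (n := m - (P.filter fun x => f x < p).card) (by omega)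
    have hd : Disjoint (P.filter fun x => f x < p) U := by
      refine Finset.disjoint_of_subset_right hU ?_
      rw [Finset.disjoint_filter]
      intro x _ h1 h2
      exact h1.ne h2
    refine ⟨P.filter (fun x => f x < p) ∪ U, ?_, ?_, ?_⟩
    · exact Finset.union_subset (Finset.filter_subset _ _) (hU.trans (Finset.filter_subset _ _))
    · rw [Finset.card_union_of_disjoint hd]
      omega
    · rw [Finset.sum_union hd, Finset.sum_congr (g := fun _ => p) rfl fun x hx =>
        (Finset.mem_filter.1 (hU hx)).2, Finset.sum_const, hUc, nsmul_eq_mul,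
        Nat.cast_sub (by omega)]
  · intro S hS hSc
    -- After subtracting `p` from every value, the negative terms are exactly those below `p`, so
    -- collecting all of them gives the least possible sum. Since `S` has `m` members, the shift
    -- cancels at the end.
    have h1 : ∑ x ∈ P.filter (fun x => f x < p), (f x - p) ≤
        ∑ x ∈ S.filter (fun x => f x < p), (f x - p) := by
      rw [← neg_le_neg_iff, ← Finset.sum_neg_distrib, ← Finset.sum_neg_distrib]
      refine Finset.sum_le_sum_of_subset_of_nonneg (Finset.filter_subset_filter _ hS) ?_
      intro x hx _
      have := (Finset.mem_filter.1 hx).2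
      linarith
    have h2 : ∑ x ∈ S.filter (fun x => f x < p), (f x - p) ≤ ∑ x ∈ S, (f x - p) := by
      refine Finset.sum_le_sum_of_subset_of_nonneg (Finset.filter_subset _ _) ?_
      intro x hx hx'
      rw [Finset.mem_filter, not_and, not_lt] at hx'
      have := hx' hx
      linarith
    have h3 := h1.trans h2
    rw [Finset.sum_sub_distrib, Finset.sum_sub_distrib, Finset.sum_const, Finset.sum_const, hSc,
      nsmul_eq_mul, nsmul_eq_mul] at h3
    linarith

/-! ### Orthonormal bases and grids -/

section Grid

variable {d : ℕ}

/-- The members of a list are orthonormal vectors. -/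
def IsOrthonormalList (B : List (Pt d)) : Prop :=
  B.Pairwise (fun e f => inner ℝ e f = (0 : ℝ)) ∧ ∀ e ∈ B, ‖e‖ = 1

/-- The linear span of the members of a list. -/
def listSpan (B : List (Pt d)) : Submodule ℝ (Pt d) := Submodule.span ℝ {x | x ∈ B}

theorem mem_listSpan_of_mem {B : List (Pt d)} {x : Pt d} (h : x ∈ B) : x ∈ listSpan B :=
  Submodule.subset_span h

theorem listSpan_nil : listSpan ([] : List (Pt d)) = ⊥ := by
  simp [listSpan]

theorem listSpan_cons (e : Pt d) (B : List (Pt d)) :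
    listSpan (e :: B) = Submodule.span ℝ {e} ⊔ listSpan B := by
  rw [listSpan, listSpan, ← Submodule.span_union]
  congr 1
  ext x
  simp

/-- A component that has been cleared stays cleared, since the later projections are along vectors
orthogonal to it. -/
theorem inner_subtractProj (B : List (Pt d)) (v f : Pt d)
    (hf : ∀ e ∈ B, inner ℝ f e = (0 : ℝ)) :
    inner ℝ f (subtractProj B v).val = (inner ℝ f v : ℝ) := by
  induction B generalizing v with
  | nil => rfl
  | cons e B ih =>
    simp only [subtractProj, innerTimed, smulTimed, subTimed, Timed.bind_val, ops_val]
    rw [ih _ fun e' he' => hf e' (by simp [he']), inner_sub_right, inner_smul_right,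
      hf e (by simp)]
    ring

theorem subtractProj_orthogonal (B : List (Pt d)) (hB : IsOrthonormalList B) (v : Pt d) :
    ∀ e ∈ B, inner ℝ e (subtractProj B v).val = (0 : ℝ) := by
  induction B generalizing v with
  | nil => simp
  | cons e B ih =>
    obtain ⟨h1, h2⟩ := hB
    rw [List.pairwise_cons] at h1
    intro f hf
    simp only [subtractProj, innerTimed, smulTimed, subTimed, Timed.bind_val, ops_val]
    rcases List.mem_cons.1 hf with rfl | hf
    · rw [inner_subtractProj _ _ _ h1.1, inner_sub_right, inner_smul_right,
        real_inner_self_eq_norm_sq, h2 f (by simp)]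
      ring
    · exact ih ⟨h1.2, fun e he => h2 e (by simp [he])⟩ _ f hf

theorem sub_subtractProj_mem (B : List (Pt d)) (v : Pt d) :
    v - (subtractProj B v).val ∈ listSpan B := by
  induction B generalizing v with
  | nil => simp [subtractProj]
  | cons e B ih =>
    simp only [subtractProj, innerTimed, smulTimed, subTimed, Timed.bind_val, ops_val]
    have h := ih (v - (inner ℝ e v : ℝ) • e)
    rw [listSpan_cons]
    have : v - (subtractProj B (v - (inner ℝ e v : ℝ) • e)).val = (inner ℝ e v : ℝ) • e +
        (v - (inner ℝ e v : ℝ) • e - (subtractProj B (v - (inner ℝ e v : ℝ) • e)).val) := by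
      abel
    rw [this]
    exact Submodule.add_mem_sup (Submodule.smul_mem _ _ (Submodule.mem_span_singleton_self e)) h

theorem time_subtractProj (B : List (Pt d)) (v : Pt d) :
    (subtractProj B v).time = B.length * (4 * d) := by
  induction B generalizing v with
  | nil => simp [subtractProj]
  | cons e B ih =>
    simp only [subtractProj, innerTimed, smulTimed, subTimed, Timed.bind_time, ops_time, ops_val,
      ih, List.length_cons]
    ring

theorem orthoBasis_cons_of_eq (B : List (Pt d)) (v : Pt d) (l : List (Pt d))
    (h : (subtractProj B v).val = 0) :
    orthoBasis B (v :: l) =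
      ⟨(orthoBasis B l).val, B.length * (4 * d) + 2 * d + 1 + (orthoBasis B l).time⟩ := by
  have h' : ‖(subtractProj B v).val‖ = 0 := by rw [h, norm_zero]
  rw [orthoBasis]
  simp only [normTimed]
  have key : ∀ x : Timed (List (Pt d)), x = ⟨x.val, x.time⟩ := fun x => rfl
  rw [key (_ >>= _)]
  simp only [Timed.bind_val, Timed.bind_time, ops_val, ops_time, h', decide_true, if_true,
    time_subtractProj]
  congr 1
  ring

theorem orthoBasis_cons_of_ne (B : List (Pt d)) (v : Pt d) (l : List (Pt d))
    (h : (subtractProj B v).val ≠ 0) :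
    orthoBasis B (v :: l) =
      ⟨(orthoBasis (‖(subtractProj B v).val‖⁻¹ • (subtractProj B v).val :: B) l).val,
        B.length * (4 * d) + 3 * d + 2 +
          (orthoBasis (‖(subtractProj B v).val‖⁻¹ • (subtractProj B v).val :: B) l).time⟩ := by
  have h' : ‖(subtractProj B v).val‖ ≠ 0 := norm_ne_zero_iff.2 h
  rw [orthoBasis]
  simp only [normTimed]
  have key : ∀ x : Timed (List (Pt d)), x = ⟨x.val, x.time⟩ := fun x => rfl
  rw [key (_ >>= _)]
  simp only [Timed.bind_val, Timed.bind_time, ops_val, ops_time, h', decide_false,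
    Bool.false_eq_true, if_false, time_subtractProj, smulTimed]
  congr 1
  ring

/-- Only inclusions of spans are recorded: approximating points of the span of the sample does not
need the converse. -/
theorem orthoBasis_spec (l B : List (Pt d)) (hB : IsOrthonormalList B) :
    IsOrthonormalList (orthoBasis B l).val ∧ listSpan B ≤ listSpan (orthoBasis B l).val ∧
      listSpan l ≤ listSpan (orthoBasis B l).val := by
  induction l generalizing B with
  | nil => exact ⟨hB, le_rfl, by simp [listSpan_nil]⟩
  | cons v l ih =>
    have hv := sub_subtractProj_mem B v
    by_cases h : (subtractProj B v).val = 0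
    · rw [orthoBasis_cons_of_eq B v l h]
      obtain ⟨h1, h2, h3⟩ := ih B hB
      refine ⟨h1, h2, ?_⟩
      rw [h, sub_zero] at hv
      rw [listSpan_cons, sup_le_iff, Submodule.span_singleton_le_iff_mem]
      exact ⟨h2 hv, h3⟩
    · rw [orthoBasis_cons_of_ne B v l h]
      have ho := subtractProj_orthogonal B hB v
      set u := (subtractProj B v).val with hu
      have hnu : ‖u‖ ≠ 0 := norm_ne_zero_iff.2 h
      have hB' : IsOrthonormalList (‖u‖⁻¹ • u :: B) := by
        refine ⟨List.pairwise_cons.2 ⟨fun e he => ?_, hB.1⟩, fun e he => ?_⟩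
        · rw [inner_smul_left, real_inner_comm, ho e he]
          simp
        · rcases List.mem_cons.1 he with rfl | he
          · rw [norm_smul, norm_inv, norm_norm, inv_mul_cancel₀ hnu]
          · exact hB.2 e he
      obtain ⟨h1, h2, h3⟩ := ih (‖u‖⁻¹ • u :: B) hB'
      refine ⟨h1, le_trans ?_ h2, ?_⟩
      · rw [listSpan_cons]
        exact le_sup_right
      · rw [listSpan_cons, sup_le_iff, Submodule.span_singleton_le_iff_mem]
        refine ⟨h2 ?_, h3⟩
        rw [listSpan_cons]
        have : v = ‖u‖ • (‖u‖⁻¹ • u) + (v - u) := by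
          rw [smul_smul, mul_inv_cancel₀ hnu]
          simp
        rw [this]
        exact Submodule.add_mem_sup
          (Submodule.smul_mem _ _ (Submodule.mem_span_singleton_self _)) hv

theorem length_orthoBasis_le (l B : List (Pt d)) :
    (orthoBasis B l).val.length ≤ B.length + l.length := by
  induction l generalizing B with
  | nil => simp [orthoBasis]
  | cons v l ih =>
    by_cases h : (subtractProj B v).val = 0
    · rw [orthoBasis_cons_of_eq B v l h]
      exact (ih B).trans (by simp)
    · rw [orthoBasis_cons_of_ne B v l h]
      refine (ih _).trans ?_
      simp only [List.length_cons]
      omega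

theorem time_orthoBasis_le (l B : List (Pt d)) (n : ℕ) (hn : B.length + l.length ≤ n) :
    (orthoBasis B l).time ≤ l.length * (n * (4 * d) + 3 * d + 2) := by
  induction l generalizing B with
  | nil => simp [orthoBasis]
  | cons v l ih =>
    simp only [List.length_cons] at hn
    have hBn : B.length * (4 * d) ≤ n * (4 * d) := Nat.mul_le_mul_right _ (by omega)
    simp only [List.length_cons]
    rw [Nat.add_one_mul]
    by_cases h : (subtractProj B v).val = 0
    · rw [orthoBasis_cons_of_eq B v l h]
      have := ih B (by omega)
      simp only
      omega
    · rw [orthoBasis_cons_of_ne B v l h]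
      have := ih (‖(subtractProj B v).val‖⁻¹ • (subtractProj B v).val :: B)
        (by simp only [List.length_cons]; omega)
      simp only
      omega

theorem self_mem_gridBox (θ : ℝ) (K : ℕ) (B : List (Pt d)) (p : Pt d) :
    p ∈ (gridBox θ K B p).val := by
  induction B generalizing p with
  | nil => simp [gridBox]
  | cons e B ih =>
    rw [gridBox, mem_collect_val]
    -- The loop index `z` stands for the coefficient `z - K`, so index `K` is the zero coefficient.
    refine ⟨K, by simp; omega, ?_⟩
    simp only [smulTimed, addTimed, Timed.bind_val, ops_val]
    simpa using ih p

/-- Every point of the span that is not too far away is approximated by a grid point. -/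
theorem exists_mem_gridBox {θ : ℝ} (hθ : 0 < θ) (K : ℕ) (B : List (Pt d))
    (hB : IsOrthonormalList B) (p w : Pt d) (hw : w ∈ listSpan B)
    (hK : ‖w‖ + θ / 2 < θ * (K + 1)) :
    ∃ q ∈ (gridBox θ K B p).val, ‖q - (p + w)‖ ≤ B.length * (θ / 2) := by
  induction B generalizing p w with
  | nil =>
    rw [listSpan_nil, Submodule.mem_bot] at hw
    exact ⟨p, by simp [gridBox], by simp [hw]⟩
  | cons e B ih =>
    obtain ⟨h1, h2⟩ := hB
    rw [List.pairwise_cons] at h1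
    rw [listSpan_cons] at hw
    obtain ⟨u, hu, w', hw', rfl⟩ := Submodule.mem_sup.1 hw
    obtain ⟨s, rfl⟩ := Submodule.mem_span_singleton.1 hu
    have he : ‖e‖ = 1 := h2 e (by simp)
    have hort : inner ℝ (s • e) w' = (0 : ℝ) := by
      rw [inner_smul_left]
      have hsp : listSpan B ≤ (Submodule.span ℝ {e})ᗮ := by
        refine Submodule.span_le.2 fun f hf => ?_
        exact Submodule.mem_orthogonal_singleton_iff_inner_right.2 (h1.1 f hf)
      rw [Submodule.mem_orthogonal_singleton_iff_inner_right.1 (hsp hw')]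
      simp
    have hnorm : ‖s • e + w'‖ * ‖s • e + w'‖ = ‖s • e‖ * ‖s • e‖ + ‖w'‖ * ‖w'‖ :=
      norm_add_sq_eq_norm_sq_add_norm_sq_of_inner_eq_zero _ _ hort
    have hse : ‖s • e‖ = |s| := by rw [norm_smul, he, mul_one, Real.norm_eq_abs]
    have hs : |s| ≤ ‖s • e + w'‖ := by
      rw [← hse]
      exact abs_le_of_sq_le_sq' (by nlinarith [norm_nonneg w']) (norm_nonneg _) |>.2
    have hw'n : ‖w'‖ ≤ ‖s • e + w'‖ :=
      abs_le_of_sq_le_sq' (by nlinarith [norm_nonneg (s • e)]) (norm_nonneg _) |>.2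
    -- Each coordinate is rounded to the nearest multiple of `θ`. This costs `θ / 2` per basis
    -- vector, and the errors are added by the triangle inequality.
    set z : ℤ := round (s / θ) with hz
    have hround : |s - θ * z| ≤ θ / 2 := by
      have := abs_sub_round (s / θ)
      have h3 : s - θ * z = θ * (s / θ - round (s / θ)) := by
        rw [mul_sub, mul_div_cancel₀ _ hθ.ne']
      rw [h3, abs_mul, abs_of_pos hθ]
      nlinarith
    have hzK : |z| ≤ K := by
      have h4 : |(z : ℝ)| < K + 1 := by
        have h5 : |θ * (z : ℝ)| ≤ |s| + θ / 2 := by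
          have : θ * (z : ℝ) = s - (s - θ * z) := by ring
          rw [this]
          exact (abs_sub _ _).trans (by linarith)
        rw [abs_mul, abs_of_pos hθ] at h5
        exact lt_of_mul_lt_mul_left (by linarith) hθ.le
      have h6 : |z| < (K : ℤ) + 1 := by exact_mod_cast h4
      omega
    rw [abs_le] at hzK
    obtain ⟨q, hq, hqn⟩ := ih ⟨h1.2, fun f hf => h2 f (by simp [hf])⟩
      (p + (θ * z) • e) w' hw' (by linarith)
    refine ⟨q, ?_, ?_⟩
    · rw [gridBox, mem_collect_val]
      refine ⟨(z + K).toNat, by rw [List.mem_range]; omega, ?_⟩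
      simp only [smulTimed, addTimed, Timed.bind_val, ops_val]
      have h7 : (((z + K).toNat : ℕ) : ℝ) - K = z := by
        have h8 : (((z + K).toNat : ℕ) : ℤ) = z + K := Int.toNat_of_nonneg (by omega)
        have h9 : (((z + K).toNat : ℕ) : ℝ) = z + K := by exact_mod_cast h8
        rw [h9]
        ring
      rw [h7]
      exact hq
    · have h10 : q - (p + (s • e + w')) = (q - (p + (θ * z) • e + w')) - (s - θ * z) • e := by
        rw [sub_smul]
        abel
      rw [h10]
      refine (norm_sub_le _ _).trans ?_
      rw [norm_smul, he, mul_one, Real.norm_eq_abs]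
      simp only [List.length_cons, Nat.cast_add, Nat.cast_one]
      linarith

theorem length_gridBox_le (θ : ℝ) (K : ℕ) (B : List (Pt d)) (p : Pt d) :
    (gridBox θ K B p).val.length ≤ (2 * K + 1) ^ B.length := by
  induction B generalizing p with
  | nil => simp [gridBox]
  | cons e B ih =>
    rw [gridBox, List.length_cons, pow_succ']
    refine (length_collect_le _ _ ((2 * K + 1) ^ B.length) fun z _ => ?_).trans (by simp)
    exact ih _

theorem time_gridBox_le (θ : ℝ) (K : ℕ) (B : List (Pt d)) (p : Pt d) :
    (gridBox θ K B p).time ≤ (2 * K + 1) ^ B.length * (B.length * (2 * d + 5) + 1) := by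
  induction B generalizing p with
  | nil => simp [gridBox]
  | cons e B ih =>
    rw [gridBox, List.length_cons, pow_succ']
    refine (time_collect_le _ _
      (3 + d + d + (2 * K + 1) ^ B.length * (B.length * (2 * d + 5) + 1))
      ((2 * K + 1) ^ B.length) (fun z _ => ?_) fun z _ => ?_).trans ?_
    · simp only [smulTimed, addTimed, Timed.bind_time, ops_time, ops_val]
      have := ih (p + (θ * ((z : ℝ) - (K : ℝ))) • e)
      omega
    · exact length_gridBox_le θ K B _
    · rw [List.length_range, mul_assoc]
      refine Nat.mul_le_mul_left _ ?_
      have h1 : 1 ≤ (2 * K + 1) ^ B.length := Nat.one_le_pow _ _ (by omega)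
      nlinarith

theorem candidateSet_mem_iff (α ε : ℝ) (R : List (Pt d)) (t : ℝ) (q : Pt d) :
    q ∈ (candidateSet α ε R t).val ↔ ∃ r ∈ R,
      q ∈ (gridBox (α * ε * t / (4 * (R.length : ℝ))) ⌊8 * (R.length : ℝ) / (α * ε)⌋₊
        (orthoBasis [] R).val r).val ∧ dist q r ≤ 2 * t := by
  simp only [candidateSet, Timed.bind_val, ops_val, mem_collect_val, distTimed]
  refine exists_congr fun r => and_congr_right fun _ => ?_
  constructor
  · rintro ⟨q', hq', h⟩
    by_cases hd : dist q' r ≤ 2 * t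
    · simp only [hd, decide_true, if_true, ops_val, List.mem_singleton] at h
      exact h ▸ ⟨hq', hd⟩
    · simp [hd] at h
  · rintro ⟨hq, hd⟩
    exact ⟨q, hq, by simp [hd]⟩

theorem self_mem_candidateSet (α ε : ℝ) {R : List (Pt d)} {t : ℝ} (ht : 0 ≤ t) {r : Pt d}
    (hr : r ∈ R) : r ∈ (candidateSet α ε R t).val :=
  (candidateSet_mem_iff ..).2 ⟨r, hr, self_mem_gridBox _ _ _ _, by simpa using ht⟩

/-- Every point of the span of `R` in a ball around a member of `R` is approximated by a
candidate. -/
theorem exists_mem_candidateSet {α ε : ℝ} (hα : 0 < α) (hε : 0 < ε) {R : List (Pt d)} {t : ℝ}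
    (ht : 0 < t) {r q : Pt d} (hr : r ∈ R) (hq : q ∈ listSpan R)
    (hd : dist q r + α * ε * t / 8 ≤ 2 * t) :
    ∃ q' ∈ (candidateSet α ε R t).val, dist q' q ≤ α * ε * t / 8 := by
  have hR : 0 < R.length := List.length_pos_of_mem hr
  have hN : (1 : ℝ) ≤ R.length := by exact_mod_cast hR
  set N : ℝ := (R.length : ℝ) with hNdef
  set θ := α * ε * t / (4 * N) with hθ
  have hθ0 : 0 < θ := by positivity
  have hNθ : N * (θ / 2) = α * ε * t / 8 := by
    rw [hθ]
    field_simp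
    ring
  have hθN : θ / 2 ≤ N * (θ / 2) := by nlinarith
  obtain ⟨h1, -, h2⟩ := orthoBasis_spec R [] ⟨List.Pairwise.nil, by simp⟩
  have hw : q - r ∈ listSpan (orthoBasis [] R).val :=
    h2 (Submodule.sub_mem _ hq (mem_listSpan_of_mem hr))
  -- The box reaches beyond `2t = θ * (8N / (αε))`; the room for rounding comes from the slack
  -- `αεt/8 ≥ θ/2` in `hd`.
  have hK : ‖q - r‖ + θ / 2 < θ * (⌊8 * N / (α * ε)⌋₊ + 1) := by
    have h3 := Nat.lt_floor_add_one (8 * N / (α * ε))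
    have h4 : θ * (8 * N / (α * ε)) = 2 * t := by
      rw [hθ]
      field_simp
      ring
    have h5 := mul_lt_mul_of_pos_left h3 hθ0
    rw [dist_eq_norm] at hd
    linarith
  obtain ⟨q', hq', hn⟩ := exists_mem_gridBox hθ0 _ _ h1 r (q - r) hw hK
  have hlen : ((orthoBasis [] R).val.length : ℝ) ≤ N := by
    have := length_orthoBasis_le R []
    simp only [List.length_nil, zero_add] at this
    rw [hNdef]
    exact_mod_cast this
  have hdist : dist q' q ≤ α * ε * t / 8 := by
    rw [dist_eq_norm, ← hNθ]
    have : q' - q = q' - (r + (q - r)) := by abel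
    rw [this]
    exact hn.trans (by gcongr)
  refine ⟨q', (candidateSet_mem_iff ..).2 ⟨r, hr, hq', ?_⟩, hdist⟩
  linarith [dist_triangle q' q r]

theorem length_candidateSet_le (α ε : ℝ) (R : List (Pt d)) (t : ℝ) :
    (candidateSet α ε R t).val.length ≤
      R.length * (2 * ⌊8 * (R.length : ℝ) / (α * ε)⌋₊ + 1) ^ R.length := by
  simp only [candidateSet, Timed.bind_val, ops_val]
  refine length_collect_le _ _ _ fun r _ => (length_collect_le _ _ 1 fun q _ => ?_).trans ?_
  · simp only [distTimed, Timed.bind_val, ops_val]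
    by_cases h : dist q r ≤ 2 * t <;> simp [h]
  · rw [mul_one]
    refine (length_gridBox_le _ _ _ _).trans (Nat.pow_le_pow_right (by omega) ?_)
    simpa using length_orthoBasis_le R []

theorem time_candidateSet_le (α ε : ℝ) (R : List (Pt d)) (t : ℝ) (N M : ℕ) (hN : R.length = N)
    (hN1 : 1 ≤ N) (hd : 1 ≤ d) (hM : (2 * ⌊8 * (R.length : ℝ) / (α * ε)⌋₊ + 1) ^ R.length = M) :
    (candidateSet α ε R t).time ≤ 40 * N ^ 2 * M * d := by
  have hM1 : 1 ≤ M := hM ▸ Nat.one_le_pow _ _ (by omega)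
  have hBlen := length_orthoBasis_le R []
  simp only [List.length_nil, zero_add, hN] at hBlen
  have hG : ∀ r, (gridBox (α * ε * t / (4 * (R.length : ℝ))) ⌊8 * (R.length : ℝ) / (α * ε)⌋₊
      (orthoBasis [] R).val r).val.length ≤ M := fun r => by
    refine (length_gridBox_le _ _ _ _).trans ?_
    rw [← hM, hN]
    exact Nat.pow_le_pow_right (by omega) hBlen
  have hGt : ∀ r, (gridBox (α * ε * t / (4 * (R.length : ℝ))) ⌊8 * (R.length : ℝ) / (α * ε)⌋₊
      (orthoBasis [] R).val r).time ≤ M * (N * (2 * d + 5) + 1) := fun r => by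
    refine (time_gridBox_le _ _ _ _).trans ?_
    refine Nat.mul_le_mul ?_ (by gcongr)
    rw [← hM, hN]
    exact Nat.pow_le_pow_right (by omega) hBlen
  have hO := time_orthoBasis_le R [] N (by simp [hN])
  simp only [candidateSet, ops_val, Timed.bind_time, ops_time]
  refine (Nat.add_le_add_left (Nat.add_le_add_left (Nat.add_le_add_left (Nat.add_le_add hO
    (time_collect_le _ _ (M * (N * (2 * d + 5) + 1) + M * (3 * d + 5)) M
      (fun r _ => ?_) fun r _ => ?_)) _) _) _).trans ?_
  · simp only [Timed.bind_time]
    refine Nat.add_le_add (hGt r) ((time_collect_le _ _ (3 * d + 3) 1 (fun q _ => ?_)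
      fun q _ => ?_).trans ?_)
    · simp only [distTimed, Timed.bind_time, ops_val, ops_time]
      by_cases h : dist q r ≤ 2 * t <;> simp [h]
    · simp only [distTimed, Timed.bind_val, ops_val]
      by_cases h : dist q r ≤ 2 * t <;> simp [h]
    · exact Nat.mul_le_mul (hG r) (by omega)
  · refine (length_collect_le _ _ 1 fun q _ => ?_).trans (by simpa using hG r)
    simp only [distTimed, Timed.bind_val, ops_val]
    by_cases h : dist q r ≤ 2 * t <;> simp [h]
  · rw [hN]
    obtain ⟨d, rfl⟩ : ∃ d', d = d' + 1 := ⟨d - 1, by omega⟩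
    obtain ⟨M, rfl⟩ : ∃ M', M = M' + 1 := ⟨M - 1, by omega⟩
    obtain ⟨N, rfl⟩ : ∃ N', N = N' + 1 := ⟨N - 1, by omega⟩
    ring_nf
    nlinarith [Nat.zero_le (N * M * d), Nat.zero_le (N ^ 2 * M * d), Nat.zero_le (N * M),
      Nat.zero_le (N ^ 2 * M), Nat.zero_le (N * d), Nat.zero_le (N ^ 2 * d), Nat.zero_le (M * d)]

end Grid

/-! ### Good candidates and the cost of the chosen center -/

section ClusterCost

variable {d : ℕ}

/-- The total amount by which points of `T` are farther from `q` than from `c`. -/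
noncomputable def excess (T : Finset (Pt d)) (q c : Pt d) : ℝ :=
  ∑ x ∈ T, max (dist x q - dist x c) 0

theorem excess_nonneg (T : Finset (Pt d)) (q c : Pt d) : 0 ≤ excess T q c :=
  Finset.sum_nonneg fun _ _ => le_max_right _ _

theorem excess_self (T : Finset (Pt d)) (c : Pt d) : excess T c c = 0 := by
  simp [excess]

/-- This is why the excess uses positive parts: one number controls every subset of `T` at once, in
particular the unknown part of `T` inside a trimmed set. -/
theorem sum_dist_le_add_excess {S T : Finset (Pt d)} (h : S ⊆ T) (q c : Pt d) :
    ∑ x ∈ S, dist x q ≤ ∑ x ∈ S, dist x c + excess T q c := by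
  calc ∑ x ∈ S, dist x q ≤ ∑ x ∈ S, (dist x c + max (dist x q - dist x c) 0) :=
        Finset.sum_le_sum fun x _ => by linarith [le_max_left (dist x q - dist x c) 0]
    _ = ∑ x ∈ S, dist x c + ∑ x ∈ S, max (dist x q - dist x c) 0 := Finset.sum_add_distrib
    _ ≤ _ := by
        gcongr
        exact Finset.sum_le_sum_of_subset_of_nonneg h fun _ _ _ => le_max_right _ _

/-- The excess is Lipschitz in the candidate with constant `|T|`; this prices the rounding to the
grid. -/
theorem excess_le_add_dist (T : Finset (Pt d)) (q q' c : Pt d) :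
    excess T q' c ≤ excess T q c + T.card * dist q' q := by
  unfold excess
  rw [← nsmul_eq_mul, ← Finset.sum_const, ← Finset.sum_add_distrib]
  refine Finset.sum_le_sum fun x _ => max_le ?_ ?_
  · have := dist_triangle x q q'
    rw [dist_comm q' q]
    linarith [le_max_left (dist x q - dist x c) 0]
  · linarith [le_max_right (dist x q - dist x c) 0, dist_nonneg (x := q') (y := q)]

/-- `q` is good enough as a center for `T`, compared with `c`. -/
def IsGoodCenter (α ε : ℝ) (T : Finset (Pt d)) (c q : Pt d) : Prop :=
  excess T q c * (1 + α - 2 * α ^ 2) ≤ (ε * α + 2 * α ^ 2) * ∑ x ∈ T, dist x c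

open scoped Classical in
/-- If `q` is a good center for the correctly labeled points, then a center whose trimmed cost
is not larger than that of `q` approximates the cost of the optimal cluster. -/
theorem sum_dist_le_of_isGoodCenter {α ε : ℝ} (hα : 0 < α) (hα' : α < 1 / 2)
    (hε : 0 < ε) {P Y N : Finset (Pt d)} {c q z : Pt d} (hP : P.Nonempty)
    (hrate : (1 - α) * max (P.card : ℝ) (Y.card : ℝ) ≤ ((P ∩ Y).card : ℝ))
    (hN : N ⊆ P) (hNc : N.card = ⌈(1 - α) * (P.card : ℝ)⌉₊)
    (hmin : ∀ S ⊆ P, S.card = ⌈(1 - α) * (P.card : ℝ)⌉₊ →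
      ∑ x ∈ N, dist x z ≤ ∑ x ∈ S, dist x q)
    (hq : IsGoodCenter α ε (P ∩ Y) c q) :
    ∑ x ∈ Y, dist x z ≤
      (1 + (6 * α - 4 * α ^ 2 + ε * α) / ((1 - α) * (1 - 2 * α))) * ∑ x ∈ Y, dist x c := by
  set T := P ∩ Y with hT
  set M := max (P.card : ℝ) (Y.card : ℝ) with hM
  have hMP : (P.card : ℝ) ≤ M := le_max_left _ _
  have hMY : (Y.card : ℝ) ≤ M := le_max_right _ _
  have hP0 : (0 : ℝ) < P.card := by exact_mod_cast hP.card_pos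
  have hM0 : 0 < M := hP0.trans_le hMP
  set C := ∑ x ∈ T, dist x c with hC
  set e := excess T q c with he
  have he0 : 0 ≤ e := excess_nonneg T q c
  have hC0 : 0 ≤ C := Finset.sum_nonneg fun _ _ => dist_nonneg
  have hCO : C ≤ ∑ x ∈ Y, dist x c :=
    Finset.sum_le_sum_of_subset_of_nonneg Finset.inter_subset_right fun _ _ _ => dist_nonneg
  have hAT : N ∩ Y ⊆ T := Finset.inter_subset_inter_right hN
  have hNge : (1 - α) * P.card ≤ (N.card : ℝ) := hNc ▸ Nat.le_ceil _
  have hNT : N.card ≤ T.card := by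
    rw [hNc]
    refine Nat.ceil_le.2 (le_trans ?_ hrate)
    have : 0 ≤ 1 - α := by linarith
    gcongr
  have hab : ((N ∩ Y).card : ℝ) + (N \ Y).card = N.card := by
    exact_mod_cast Finset.card_inter_add_card_sdiff N Y
  have hPT : ((P \ Y).card : ℝ) + T.card = P.card := by
    rw [add_comm]
    exact_mod_cast Finset.card_inter_add_card_sdiff P Y
  have hb : ((N \ Y).card : ℝ) ≤ (P \ Y).card := by
    exact_mod_cast Finset.card_le_card (Finset.sdiff_subset_sdiff hN le_rfl)
  have hYa : ((Y \ N).card : ℝ) + (N ∩ Y).card = Y.card := by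
    rw [add_comm, Finset.inter_comm]
    exact_mod_cast Finset.card_inter_add_card_sdiff Y N
  have hbM : ((N \ Y).card : ℝ) ≤ α * M := by linarith
  -- `N` has at least `(1 - α)|P|` points, of which at most `|P| - |T|` lie outside `Y`; what
  -- remains is at least `|T| - α|P|`.
  have haM : (1 - 2 * α) * M ≤ ((N ∩ Y).card : ℝ) := by
    linarith [mul_le_mul_of_nonneg_left hMP hα.le]
  have hYM : ((Y \ N).card : ℝ) ≤ 2 * α * M := by linarith
  have hsplit : ∀ p : Pt d, ∑ x ∈ N, dist x p =
      ∑ x ∈ N ∩ Y, dist x p + ∑ x ∈ N \ Y, dist x p := fun p =>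
    (Finset.sum_inter_add_sum_sdiff N Y _).symm
  have hsplitY : ∀ p : Pt d, ∑ x ∈ Y, dist x p =
      ∑ x ∈ N ∩ Y, dist x p + ∑ x ∈ Y \ N, dist x p := fun p => by
    rw [Finset.inter_comm]
    exact (Finset.sum_inter_add_sum_sdiff Y N _).symm
  have hu : ∑ x ∈ N ∩ Y, dist x c ≤ C :=
    Finset.sum_le_sum_of_subset_of_nonneg hAT fun _ _ _ => dist_nonneg
  have hqA := sum_dist_le_add_excess hAT q c
  -- Minimality is used twice. Comparing with `N` itself bounds the cost of `z` on `N ∩ Y` up to the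
  -- mislabeled points; comparing below with some `S ⊆ T` of the same size bounds the whole trimmed
  -- cost by `C + e`.
  have h1 := hmin N hN hNc
  rw [hsplit z, hsplit q] at h1
  have h2 : ∑ x ∈ N \ Y, dist x q ≤ ∑ x ∈ N \ Y, dist x z + (N \ Y).card * dist z q := by
    rw [← nsmul_eq_mul, ← Finset.sum_const, ← Finset.sum_add_distrib]
    exact Finset.sum_le_sum fun x _ => dist_triangle x z q
  obtain ⟨S, hS, hSc⟩ := Finset.exists_subset_card_eq hNT
  have h3 := hmin S (hS.trans Finset.inter_subset_left) (hSc.trans hNc)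
  have h4 := sum_dist_le_add_excess hS q c
  have h5 : ∑ x ∈ S, dist x c ≤ C :=
    Finset.sum_le_sum_of_subset_of_nonneg hS fun _ _ _ => dist_nonneg
  have h6 : 0 ≤ ∑ x ∈ N \ Y, dist x z := Finset.sum_nonneg fun _ _ => dist_nonneg
  have h7 : ∀ p p' : Pt d, ((N ∩ Y).card : ℝ) * dist p p' ≤
      ∑ x ∈ N ∩ Y, dist x p + ∑ x ∈ N ∩ Y, dist x p' := fun p p' => by
    rw [← nsmul_eq_mul, ← Finset.sum_const, ← Finset.sum_add_distrib]
    exact Finset.sum_le_sum fun x _ => dist_triangle_left p p' x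
  have h8 : ∑ x ∈ Y \ N, dist x z ≤ ∑ x ∈ Y \ N, dist x c + (Y \ N).card * dist c z := by
    rw [← nsmul_eq_mul, ← Finset.sum_const, ← Finset.sum_add_distrib]
    exact Finset.sum_le_sum fun x _ => dist_triangle x c z
  have hg : ∑ x ∈ N ∩ Y, dist x z ≤ C + e := by
    rw [hsplit z] at h3
    linarith
  have hD1 : (1 - 2 * α) * (M * dist z q) ≤ 2 * (C + e) := by
    have := h7 z q
    linarith [mul_le_mul_of_nonneg_right haM (dist_nonneg (x := z) (y := q))]
  have hD2 : (1 - 2 * α) * (M * dist c z) ≤ 2 * C + e := by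
    have := h7 c z
    linarith [mul_le_mul_of_nonneg_right haM (dist_nonneg (x := c) (y := z))]
  have hb1 : ((N \ Y).card : ℝ) * dist z q ≤ α * (M * dist z q) := by
    rw [← mul_assoc]
    gcongr
  have hb2 : ((Y \ N).card : ℝ) * dist c z ≤ 2 * α * (M * dist c z) := by
    rw [← mul_assoc]
    gcongr
  have htotal : ∑ x ∈ Y, dist x z ≤
      ∑ x ∈ Y, dist x c + (e + α * (M * dist z q) + 2 * α * (M * dist c z)) := by
    rw [hsplitY z, hsplitY c]
    linarith
  have hα1 : 0 < 1 - α := by linarith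
  have hα2 : 0 < 1 - 2 * α := by linarith
  refine htotal.trans ?_
  rw [add_mul, one_mul]
  gcongr
  rw [div_mul_eq_mul_div, le_div_iff₀ (mul_pos hα1 hα2)]
  unfold IsGoodCenter at hq
  have hf : 0 ≤ 6 * α - 4 * α ^ 2 + ε * α := by
    have k3 : 6 * α - 4 * α ^ 2 + ε * α = α * (4 * (1 - α) + 2 + ε) := by ring
    rw [k3]
    positivity
  -- Inserting `hD1` and `hD2`, the left side is at most `(1 - α)((1 + 2α) e + 6α C)`. The
  -- coefficient of `e` is `1 + α - 2α²`, and the budget left after `6α(1 - α) C` is `(εα + 2α²) C`: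
  -- this is exactly the inequality defining `IsGoodCenter`.
  have hkey : (e + α * (M * dist z q) + 2 * α * (M * dist c z)) * ((1 - α) * (1 - 2 * α)) ≤
      (6 * α - 4 * α ^ 2 + ε * α) * C := by
    have k1 := mul_le_mul_of_nonneg_left hD1 (mul_nonneg hα.le hα1.le)
    have k2 := mul_le_mul_of_nonneg_left hD2 (mul_nonneg hα.le hα1.le)
    linarith
  exact hkey.trans (mul_le_mul_of_nonneg_left hCO hf)

end ClusterCost

/-! ### Random samples span good centers -/

section SpanSampling

variable {d : ℕ}

/-- The line through `q` and `x` comes closer to `c` than `q` if `x` is farther from `q` than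
from `c`. -/
theorem exists_sq_dist_add_sq_excess_le (c q x : Pt d) :
    ∃ s : ℝ, dist c (q + s • (x - q)) ^ 2 + max (dist x q - dist x c) 0 ^ 2 ≤ dist c q ^ 2 := by
  rcases le_or_gt (dist x q - dist x c) 0 with h | h
  · exact ⟨0, by simp [max_eq_right h]⟩
  · rw [max_eq_left h.le]
    have hφ : 0 < dist x q := by linarith [dist_nonneg (x := x) (y := c)]
    rw [dist_eq_norm] at hφ
    have h1 : dist x c ^ 2 = ‖x - q‖ ^ 2 - 2 * inner ℝ (c - q) (x - q) + ‖c - q‖ ^ 2 := by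
      rw [dist_eq_norm, show x - c = (x - q) - (c - q) by abel, norm_sub_sq_real,
        real_inner_comm]
    have h2 : ∀ s : ℝ, dist c (q + s • (x - q)) ^ 2 =
        ‖c - q‖ ^ 2 - 2 * (s * inner ℝ (c - q) (x - q)) + s ^ 2 * ‖x - q‖ ^ 2 := by
      intro s
      rw [dist_eq_norm, show c - (q + s • (x - q)) = (c - q) - s • (x - q) by abel,
        norm_sub_sq_real, inner_smul_right, norm_smul, mul_pow, Real.norm_eq_abs, sq_abs]
    have h3 : dist x q - dist x c ≤ dist c q := by
      linarith [dist_triangle x c q]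
    -- Move from `q` towards `x` by exactly the length `e = dist x q - dist x c`. Since `e ≤ dist c
    -- q`, the law of cosines gives an inner product of at least `e * ‖x - q‖`, so the squared
    -- distance drops by at least `2e² - e²`.
    refine ⟨(dist x q - dist x c) / ‖x - q‖, ?_⟩
    rw [h2]
    rw [dist_eq_norm x q, dist_eq_norm c q] at *
    set e := ‖x - q‖ - dist x c with he
    set I : ℝ := inner ℝ (c - q) (x - q) with hI
    have h4 : e * ‖x - q‖ ≤ I := by
      have h5 : dist x c = ‖x - q‖ - e := by rw [he]; ring
      rw [h5] at h1
      nlinarith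
    have h6 : e ^ 2 ≤ e / ‖x - q‖ * I := by
      rw [div_mul_eq_mul_div, le_div_iff₀ hφ]
      nlinarith
    have h7 : (e / ‖x - q‖) ^ 2 * ‖x - q‖ ^ 2 = e ^ 2 := by
      field_simp
    rw [h7]
    linarith

/-- A point of a subspace that is nearest to `c`. -/
theorem exists_mem_nearest (F : Submodule ℝ (Pt d)) (c : Pt d) :
    ∃ q ∈ F, Metric.infDist c (F : Set (Pt d)) = dist c q ∧ ∀ r ∈ F, dist r q ≤ dist r c := by
  obtain ⟨q, hq, hqd⟩ := IsClosed.exists_infDist_eq_dist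
    (Submodule.closed_of_finiteDimensional F) ⟨0, F.zero_mem⟩ c
  refine ⟨q, hq, hqd, fun r hr => ?_⟩
  obtain ⟨s, hs⟩ := exists_sq_dist_add_sq_excess_le c q r
  have hmem : q + s • (r - q) ∈ F :=
    F.add_mem hq (F.smul_mem _ (F.sub_mem hr hq))
  have h1 : dist c q ≤ dist c (q + s • (r - q)) :=
    hqd ▸ Metric.infDist_le_dist_of_mem hmem
  have h2 : dist c q ^ 2 ≤ dist c (q + s • (r - q)) ^ 2 := by gcongr
  -- The line through `q` and `r` stays in `F`, where nothing is nearer to `c` than `q`, so the gain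
  -- must vanish.
  have h3 : max (dist r q - dist r c) 0 ^ 2 ≤ 0 := by linarith
  have h4 : max (dist r q - dist r c) 0 = 0 := pow_eq_zero_iff two_ne_zero |>.1
    (le_antisymm h3 (sq_nonneg _))
  have := le_max_left (dist r q - dist r c) 0
  linarith

/-- If the point of `F` nearest to `c` is bad as a center for `T`, then the span of `F` and a random
point comes closer to `c` on average. -/
theorem add_avg_sq_infDist_le {P T : Finset (Pt d)} (hTP : T ⊆ P) (hT : T.Nonempty) (c : Pt d)
    (F : Submodule ℝ (Pt d)) {r : Pt d} (hr : r ∈ F) {b : ℝ} (hb : 0 ≤ b)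
    (hF : ∀ q ∈ F, dist r q ≤ dist r c → b < excess T q c) :
    b ^ 2 / (T.card * P.card) +
      avg (fun x : P => Metric.infDist c ((F ⊔ Submodule.span ℝ {(x : Pt d)} :
        Submodule ℝ (Pt d)) : Set (Pt d)) ^ 2) ≤ Metric.infDist c (F : Set (Pt d)) ^ 2 := by
  obtain ⟨q, hq, hqd, hqr⟩ := exists_mem_nearest F c
  have hP : P.Nonempty := hT.mono hTP
  have hP0 : (0 : ℝ) < P.card := by exact_mod_cast hP.card_pos
  have hT0 : (0 : ℝ) < T.card := by exact_mod_cast hT.card_pos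
  have hstep : ∀ x : Pt d, Metric.infDist c ((F ⊔ Submodule.span ℝ {x} :
      Submodule ℝ (Pt d)) : Set (Pt d)) ^ 2 + max (dist x q - dist x c) 0 ^ 2 ≤ dist c q ^ 2 := by
    intro x
    obtain ⟨s, hs⟩ := exists_sq_dist_add_sq_excess_le c q x
    refine le_trans ?_ hs
    gcongr
    · exact Metric.infDist_nonneg
    · refine Metric.infDist_le_dist_of_mem ?_
      have hqF : q ∈ F ⊔ Submodule.span ℝ {x} := Submodule.mem_sup_left hq
      exact Submodule.add_mem _ hqF (Submodule.smul_mem _ _ (Submodule.sub_mem _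
        (Submodule.mem_sup_right (Submodule.mem_span_singleton_self x)) hqF))
  -- Cauchy–Schwarz turns a large total excess into a large total drop of the squared distance.
  have hCS : b ^ 2 ≤ T.card * ∑ x ∈ T, max (dist x q - dist x c) 0 ^ 2 := by
    refine le_trans ?_ (sq_sum_le_card_mul_sum_sq (s := T)
      (f := fun x => max (dist x q - dist x c) 0))
    have := (hF q hq (hqr r hr)).le
    unfold excess at this
    gcongr
  have hsum : ∑ x ∈ T, max (dist x q - dist x c) 0 ^ 2 ≤
      ∑ x ∈ P, max (dist x q - dist x c) 0 ^ 2 :=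
    Finset.sum_le_sum_of_subset_of_nonneg hTP fun _ _ _ => sq_nonneg _
  have htot : ∑ x ∈ P, Metric.infDist c ((F ⊔ Submodule.span ℝ {x} :
      Submodule ℝ (Pt d)) : Set (Pt d)) ^ 2 + ∑ x ∈ P, max (dist x q - dist x c) 0 ^ 2 ≤
      P.card * dist c q ^ 2 := by
    rw [← Finset.sum_add_distrib, ← nsmul_eq_mul, ← Finset.sum_const]
    exact Finset.sum_le_sum fun x _ => hstep x
  rw [hqd, avg_coe P fun x => Metric.infDist c ((F ⊔ Submodule.span ℝ {x} :
    Submodule ℝ (Pt d)) : Set (Pt d)) ^ 2, ← div_div, ← add_div, div_le_iff₀ hP0,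
    div_add' _ _ _ hT0.ne',
    div_le_iff₀ hT0]
  nlinarith

/-- With high probability a random sample, together with `F`, spans a good center. -/
theorem uprob_forall_excess_mul_le {P T : Finset (Pt d)} (hTP : T ⊆ P) (hT : T.Nonempty)
    (c r : Pt d) {b : ℝ} (hb : 0 ≤ b) (n : ℕ) (F : Submodule ℝ (Pt d)) (hr : r ∈ F) :
    uprob (fun R : Fin n → P => ∀ q ∈ F ⊔ Submodule.span ℝ (Set.range fun i => (R i : Pt d)),
      dist r q ≤ dist r c → b < excess T q c) * ((n + 1) * (b ^ 2 / (T.card * P.card))) ≤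
      Metric.infDist c (F : Set (Pt d)) ^ 2 := by
  have hne : Nonempty P := (hT.mono hTP).to_subtype
  -- After the first draw `x` the argument continues with `F ⊔ span {x}`. If `F` already contains a
  -- good point, so does every larger span and the event is impossible. Otherwise the potential
  -- drops by `γ` on average, and since a probability is at most 1, this drop pays for one more term
  -- `γ`.
  induction n generalizing F with
  | zero =>
    have h0 : ∀ R : Fin 0 → P,
        F ⊔ Submodule.span ℝ (Set.range fun i => (R i : Pt d)) = F := fun R => by
      simp
    simp only [h0]
    by_cases hF : ∀ q ∈ F, dist r q ≤ dist r c → b < excess T q c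
    · have h1 := add_avg_sq_infDist_le hTP hT c F hr hb hF
      have h2 : 0 ≤ avg (fun x : P => Metric.infDist c ((F ⊔ Submodule.span ℝ {(x : Pt d)} :
        Submodule ℝ (Pt d)) : Set (Pt d)) ^ 2) := avg_nonneg fun _ => sq_nonneg _
      have h3 : 0 ≤ b ^ 2 / ((T.card : ℝ) * P.card) := by positivity
      have h4 := uprob_le_one fun R : Fin 0 → P => ∀ q ∈ F, dist r q ≤ dist r c → b < excess T q c
      norm_num
      nlinarith
    · rw [uprob_eq_zero fun _ => hF, zero_mul]
      exact sq_nonneg _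
  | succ n ih =>
    by_cases hF : ∀ q ∈ F, dist r q ≤ dist r c → b < excess T q c
    · have h1 := add_avg_sq_infDist_le hTP hT c F hr hb hF
      rw [uprob_cons]
      have h3 : 0 ≤ b ^ 2 / ((T.card : ℝ) * P.card) := by positivity
      set γ := b ^ 2 / ((T.card : ℝ) * P.card) with hγ
      set A := avg fun x : P => uprob fun R : Fin n → P =>
        ∀ q ∈ F ⊔ Submodule.span ℝ (Set.range fun i => ((Fin.cons x R : Fin (n + 1) → P) i : Pt d)),
          dist r q ≤ dist r c → b < excess T q c with hA
      have hA1 : A ≤ 1 := by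
        rw [← avg_const (Ω := P) 1]
        exact avg_mono fun x => uprob_le_one _
      have hA2 : ((n + 1) * γ) * A ≤ avg (fun x : P => Metric.infDist c
          ((F ⊔ Submodule.span ℝ {(x : Pt d)} : Submodule ℝ (Pt d)) : Set (Pt d)) ^ 2) := by
        rw [hA, ← avg_const_mul]
        refine avg_mono fun x => ?_
        refine le_trans ?_ (ih (F ⊔ Submodule.span ℝ {(x : Pt d)})
          (Submodule.mem_sup_left hr))
        rw [mul_comm]
        refine mul_le_mul_of_nonneg_right (uprob_mono fun R hR q hq => hR q ?_) (by positivity)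
        have hrange : (Set.range fun i => ((Fin.cons x R : Fin (n + 1) → P) i : Pt d)) =
            {(x : Pt d)} ∪ Set.range fun i => (R i : Pt d) := by
          ext z
          simp [Fin.exists_fin_succ, eq_comm]
        rw [hrange, Submodule.span_union, ← sup_assoc]
        exact hq
      push_cast
      nlinarith
    · have h0 : ∀ R : Fin (n + 1) → P, ¬ ∀ q ∈ F ⊔ Submodule.span ℝ
          (Set.range fun i => (R i : Pt d)), dist r q ≤ dist r c → b < excess T q c :=
        fun R h => hF fun q hq => h q (Submodule.mem_sup_left hq)
      rw [uprob_eq_zero h0, zero_mul]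
      exact sq_nonneg _

end SpanSampling

/-! ### One trial -/

section Trial

variable {d : ℕ}

/-- The constants are those of the tested range: `4394 = 2 * 13 ^ 3` comes from `a` and `13` from
`b`. The witness is `z` rounded up to a power of two. -/
theorem exists_mem_scales {v z : ℝ} (hv : 0 < v) (hz : 0 < z) (h1 : v ≤ 4394 * z)
    (h2 : z ≤ 13 * v) : ∃ t ∈ (scales v).val, z ≤ t ∧ t ≤ 2 * z := by
  have hlo : ⌊Real.logb 2 (v * (1 / (zetaInv : ℝ)) ^ 3 / 2)⌋ ≤ ⌈Real.logb 2 z⌉ := by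
    have h3 : Real.logb 2 (v * (1 / (zetaInv : ℝ)) ^ 3 / 2) ≤ Real.logb 2 z := by
      refine Real.logb_le_logb_of_le (by norm_num) (by unfold zetaInv; positivity) ?_
      unfold zetaInv
      norm_num
      linarith
    exact_mod_cast (Int.floor_le _).trans (h3.trans (Int.le_ceil _))
  have hhi : ⌈Real.logb 2 z⌉ ≤ ⌈Real.logb 2 (v / (1 / (zetaInv : ℝ)))⌉ := by
    refine Int.ceil_mono (Real.logb_le_logb_of_le (by norm_num) hz ?_)
    unfold zetaInv
    norm_num
    linarith
  refine ⟨(2 : ℝ) ^ ⌈Real.logb 2 z⌉, ?_, ?_, ?_⟩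
  · simp only [scales, Timed.bind_val, ops_val, hv.ne', decide_false, Bool.false_eq_true, if_false,
      mapTimed_val, List.mem_map, List.mem_range]
    refine ⟨(⌈Real.logb 2 z⌉ - ⌊Real.logb 2 (v * (1 / (zetaInv : ℝ)) ^ 3 / 2)⌋).toNat,
      by omega, ?_⟩
    congr 1
    omega
  · rw [← Real.rpow_intCast]
    calc z = (2 : ℝ) ^ Real.logb 2 z := (Real.rpow_logb (by norm_num) (by norm_num) hz).symm
      _ ≤ _ := Real.rpow_le_rpow_of_exponent_le (by norm_num) (Int.le_ceil _)
  · rw [← Real.rpow_intCast]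
    calc (2 : ℝ) ^ ((⌈Real.logb 2 z⌉ : ℤ) : ℝ) ≤ (2 : ℝ) ^ (1 + Real.logb 2 z) :=
        Real.rpow_le_rpow_of_exponent_le (by norm_num) (by
          linarith [Int.ceil_lt_add_one (Real.logb 2 z)])
      _ = 2 * z := by
        rw [Real.rpow_add (by norm_num), Real.rpow_logb (by norm_num) (by norm_num) hz,
          Real.rpow_one]

theorem zero_mem_scales_zero : (0 : ℝ) ∈ (scales 0).val := by
  simp [scales]

theorem exists_nonneg_mem_scales {v : ℝ} (hv : 0 ≤ v) : ∃ t ∈ (scales v).val, 0 ≤ t := by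
  rcases hv.eq_or_lt with rfl | hv
  · exact ⟨0, zero_mem_scales_zero, le_rfl⟩
  · obtain ⟨t, ht, h, -⟩ := exists_mem_scales hv hv (by linarith) (by linarith)
    exact ⟨t, ht, hv.le.trans h⟩

/-- The factor `1 + α - 2α²` costs an extra `αε(α - 2α²)`, which the term `2α²` of the budget
covers. -/
theorem isGoodCenter_of_excess_le {α ε : ℝ} (hα : 0 < α) (hα' : α < 1 / 2) (hε : 0 < ε)
    (hε' : ε < 1) {T : Finset (Pt d)} {c q : Pt d}
    (h : excess T q c ≤ α * ε * ∑ x ∈ T, dist x c) : IsGoodCenter α ε T c q := by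
  have hC : 0 ≤ ∑ x ∈ T, dist x c := Finset.sum_nonneg fun _ _ => dist_nonneg
  have h1 : 0 ≤ 1 + α - 2 * α ^ 2 := by nlinarith
  have h2 : α * ε * (1 + α - 2 * α ^ 2) ≤ ε * α + 2 * α ^ 2 := by
    have : α * ε * (α - 2 * α ^ 2) ≤ 2 * α ^ 2 := by
      have h3 : ε * (1 - 2 * α) ≤ 2 := by nlinarith
      nlinarith [sq_nonneg α, mul_pos hα hα]
    linarith
  unfold IsGoodCenter
  nlinarith [mul_le_mul_of_nonneg_right h h1, mul_le_mul_of_nonneg_right h2 hC]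

theorem isGoodCenter_self {α ε : ℝ} (hα : 0 < α) (hε : 0 < ε) (T : Finset (Pt d)) (c : Pt d) :
    IsGoodCenter α ε T c c := by
  rw [IsGoodCenter, excess_self, zero_mul]
  exact mul_nonneg (by positivity) (Finset.sum_nonneg fun _ _ => dist_nonneg)

open scoped Classical in
/-- If most of `T` is concentrated near `y` and the median `c` of a set `Y` that is mostly
contained in `T` is far from `y`, then `α` is large and every point near `y` is a good center. -/
theorem isGoodCenter_of_concentrated {α ε : ℝ} (hα : 0 < α) (hε : 0 < ε) {T Y : Finset (Pt d)}
    (hTY : T ⊆ Y) (hrate : (1 - α) * (Y.card : ℝ) ≤ T.card) (hT : T.Nonempty) {c y r : Pt d}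
    (hmed : ∑ x ∈ Y, dist x c ≤ ∑ x ∈ Y, dist x y) {ρ : ℝ} (hρ : 0 ≤ ρ)
    (hball : 9 / 10 * (T.card : ℝ) ≤ ((T.filter fun x => dist x y ≤ ρ).card : ℝ))
    (hr : dist r y ≤ ρ) (hfar : 24 * ρ < dist y c) : IsGoodCenter α ε T c r := by
  have hT0 : (0 : ℝ) < T.card := by exact_mod_cast hT.card_pos
  set B := T.filter fun x => dist x y ≤ ρ with hB
  have hBT : B ⊆ T := Finset.filter_subset _ _
  set D := dist y c with hD
  have hxB : ∀ x ∈ B, dist x y ≤ ρ ∧ D - ρ ≤ dist x c := fun x hx => by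
    have h1 := (Finset.mem_filter.1 hx).2
    have := dist_triangle_left y c x
    exact ⟨h1, by linarith⟩
  have hBY : (B.card : ℝ) + (Y \ B).card = Y.card := by
    rw [add_comm]
    exact_mod_cast Finset.card_sdiff_add_card_eq_card (hBT.trans hTY)
  have hBT' : (B.card : ℝ) + (T \ B).card = T.card := by
    rw [add_comm]
    exact_mod_cast Finset.card_sdiff_add_card_eq_card hBT
  -- For small `α` the ball `B` holds a clear majority of `Y`, so `y` would beat the median `c`. For
  -- large `α` the budget `2α²` exceeds `8/25`.
  rcases le_or_gt α (2 / 5) with hα2 | hα2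
  · exfalso
    have h1 : ∑ x ∈ Y \ B, dist x y ≤ ∑ x ∈ Y \ B, dist x c + (Y \ B).card * D := by
      rw [← nsmul_eq_mul, ← Finset.sum_const, ← Finset.sum_add_distrib]
      refine Finset.sum_le_sum fun x _ => ?_
      rw [hD, dist_comm y c]
      exact dist_triangle x c y
    have h2 : ∑ x ∈ B, dist x y ≤ B.card * ρ := by
      rw [← nsmul_eq_mul, ← Finset.sum_const]
      exact Finset.sum_le_sum fun x hx => (hxB x hx).1
    have h3 : B.card * (D - ρ) ≤ ∑ x ∈ B, dist x c := by
      rw [← nsmul_eq_mul, ← Finset.sum_const]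
      exact Finset.sum_le_sum fun x hx => (hxB x hx).2
    rw [← Finset.sum_sdiff (hBT.trans hTY), ← Finset.sum_sdiff (hBT.trans hTY)] at hmed
    have h4 : B.card * (D - 2 * ρ) ≤ ((Y \ B).card : ℝ) * D := by linarith
    -- `27/50 = 9/10 * 3/5`, so at most `23/50` of `Y` lies outside `B`. With `h4` this gives `D ≤
    -- 13.5 ρ`, against `24 ρ < D`.
    have h5 : 27 / 50 * (Y.card : ℝ) ≤ B.card := by nlinarith
    have h6 : 23 / 27 * (B.card : ℝ) ≥ (Y \ B).card := by linarith
    have hB0 : (0 : ℝ) < B.card := by linarith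
    have h7 : ((Y \ B).card : ℝ) * D ≤ 23 / 27 * B.card * D := by
      gcongr
    have h8 : (B.card : ℝ) * (D - 2 * ρ) ≤ B.card * (23 / 27 * D) := by linarith
    have h9 := le_of_mul_le_mul_left h8 hB0
    linarith
  -- Points of `B` contribute nothing: they are within `2ρ` of `r` and at least `D - ρ` from `c`.
  · have h1 : excess T r c ≤ (T \ B).card * (D + ρ) := by
      unfold excess
      rw [← Finset.sum_sdiff hBT, ← add_zero ((T \ B).card * (D + ρ))]
      refine add_le_add ?_ (Finset.sum_nonpos fun x hx => max_le ?_ le_rfl)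
      · rw [← nsmul_eq_mul, ← Finset.sum_const]
        refine Finset.sum_le_sum fun x _ => max_le ?_ (by linarith)
        have := dist_triangle4 x c y r
        rw [dist_comm c y, dist_comm y r] at this
        linarith
      · have h2 := hxB x hx
        have := dist_triangle_right x r y
        linarith
    have h2 : B.card * (D - ρ) ≤ ∑ x ∈ T, dist x c := by
      rw [← nsmul_eq_mul, ← Finset.sum_const]
      refine (Finset.sum_le_sum fun x hx => (hxB x hx).2).trans ?_
      exact Finset.sum_le_sum_of_subset_of_nonneg hBT fun _ _ _ => dist_nonneg
    set C := ∑ x ∈ T, dist x c with hC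
    have hC0 : 0 ≤ C := Finset.sum_nonneg fun _ _ => dist_nonneg
    have hD0 : 0 < D := by linarith
    have h3 : excess T r c ≤ 1 / 10 * T.card * (25 / 24 * D) := by
      refine h1.trans ?_
      gcongr <;> linarith
    have h4 : 9 / 10 * T.card * (23 / 24 * D) ≤ C := by
      refine le_trans ?_ h2
      gcongr
      linarith
    have h5 : excess T r c ≤ 1 / 8 * C := by linarith [mul_pos hT0 hD0]
    have he := excess_nonneg T r c
    have h6 : 1 + α - 2 * α ^ 2 ≤ 9 / 8 := by linarith [sq_nonneg (α - 1 / 4)]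
    have h7 : 8 / 25 ≤ ε * α + 2 * α ^ 2 := by
      have := mul_le_mul hα2.le hα2.le (by norm_num) hα.le
      linarith [mul_pos hε hα]
    unfold IsGoodCenter
    calc excess T r c * (1 + α - 2 * α ^ 2) ≤ excess T r c * (9 / 8) := by gcongr
      _ ≤ 8 / 25 * C := by linarith
      _ ≤ _ := mul_le_mul_of_nonneg_right h7 hC0

open scoped Classical in
/-- The candidates for suitable samples contain a good center. -/
theorem exists_isGoodCenter_mem_candidateSet {α ε : ℝ} (hα : 0 < α) (hα' : α < 1 / 2)
    (hε : 0 < ε) (hε' : ε < 1) {T Y : Finset (Pt d)} (hTY : T ⊆ Y)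
    (hrate : (1 - α) * (Y.card : ℝ) ≤ T.card) (hT : T.Nonempty) {c y r : Pt d}
    (hmed : ∑ x ∈ Y, dist x c ≤ ∑ x ∈ Y, dist x y) {ρ μ v : ℝ} (hρ : 0 ≤ ρ)
    (hμ : (T.card : ℝ) * μ = ∑ x ∈ T, dist x c)
    (hball : 9 / 10 * (T.card : ℝ) ≤ ((T.filter fun x => dist x y ≤ ρ).card : ℝ))
    (hr : dist r y ≤ ρ) (hrc : dist r c ≤ 19 / 10 * μ) (hv1 : ρ ≤ v) (hv2 : v ≤ 4394 * μ)
    {R : List (Pt d)} (hrR : r ∈ R)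
    (hR : ∃ q ∈ listSpan R, dist r q ≤ dist r c ∧
      excess T q c ≤ 3 / 4 * (α * ε) * ∑ x ∈ T, dist x c) :
    ∃ t ∈ (scales v).val, ∃ q ∈ (candidateSet α ε R t).val, IsGoodCenter α ε T c q := by
  obtain ⟨q, hqR, hqr, hqe⟩ := hR
  have hT0 : (0 : ℝ) < T.card := by exact_mod_cast hT.card_pos
  have hself : IsGoodCenter α ε T c r →
      ∃ t ∈ (scales v).val, ∃ q ∈ (candidateSet α ε R t).val, IsGoodCenter α ε T c q := by
    intro h
    obtain ⟨t, ht, ht0⟩ := exists_nonneg_mem_scales (hρ.trans hv1)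
    exact ⟨t, ht, r, self_mem_candidateSet α ε ht0 hrR, h⟩
  have hαε : α * ε ≤ 1 / 2 := by nlinarith
  have hαε0 : 0 < α * ε := mul_pos hα hε
  -- A usable scale satisfies two demands. The bound `t ≤ 2μ` keeps the rounding cost `|T| αεt/8`
  -- below `αεC/4`, which the `3/4` in the excess of `q` leaves free. The other one keeps `q` and
  -- its rounding within the ball of radius `2t`.
  have hfine : ∀ t ∈ (scales v).val, 0 < t → t ≤ 2 * μ → dist r c + t / 16 ≤ 2 * t →
      ∃ t ∈ (scales v).val, ∃ q ∈ (candidateSet α ε R t).val, IsGoodCenter α ε T c q := by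
    intro t ht ht0 htμ hrt
    have h1 : α * ε * t / 8 ≤ t / 16 := by nlinarith
    obtain ⟨q', hq', hqq⟩ := exists_mem_candidateSet hα hε ht0 hrR hqR (by
      rw [dist_comm q r]
      linarith)
    refine ⟨t, ht, q', hq', isGoodCenter_of_excess_le hα hα' hε hε' ?_⟩
    have h2 := excess_le_add_dist T q q' c
    have h3 : dist q' q ≤ 1 / 4 * (α * ε) * μ := by nlinarith
    have h4 := mul_le_mul_of_nonneg_left h3 hT0.le
    rw [← hμ] at hqe ⊢
    linarith
  have hμ0 : 0 ≤ μ := by linarith [dist_nonneg (x := r) (y := c)]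
  rcases hμ0.eq_or_lt with hμ' | hμ'
  · have : r = c := dist_le_zero.1 (by rw [← hμ'] at hrc; simpa using hrc)
    exact hself (this ▸ isGoodCenter_self hα hε T r)
  -- In the first case `t ≥ μ`, and `19/10 μ + t/16 ≤ 2t` holds because `19/10 < 31/16`.
  rcases le_or_gt μ (13 * v) with h13 | h13
  · obtain ⟨t, ht, ht1, ht2⟩ := exists_mem_scales (by linarith) hμ' hv2 h13
    exact hfine t ht (by linarith) ht2 (by linarith)
  rcases le_or_gt (dist y c) (24 * v) with hD | hD
  · have hrc' : dist r c ≤ 25 * v := by linarith [dist_triangle r y c]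
    rcases (hρ.trans hv1).eq_or_lt with hv0 | hv0
    · have : r = c := dist_le_zero.1 (by rw [← hv0] at hrc'; simpa using hrc')
      exact hself (this ▸ isGoodCenter_self hα hε T r)
    -- Here `dist r c ≤ 25 v`, and `31/16 * 13 > 25`; moreover `t ≤ 26 v < 2μ`.
    · obtain ⟨t, ht, ht1, ht2⟩ := exists_mem_scales (z := 13 * v) hv0 (by linarith)
        (by linarith) le_rfl
      exact hfine t ht (by linarith) (by linarith) (by linarith)
  · exact hself (isGoodCenter_of_concentrated hα hε hTY hrate hT hmed hρ hball hr
      (by linarith))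

theorem mem_trial_val {α ε : ℝ} {P : Finset (Pt d)} {ω : TrialSample α ε P} {q : Pt d} :
    q ∈ (trial α ε P ω).val ↔ ∃ S : List (Pt d),
      (S.Sublist (List.ofFn fun a => (ω.2.1 a : Pt d)) ∧ S.length = zetaInv) ∧
      ∃ t ∈ (scales (S.map fun s => dist s (ω.1 : Pt d)).sum).val,
        q ∈ (candidateSet α ε (List.ofFn fun a => (ω.2.2 a : Pt d)) t).val := by
  simp only [trial, Timed.bind_val, ops_val, mem_collect_val, subsetsTimed_val, sumTimed_val,
    distTimed]

end Trial

/-! ### The probability that a trial succeeds -/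

section TrialProbability

variable {d : ℕ}

theorem one_sub_pow_le_exp {p x : ℝ} {n : ℕ} (hp : p ≤ 1) (hx : x ≤ p * n) :
    (1 - p) ^ n ≤ Real.exp (-x) := by
  calc (1 - p) ^ n ≤ Real.exp (-p) ^ n := by
        have := Real.add_one_le_exp (-p)
        exact pow_le_pow_left₀ (by linarith) (by linarith) n
    _ = Real.exp (-(p * n)) := by rw [← Real.exp_nat_mul]; ring_nf
    _ ≤ _ := Real.exp_le_exp.2 (by linarith)

/-- Few points are much farther from `c` than the average. -/
theorem card_filter_dist_le_mean {T : Finset (Pt d)} {c : Pt d} {μ : ℝ}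
    (hμ : (T.card : ℝ) * μ = ∑ x ∈ T, dist x c) {s : ℝ} (hs : 0 < s) :
    (1 - 1 / s) * (T.card : ℝ) ≤ ((T.filter fun x => dist x c ≤ s * μ).card : ℝ) := by
  have hsplit : ((T.filter fun x => dist x c ≤ s * μ).card : ℝ) +
      (T.filter fun x => ¬ dist x c ≤ s * μ).card = T.card := by
    exact_mod_cast Finset.card_filter_add_card_filter_not _
  have h1 : ((T.filter fun x => ¬ dist x c ≤ s * μ).card : ℝ) * (s * μ) ≤ T.card * μ := by
    rw [hμ, ← nsmul_eq_mul, ← Finset.sum_const]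
    refine (Finset.sum_le_sum fun x hx => (not_le.1 (Finset.mem_filter.1 hx).2).le).trans ?_
    exact Finset.sum_le_sum_of_subset_of_nonneg (Finset.filter_subset _ _) fun _ _ _ => dist_nonneg
  have h2 : ((T.filter fun x => ¬ dist x c ≤ s * μ).card : ℝ) ≤ T.card / s := by
    rcases T.eq_empty_or_nonempty with rfl | hT
    · simp
    have hT0 : (0 : ℝ) < T.card := by exact_mod_cast hT.card_pos
    have hμ0 : 0 ≤ μ := by
      refine nonneg_of_mul_nonneg_right ?_ hT0
      rw [hμ]
      exact Finset.sum_nonneg fun _ _ => dist_nonneg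
    rcases hμ0.eq_or_lt with h0 | h0
    · have h3 : ∀ x ∈ T, dist x c = 0 := by
        rw [← h0, mul_zero] at hμ
        exact (Finset.sum_eq_zero_iff_of_nonneg fun _ _ => dist_nonneg).1 hμ.symm
      rw [Finset.filter_false_of_mem fun x hx => by simp [h3 x hx, ← h0]]
      simp
      positivity
    · rw [le_div_iff₀ hs]
      refine le_of_mul_le_mul_right ?_ h0
      linarith
  rw [sub_mul, one_mul, one_div_mul_eq_div]
  linarith

/-- A quantile of the distances to `y`. -/
theorem exists_quantile_dist {T : Finset (Pt d)} (hT : T.Nonempty) (y : Pt d) {β : ℝ}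
    (hβ : 0 < β) (hβ' : β ≤ 1) :
    ∃ ρ : ℝ, 0 ≤ ρ ∧ β * (T.card : ℝ) ≤ ((T.filter fun x => dist x y ≤ ρ).card : ℝ) ∧
      (1 - β) * (T.card : ℝ) ≤ ((T.filter fun x => ρ ≤ dist x y).card : ℝ) := by
  have hT0 : (0 : ℝ) < T.card := by exact_mod_cast hT.card_pos
  -- `ρ` is the least attained distance whose closed ball holds a `β`-fraction of `T`; by
  -- minimality, the points strictly closer are at most a `β`-fraction.
  set D := (T.image fun x => dist x y).filter fun ρ =>
    β * (T.card : ℝ) ≤ ((T.filter fun x => dist x y ≤ ρ).card : ℝ) with hD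
  have hDne : D.Nonempty := by
    obtain ⟨x, hx, hmax⟩ := T.exists_max_image (fun x => dist x y) hT
    refine ⟨dist x y, Finset.mem_filter.2 ⟨Finset.mem_image_of_mem _ hx, ?_⟩⟩
    rw [Finset.filter_true_of_mem hmax]
    nlinarith
  obtain ⟨ρ, hρ, hmin⟩ := D.exists_min_image id hDne
  obtain ⟨hρ1, hρ2⟩ := Finset.mem_filter.1 hρ
  obtain ⟨x0, hx0, rfl⟩ := Finset.mem_image.1 hρ1
  refine ⟨dist x0 y, dist_nonneg, hρ2, ?_⟩
  have hsplit : ((T.filter fun x => dist x0 y ≤ dist x y).card : ℝ) +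
      (T.filter fun x => ¬ dist x0 y ≤ dist x y).card = T.card := by
    exact_mod_cast Finset.card_filter_add_card_filter_not _
  have hlt : ((T.filter fun x => ¬ dist x0 y ≤ dist x y).card : ℝ) ≤ β * T.card := by
    by_contra hcon
    rw [not_le] at hcon
    have hne : (T.filter fun x => ¬ dist x0 y ≤ dist x y).Nonempty := by
      rw [← Finset.card_pos]
      have : 0 < β * T.card := by positivity
      exact_mod_cast this.trans hcon
    obtain ⟨x1, hx1, hmax⟩ := Finset.exists_max_image _ (fun x => dist x y) hne
    obtain ⟨hx1T, hx1lt⟩ := Finset.mem_filter.1 hx1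
    have hmem : dist x1 y ∈ D := by
      refine Finset.mem_filter.2 ⟨Finset.mem_image_of_mem _ hx1T, hcon.le.trans ?_⟩
      refine Nat.cast_le.2 (Finset.card_le_card fun x hx => Finset.mem_filter.2
        ⟨(Finset.mem_filter.1 hx).1, hmax x hx⟩)
    exact hx1lt (hmin _ hmem)
  linarith

/-- A sample rarely misses a set that is not small. -/
theorem uprob_forall_notMem_le {P A : Finset (Pt d)} (hAP : A ⊆ P) (hP : P.Nonempty) {n : ℕ}
    {x : ℝ} (hx : x * P.card ≤ A.card * n) :
    uprob (fun Q : Fin n → P => ∀ i, (Q i : Pt d) ∉ A) ≤ Real.exp (-x) := by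
  classical
  have hP0 : (0 : ℝ) < P.card := by exact_mod_cast hP.card_pos
  rw [uprob_pi_forall (A := fun _ : Fin n => P) fun _ z => (z : Pt d) ∉ A,
    uprob_coe P fun z => z ∉ A, Finset.prod_const, Finset.card_univ, Fintype.card_fin]
  have h1 : ((P.filter fun z => z ∉ A).card : ℝ) / P.card = 1 - A.card / P.card := by
    rw [Finset.filter_notMem_eq_sdiff, Finset.card_sdiff_of_subset hAP,
      Nat.cast_sub (Finset.card_le_card hAP)]
    field_simp
  rw [h1]
  refine one_sub_pow_le_exp ?_ ?_
  · rw [div_le_one hP0]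
    exact_mod_cast Finset.card_le_card hAP
  · rw [div_mul_eq_mul_div, le_div_iff₀ hP0]
    exact hx

open scoped Classical in
/-- A sample rarely has few members in a set that is not small. -/
theorem uprob_card_mem_le {P T : Finset (Pt d)} (hTP : T ⊆ P) (hP : P.Nonempty) {n : ℕ}
    {x : ℝ} (hx : 2 * x * P.card ≤ T.card * n) (j : ℕ) :
    uprob (fun Q : Fin n → P => (Finset.univ.filter fun i => (Q i : Pt d) ∈ T).card ≤ j) ≤
      2 ^ j * Real.exp (-x) := by
  have hP0 : (0 : ℝ) < P.card := by exact_mod_cast hP.card_pos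
  have hTP' : (T.card : ℝ) ≤ P.card := by exact_mod_cast Finset.card_le_card hTP
  -- Chernoff's method with base `1/2`: the mean of `(1/2) ^ count` factors over the independent
  -- draws, and Markov's inequality applies to it.
  set f : Pt d → ℝ := fun z => if z ∈ T then 1 / 2 else 1 with hf
  have hprod : ∀ Q : Fin n → P, ∏ i, f (Q i) =
      (1 / 2 : ℝ) ^ (Finset.univ.filter fun i => (Q i : Pt d) ∈ T).card := fun Q => by
    simp only [hf, Finset.prod_ite, Finset.prod_const, one_pow, mul_one]
  have havg : avg (fun z : P => f z) = 1 - T.card / P.card / 2 := by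
    rw [avg_coe P f]
    simp only [hf, Finset.sum_ite, Finset.sum_const, nsmul_eq_mul, mul_one]
    rw [Finset.filter_mem_eq_inter, Finset.inter_eq_right.2 hTP, Finset.filter_notMem_eq_sdiff,
      Finset.card_sdiff_of_subset hTP, Nat.cast_sub (Finset.card_le_card hTP)]
    field_simp
    ring
  calc uprob (fun Q : Fin n → P => (Finset.univ.filter fun i => (Q i : Pt d) ∈ T).card ≤ j)
      ≤ uprob (fun Q : Fin n → P => (1 / 2 : ℝ) ^ j ≤ ∏ i, f (Q i)) := by
        refine uprob_mono fun Q hQ => ?_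
        rw [hprod]
        exact pow_le_pow_of_le_one (by norm_num) (by norm_num) hQ
    _ ≤ avg (fun Q : Fin n → P => ∏ i, f (Q i)) / (1 / 2 : ℝ) ^ j :=
        uprob_le_avg_div (fun Q => Finset.prod_nonneg fun i _ => by
          simp only [hf]
          split_ifs <;> norm_num) (by positivity)
    _ = 2 ^ j * (1 - T.card / P.card / 2) ^ n := by
        rw [avg_pi_pow fun z : P => f z, havg, one_div, inv_pow, div_inv_eq_mul, mul_comm]
    _ ≤ _ := by
        gcongr
        refine one_sub_pow_le_exp ?_ ?_
        · rw [div_div, div_le_one (by positivity)]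
          linarith
        · rw [div_div, div_mul_eq_mul_div, le_div_iff₀ (by positivity)]
          linarith

/-- A list of some members of a finite family. -/
theorem exists_sublist_ofFn {A : Type*} {n : ℕ} (Q : Fin n → A) (J : Finset (Fin n)) :
    ∃ S : List A, S.Sublist (List.ofFn Q) ∧ S.length = J.card ∧
      ∀ f : A → ℝ, (S.map f).sum = ∑ i ∈ J, f (Q i) := by
  have hJ : ((List.finRange n).filter (· ∈ J)).toFinset = J := by
    ext i
    simp
  have hnd : ((List.finRange n).filter (· ∈ J)).Nodup := (List.nodup_finRange n).filter _
  refine ⟨((List.finRange n).filter (· ∈ J)).map Q, ?_, ?_, fun f => ?_⟩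
  · rw [List.ofFn_eq_map]
    exact List.filter_sublist.map Q
  · rw [List.length_map, ← List.toFinset_card_of_nodup hnd, hJ]
  · rw [List.map_map]
    conv_rhs => rw [← hJ, List.sum_toFinset _ hnd]
    rfl

/-- A random sample contains a subset whose distances to `y` add up to a suitable scale. -/
theorem uprob_exists_scale {α : ℝ} {P T : Finset (Pt d)}
    (hTP : T ⊆ P) (hT : T.Nonempty) (hrate : (1 - α) * (P.card : ℝ) ≤ T.card) {n : ℕ}
    (hn : 26 ≤ (1 - α) * n) (hn' : n ≤ 53) {c y : Pt d} {ρ μ : ℝ}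
    (hμ : (T.card : ℝ) * μ = ∑ x ∈ T, dist x c) (hy : dist y c ≤ 10 * μ)
    (hfar : 1 / 10 * (T.card : ℝ) ≤ ((T.filter fun x => ρ ≤ dist x y).card : ℝ)) :
    3 / 5 ≤ uprob fun Q : Fin n → P => ∃ S : List (Pt d),
      (S.Sublist (List.ofFn fun a => (Q a : Pt d)) ∧ S.length = zetaInv) ∧
        ρ ≤ (S.map fun s => dist s y).sum ∧ (S.map fun s => dist s y).sum ≤ 4394 * μ := by
  classical
  have hP : P.Nonempty := hT.mono hTP
  have hPne : Nonempty P := hP.to_subtype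
  have hP0 : (0 : ℝ) < P.card := by exact_mod_cast hP.card_pos
  have hT0 : (0 : ℝ) < T.card := by exact_mod_cast hT.card_pos
  have hμ0 : 0 ≤ μ := by linarith [dist_nonneg (x := y) (y := c)]
  have hn0 : (0 : ℝ) ≤ n := Nat.cast_nonneg n
  have hTn : 26 * (P.card : ℝ) ≤ T.card * n := by nlinarith
  set A := T.filter fun x => ρ ≤ dist x y with hA
  have h1 := uprob_card_mem_le hTP hP (n := n) (x := 13) (by linarith) 12
  have h2 := uprob_forall_notMem_le ((Finset.filter_subset _ _ : A ⊆ T).trans hTP) hP (n := n)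
    (x := 13 / 5) (by nlinarith)
  -- Mislabeled points may be arbitrarily far away, but only sampled points of `T` enter `S`;
  -- discarding the others keeps the mean of the sum below `53 μ`.
  set g : Pt d → ℝ := fun z => if z ∈ T then dist z c else 0 with hg
  have hg0 : ∀ z, 0 ≤ g z := fun z => by
    simp only [hg]
    split_ifs
    · exact dist_nonneg
    · exact le_rfl
  have havg : avg (fun Q : Fin n → P => ∑ i, g (Q i)) ≤ 53 * μ := by
    rw [avg_pi_sum fun z : P => g z, avg_coe P g]
    have h3 : ∑ x ∈ P, g x = T.card * μ := by
      rw [hμ]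
      simp only [hg, Finset.sum_ite_mem, Finset.inter_eq_right.2 hTP]
    rw [h3]
    have h4 : (T.card : ℝ) * μ / P.card ≤ μ := by
      rw [div_le_iff₀ hP0, mul_comm μ]
      gcongr
    have h5 : (n : ℝ) ≤ 53 := by exact_mod_cast hn'
    gcongr
  have h3 : uprob (fun Q : Fin n → P => 4000 * μ < ∑ i, g (Q i)) ≤ 53 / 4000 := by
    rcases hμ0.eq_or_lt with h0 | h0
    · have hgz : ∀ z, g z = 0 := fun z => by
        simp only [hg]
        split_ifs with hz
        · rw [← h0, mul_zero] at hμ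
          exact (Finset.sum_eq_zero_iff_of_nonneg fun _ _ => dist_nonneg).1 hμ.symm z hz
        · rfl
      rw [uprob_eq_zero fun Q => by simp [hgz, ← h0]]
      norm_num
    · refine (uprob_mono fun Q h => h.le).trans ((uprob_le_avg_div (f := fun Q : Fin n → P =>
        ∑ i, g (Q i)) (fun Q => Finset.sum_nonneg fun _ _ => hg0 _)
        (t := 4000 * μ) (by positivity)).trans ?_)
      rw [div_le_div_iff₀ (by positivity) (by norm_num)]
      linarith
  have hexp1 : (2 : ℝ) ^ 12 * Real.exp (-13) ≤ 1 / 100 := by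
    have h4 : (2.718 : ℝ) ^ 13 ≤ Real.exp 13 := by
      rw [show (13 : ℝ) = ((13 : ℕ) : ℝ) * 1 by norm_num, Real.exp_nat_mul]
      gcongr
      linarith [Real.exp_one_gt_d9]
    rw [Real.exp_neg, ← div_eq_mul_inv, div_le_div_iff₀ (Real.exp_pos _) (by norm_num)]
    refine le_trans ?_ (mul_le_mul_of_nonneg_left h4 zero_le_one)
    norm_num
  have hexp2 : Real.exp (-(13 / 5)) ≤ 5 / 18 := by
    have := Real.add_one_le_exp (13 / 5)
    rw [Real.exp_neg, inv_le_comm₀ (Real.exp_pos _) (by norm_num)]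
    linarith
  -- The three ways to fail have probabilities at most `1/100`, `5/18` and `53/4000`, in total less
  -- than `2/5`. If none occurs, 13 sampled points of `T` including one at distance at least `ρ`
  -- from `y` have distance sum at most `4000 μ + 13 * 10 μ`.
  have hcompl : uprob (fun Q : Fin n → P => ¬ ∃ S : List (Pt d),
      (S.Sublist (List.ofFn fun a => (Q a : Pt d)) ∧ S.length = zetaInv) ∧
        ρ ≤ (S.map fun s => dist s y).sum ∧ (S.map fun s => dist s y).sum ≤ 4394 * μ) ≤
      uprob (fun Q : Fin n → P =>
        ((Finset.univ.filter fun i => (Q i : Pt d) ∈ T).card ≤ 12 ∨ ∀ i, (Q i : Pt d) ∉ A) ∨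
          4000 * μ < ∑ i, g (Q i)) := by
    refine uprob_mono fun Q hQ => ?_
    by_contra hcon
    push Not at hcon
    obtain ⟨⟨hc1, i0, hi0⟩, hc3⟩ := hcon
    obtain ⟨hi0T, hi0ρ⟩ := Finset.mem_filter.1 hi0
    obtain ⟨J, hJ1, hJ2, hJc⟩ := Finset.exists_subsuperset_card_eq
      (s := {i0}) (t := Finset.univ.filter fun i => (Q i : Pt d) ∈ T) (n := 13)
      (by simpa using hi0T) (by simp) (by omega)
    obtain ⟨S, hS1, hS2, hS3⟩ := exists_sublist_ofFn (fun a => (Q a : Pt d)) J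
    refine hQ ⟨S, ⟨hS1, hS2.trans hJc⟩, ?_, ?_⟩
    · rw [hS3 fun s => dist s y]
      exact hi0ρ.trans (Finset.single_le_sum (f := fun i => dist (Q i : Pt d) y)
        (fun _ _ => dist_nonneg) (hJ1 (Finset.mem_singleton_self i0)))
    · rw [hS3 fun s => dist s y]
      calc ∑ i ∈ J, dist (Q i : Pt d) y ≤ ∑ i ∈ J, (g (Q i) + 10 * μ) := by
            refine Finset.sum_le_sum fun i hi => ?_
            have hiT : (Q i : Pt d) ∈ T := (Finset.mem_filter.1 (hJ2 hi)).2
            simp only [hg, hiT, if_true]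
            have := dist_triangle_right (Q i : Pt d) y c
            linarith
        _ = ∑ i ∈ J, g (Q i) + 130 * μ := by
            rw [Finset.sum_add_distrib, Finset.sum_const, hJc, nsmul_eq_mul]
            push_cast
            ring
        _ ≤ ∑ i, g (Q i) + 130 * μ := by
            have := Finset.sum_le_sum_of_subset_of_nonneg (f := fun i => g (Q i))
              (Finset.subset_univ J) fun _ _ _ => hg0 _
            linarith
        _ ≤ _ := by linarith
  rw [uprob_not] at hcompl
  have h4 := uprob_or_le (fun Q : Fin n → P =>
    (Finset.univ.filter fun i => (Q i : Pt d) ∈ T).card ≤ 12 ∨ ∀ i, (Q i : Pt d) ∉ A)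
    (fun Q => 4000 * μ < ∑ i, g (Q i))
  have h5 := uprob_or_le (fun Q : Fin n → P =>
    (Finset.univ.filter fun i => (Q i : Pt d) ∈ T).card ≤ 12)
    fun Q : Fin n → P => ∀ i, (Q i : Pt d) ∉ A
  linarith

theorem listSpan_ofFn {n : ℕ} (R : Fin n → Pt d) :
    listSpan (List.ofFn R) = Submodule.span ℝ (Set.range R) := by
  rw [listSpan]
  congr 1
  ext x
  simp [List.mem_ofFn]

/-- A random sample of the prescribed size contains a point near `y` and `c` and spans a good
center, with constant probability. -/
theorem uprob_exists_span {α η : ℝ} (hα' : α < 1 / 2) (hη : 0 < η) (hη' : η < 1 / 4)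
    {P T : Finset (Pt d)} (hTP : T ⊆ P) (hT : T.Nonempty)
    (hrate : (1 - α) * (P.card : ℝ) ≤ T.card) {N : ℕ}
    (hN : 4 * Real.log (1 / η) / η ^ 3 ≤ (1 - α) * N) {c y : Pt d} {ρ μ : ℝ}
    (hμ : (T.card : ℝ) * μ = ∑ x ∈ T, dist x c)
    (hball : 9 / 10 * (T.card : ℝ) ≤ ((T.filter fun x => dist x y ≤ ρ).card : ℝ)) :
    3 / 20 ≤ uprob fun R : Fin N → P => ∃ r ∈ List.ofFn fun a => (R a : Pt d),
      dist r y ≤ ρ ∧ dist r c ≤ 19 / 10 * μ ∧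
        ∃ q ∈ listSpan (List.ofFn fun a => (R a : Pt d)), dist r q ≤ dist r c ∧
          excess T q c ≤ 3 / 2 * η * ∑ x ∈ T, dist x c := by
  classical
  have hP : P.Nonempty := hT.mono hTP
  have hPne : Nonempty P := hP.to_subtype
  have hP0 : (0 : ℝ) < P.card := by exact_mod_cast hP.card_pos
  have hT0 : (0 : ℝ) < T.card := by exact_mod_cast hT.card_pos
  have hlog : 1 ≤ Real.log (1 / η) := by
    rw [Real.le_log_iff_exp_le (by positivity)]
    have h1 : (4 : ℝ) ≤ 1 / η := by
      rw [le_div_iff₀ hη]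
      linarith
    linarith [Real.exp_one_lt_d9]
  have hN4 : 4 ≤ (1 - α) * N * η ^ 3 := by
    have h1 : 4 * 1 / η ^ 3 ≤ (1 - α) * N := le_trans (by gcongr) hN
    rwa [mul_one, div_le_iff₀ (by positivity)] at h1
  -- The first draw serves as `r`; the other `n` draws enlarge the span of `r`.
  obtain ⟨n, rfl⟩ : ∃ n, N = n + 1 := by
    refine Nat.exists_eq_succ_of_ne_zero ?_
    rintro rfl
    norm_num at hN4
  push_cast at hN4
  set C := ∑ x ∈ T, dist x c with hC
  -- Within `T` the two requirements fail on fractions of at most `1/10` and `10/19`, and `T` is at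
  -- least half of `P`.
  have hfirst : 9 / 50 ≤ uprob fun r : P => ((r : Pt d) ∈ T ∧ dist (r : Pt d) y ≤ ρ) ∧
      dist (r : Pt d) c ≤ 19 / 10 * μ := by
    rw [uprob_coe P fun r => (r ∈ T ∧ dist r y ≤ ρ) ∧ dist r c ≤ 19 / 10 * μ,
      le_div_iff₀ hP0]
    have h1 := card_filter_dist_le_mean hμ (s := 19 / 10) (by norm_num)
    have h2 : (T.filter fun x => dist x y ≤ ρ).card +
        (T.filter fun x => dist x c ≤ 19 / 10 * μ).card ≤
        T.card + (P.filter fun r => (r ∈ T ∧ dist r y ≤ ρ) ∧ dist r c ≤ 19 / 10 * μ).card := by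
      rw [← Finset.card_union_add_card_inter]
      refine add_le_add (Finset.card_le_card (Finset.union_subset (Finset.filter_subset _ _)
        (Finset.filter_subset _ _))) (Finset.card_le_card fun x hx => ?_)
      simp only [Finset.mem_inter, Finset.mem_filter] at hx ⊢
      exact ⟨hTP hx.1.1, hx.1, hx.2.2⟩
    have h3 : ((T.filter fun x => dist x y ≤ ρ).card : ℝ) +
        (T.filter fun x => dist x c ≤ 19 / 10 * μ).card ≤ T.card +
          (P.filter fun r => (r ∈ T ∧ dist r y ≤ ρ) ∧ dist r c ≤ 19 / 10 * μ).card := by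
      exact_mod_cast h2
    nlinarith
  have hsecond : ∀ r : P, (((r : Pt d) ∈ T ∧ dist (r : Pt d) y ≤ ρ) ∧
      dist (r : Pt d) c ≤ 19 / 10 * μ) → 5 / 6 ≤ uprob fun R : Fin n → P =>
        ∃ r' ∈ List.ofFn fun a => ((Fin.cons r R : Fin (n + 1) → P) a : Pt d),
          dist r' y ≤ ρ ∧ dist r' c ≤ 19 / 10 * μ ∧
            ∃ q ∈ listSpan (List.ofFn fun a => ((Fin.cons r R : Fin (n + 1) → P) a : Pt d)),
              dist r' q ≤ dist r' c ∧ excess T q c ≤ 3 / 2 * η * C := by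
    rintro r ⟨⟨hrT, hry⟩, hrc⟩
    set F : Submodule ℝ (Pt d) := Submodule.span ℝ {(r : Pt d)} with hF
    have hrF : (r : Pt d) ∈ F := Submodule.mem_span_singleton_self _
    have hspan : ∀ R : Fin n → P,
        listSpan (List.ofFn fun a => ((Fin.cons r R : Fin (n + 1) → P) a : Pt d)) =
          F ⊔ Submodule.span ℝ (Set.range fun i => (R i : Pt d)) := fun R => by
      rw [List.ofFn_succ, listSpan_cons]
      simp [listSpan_ofFn, hF]
    refine le_trans ?_ (uprob_mono (p := fun R : Fin n → P => ∃ q ∈ F ⊔ Submodule.span ℝ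
        (Set.range fun i => (R i : Pt d)), dist (r : Pt d) q ≤ dist (r : Pt d) c ∧
          excess T q c ≤ 3 / 2 * η * C) fun R hR => ⟨(r : Pt d), List.mem_ofFn.2 ⟨0, rfl⟩, hry, hrc,
        by rw [hspan]; exact hR⟩)
    have hμ0 : 0 ≤ μ := by linarith [dist_nonneg (x := (r : Pt d)) (y := c)]
    rcases hμ0.eq_or_lt with h0 | h0
    · have hrc' : (r : Pt d) = c := dist_le_zero.1 (by rw [← h0] at hrc; simpa using hrc)
      have hC0 : C = 0 := by rw [← hμ, ← h0, mul_zero]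
      have h1 : uprob (fun R : Fin n → P => ¬ ∃ q ∈ F ⊔ Submodule.span ℝ
        (Set.range fun i => (R i : Pt d)), dist (r : Pt d) q ≤ dist (r : Pt d) c ∧
          excess T q c ≤ 3 / 2 * η * C) = 0 := by
        refine uprob_eq_zero fun R => not_not.2 ⟨r, Submodule.mem_sup_left hrF, by simp, ?_⟩
        rw [hrc', excess_self, hC0, mul_zero]
      rw [uprob_not] at h1
      linarith
    · have hb : 0 ≤ 3 / 2 * η * C := by
        rw [← hμ]
        positivity
      have h1 := uprob_forall_excess_mul_le hTP hT c r hb n F hrF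
      have h2 : Metric.infDist c (F : Set (Pt d)) ^ 2 ≤ (19 / 10 * μ) ^ 2 := by
        have h3 : Metric.infDist c (F : Set (Pt d)) ≤ 19 / 10 * μ :=
          (Metric.infDist_le_dist_of_mem hrF).trans (by rw [dist_comm]; exact hrc)
        have h4 : 0 ≤ Metric.infDist c (F : Set (Pt d)) := Metric.infDist_nonneg
        gcongr
      set p := uprob (fun R : Fin n → P => ∀ q ∈ F ⊔ Submodule.span ℝ
        (Set.range fun i => (R i : Pt d)), dist (r : Pt d) q ≤ dist (r : Pt d) c →
          3 / 2 * η * C < excess T q c) with hp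
      have hp0 : 0 ≤ p := uprob_nonneg _
      -- `hN4` and `η < 1/4` give `(1 - α)(n + 1)η² ≥ 4/η ≥ 16`. The initial potential is at most
      -- `(19/10 μ)² < 6 μ²`, hence the failure bound `1/6`.
      have h3 : 36 * μ ^ 2 ≤ (n + 1) * ((3 / 2 * η * C) ^ 2 / (T.card * P.card)) := by
        have h4 : (3 / 2 * η * C) ^ 2 / (T.card * P.card) =
            9 / 4 * η ^ 2 * μ ^ 2 * (T.card / P.card) := by
          rw [← hμ]
          field_simp
          ring
        have h5 : 1 - α ≤ T.card / P.card := by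
          rw [le_div_iff₀ hP0]
          exact hrate
        rw [h4]
        calc 36 * μ ^ 2 = 9 / 4 * μ ^ 2 * (4 * 4) := by ring
          _ ≤ 9 / 4 * μ ^ 2 * ((1 - α) * (n + 1) * η ^ 2) := by
              have h6 : 0 ≤ (1 - α) * (n + 1) * η ^ 2 :=
                mul_nonneg (mul_nonneg (by linarith) (by positivity)) (sq_nonneg η)
              refine mul_le_mul_of_nonneg_left ?_ (by positivity)
              nlinarith
          _ = (n + 1) * (9 / 4 * η ^ 2 * μ ^ 2 * (1 - α)) := by ring
          _ ≤ _ := by gcongr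
      have h4 : p ≤ 1 / 6 := by
        have h5 : p * (36 * μ ^ 2) ≤ 6 * μ ^ 2 := by
          calc p * (36 * μ ^ 2) ≤ p * ((n + 1) * ((3 / 2 * η * C) ^ 2 / (T.card * P.card))) := by
                gcongr
            _ ≤ (19 / 10 * μ) ^ 2 := h1.trans h2
            _ ≤ _ := by nlinarith [sq_nonneg μ]
        have h6 : 0 < μ ^ 2 := by positivity
        nlinarith
      have h5 : uprob (fun R : Fin n → P => ¬ ∃ q ∈ F ⊔ Submodule.span ℝ
        (Set.range fun i => (R i : Pt d)), dist (r : Pt d) q ≤ dist (r : Pt d) c ∧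
          excess T q c ≤ 3 / 2 * η * C) ≤ p := by
        refine uprob_mono fun R hR q hq hqr => ?_
        by_contra hcon
        exact hR ⟨q, hq, hqr, not_lt.1 hcon⟩
      rw [uprob_not] at h5
      linarith
  have h1 := mul_le_uprob_prod (Ω := P) (Ω' := Fin n → P)
    (p := fun ω => ∃ r' ∈ List.ofFn fun a => ((Fin.cons ω.1 ω.2 : Fin (n + 1) → P) a : Pt d),
          dist r' y ≤ ρ ∧ dist r' c ≤ 19 / 10 * μ ∧
            ∃ q ∈ listSpan (List.ofFn fun a => ((Fin.cons ω.1 ω.2 : Fin (n + 1) → P) a : Pt d)),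
              dist r' q ≤ dist r' c ∧ excess T q c ≤ 3 / 2 * η * C) hsecond
  rw [uprob_prod] at h1
  rw [uprob_cons]
  refine le_trans ?_ h1
  linarith

end TrialProbability

/-! ### From one trial to all clusters: amplification and the union bound -/

section Success

variable {d : ℕ}

theorem le_mul_sizeQ {α : ℝ} (hα' : α < 1 / 2) : 26 ≤ (1 - α) * (sizeQ α : ℝ) := by
  have h0 : 0 < 1 - α := by linarith
  have h1 : 2 / ((1 - α) * (1 / (zetaInv : ℝ))) ≤ (sizeQ α : ℝ) := Nat.le_ceil _
  have h2 : 2 / ((1 - α) * (1 / (zetaInv : ℝ))) = 26 / (1 - α) := by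
    unfold zetaInv
    field_simp
    norm_num
  rw [h2, div_le_iff₀ h0] at h1
  linarith

theorem sizeQ_le {α : ℝ} (hα' : α < 1 / 2) : sizeQ α ≤ 53 := by
  have h0 : 0 < 1 - α := by linarith
  refine Nat.ceil_le.2 ?_
  have h2 : 2 / ((1 - α) * (1 / (zetaInv : ℝ))) = 26 / (1 - α) := by
    unfold zetaInv
    field_simp
    norm_num
  rw [h2, div_le_iff₀ h0]
  push_cast
  linarith

theorem le_mul_sizeR {α ε : ℝ} (hα : 0 < α) (hα' : α < 1 / 2) (hε : 0 < ε) :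
    4 * Real.log (1 / (α * ε / 2)) / (α * ε / 2) ^ 3 ≤ (1 - α) * (sizeR α ε : ℝ) := by
  have h0 : 0 < 1 - α := by linarith
  have h1 : 4 * Real.log (1 / (α * ε / 2)) / ((1 - α) * (α * ε / 2) ^ 3) ≤ (sizeR α ε : ℝ) :=
    Nat.le_ceil _
  rw [div_le_iff₀ (by positivity)] at h1
  rw [div_le_iff₀ (by positivity)]
  linarith

open scoped Classical in
/-- A trial produces a good center with constant probability. -/
theorem uprob_trial {α ε : ℝ} (hα : 0 < α) (hα' : α < 1 / 2) (hε : 0 < ε) (hε' : ε < 1)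
    {P Y : Finset (Pt d)} (hP : P.Nonempty)
    (hrate : (1 - α) * max (P.card : ℝ) (Y.card : ℝ) ≤ ((P ∩ Y).card : ℝ)) {c : Pt d}
    (hmed : ∀ p, ∑ x ∈ Y, dist x c ≤ ∑ x ∈ Y, dist x p) :
    1 / 40 ≤ uprob fun ω : TrialSample α ε P =>
      ∃ q ∈ (trial α ε P ω).val, IsGoodCenter α ε (P ∩ Y) c q := by
  set T := P ∩ Y with hTdef
  have hPne : Nonempty P := hP.to_subtype
  have hP0 : (0 : ℝ) < P.card := by exact_mod_cast hP.card_pos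
  have h1α : 0 ≤ 1 - α := by linarith
  have hrateP : (1 - α) * (P.card : ℝ) ≤ T.card :=
    (mul_le_mul_of_nonneg_left (le_max_left _ _) h1α).trans hrate
  have hrateY : (1 - α) * (Y.card : ℝ) ≤ T.card :=
    (mul_le_mul_of_nonneg_left (le_max_right _ _) h1α).trans hrate
  have hT0 : (0 : ℝ) < T.card := by nlinarith
  have hT : T.Nonempty := by
    rw [← Finset.card_pos]
    exact_mod_cast hT0
  have hTP : T ⊆ P := Finset.inter_subset_left
  set μ := (∑ x ∈ T, dist x c) / T.card with hμdef
  have hμ : (T.card : ℝ) * μ = ∑ x ∈ T, dist x c := by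
    rw [hμdef]
    field_simp
  have hy : 9 / 20 ≤ uprob fun y : P => (y : Pt d) ∈ T ∧ dist (y : Pt d) c ≤ 10 * μ := by
    rw [uprob_coe P fun y => y ∈ T ∧ dist y c ≤ 10 * μ, le_div_iff₀ hP0]
    have h1 := card_filter_dist_le_mean hμ (s := 10) (by norm_num)
    have h2 : ((T.filter fun x => dist x c ≤ 10 * μ).card : ℝ) ≤
        (P.filter fun y => y ∈ T ∧ dist y c ≤ 10 * μ).card := by
      refine Nat.cast_le.2 (Finset.card_le_card fun x hx => ?_)
      simp only [Finset.mem_filter] at hx ⊢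
      exact ⟨hTP hx.1, hx⟩
    nlinarith
  have hαε : α * ε < 1 / 2 := by nlinarith
  -- The radius `ρ` depends on `y`, so `y` is fixed first; given `y`, the events for `Q` and `R` are
  -- independent. The constant is `9/100 = 3/5 * 3/20`, and `9/20 * 9/100 > 1/40`.
  have hkey := mul_le_uprob_prod (Ω := P) (Ω' := (Fin (sizeQ α) → P) × (Fin (sizeR α ε) → P))
    (p := fun ω => ∃ q ∈ (trial α ε P ω).val, IsGoodCenter α ε T c q)
    (q := fun y => (y : Pt d) ∈ T ∧ dist (y : Pt d) c ≤ 10 * μ) (b := 9 / 100) (by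
      rintro y ⟨-, hyc⟩
      obtain ⟨ρ, hρ, hball, hfar⟩ := exists_quantile_dist hT (y : Pt d) (β := 9 / 10)
        (by norm_num) (by norm_num)
      have hQ := uprob_exists_scale (ρ := ρ) hTP hT hrateP (le_mul_sizeQ hα') (sizeQ_le hα') hμ hyc
        (by linarith)
      have hR := uprob_exists_span hα' (η := α * ε / 2) (by positivity) (by linarith) hTP hT hrateP
        (le_mul_sizeR hα hα' hε) hμ hball
      have hQR := uprob_prod_and (fun Q : Fin (sizeQ α) → P => ∃ S : List (Pt d),
        (S.Sublist (List.ofFn fun a => (Q a : Pt d)) ∧ S.length = zetaInv) ∧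
          ρ ≤ (S.map fun s => dist s (y : Pt d)).sum ∧
            (S.map fun s => dist s (y : Pt d)).sum ≤ 4394 * μ)
        (fun R : Fin (sizeR α ε) → P => ∃ r ∈ List.ofFn fun a => (R a : Pt d),
          dist r y ≤ ρ ∧ dist r c ≤ 19 / 10 * μ ∧
            ∃ q ∈ listSpan (List.ofFn fun a => (R a : Pt d)), dist r q ≤ dist r c ∧
              excess T q c ≤ 3 / 2 * (α * ε / 2) * ∑ x ∈ T, dist x c)
      have hmul := mul_le_mul hQ hR (by norm_num) (uprob_nonneg _)
      refine le_trans ?_ ((hmul.trans hQR).trans (uprob_mono ?_))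
      · norm_num
      · rintro ⟨Q, R⟩ ⟨⟨S, hS, hv1, hv2⟩, r, hrR, hry, hrc, q, hq, hqr, hqe⟩
        obtain ⟨t, ht, q', hq', hgood⟩ := exists_isGoodCenter_mem_candidateSet hα hα' hε hε'
          (Finset.inter_subset_right : T ⊆ Y) hrateY hT (hmed y) hρ hμ hball hry hrc hv1 hv2 hrR
          ⟨q, hq, hqr, by linarith⟩
        exact ⟨q', mem_trial_val.2 ⟨S, hS, t, ht, hq'⟩, hgood⟩)
  refine le_trans ?_ hkey
  linarith

open scoped Classical in
/-- The chosen center is at least as good as any good center among the candidates. -/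
theorem sum_dist_chooseCenter_le {α ε : ℝ} (hα : 0 < α) (hα' : α < 1 / 2) (hε : 0 < ε)
    {P Y : Finset (Pt d)} (hP : P.Nonempty)
    (hrate : (1 - α) * max (P.card : ℝ) (Y.card : ℝ) ≤ ((P ∩ Y).card : ℝ)) {c : Pt d} {J : ℕ}
    (ω : Fin J → TrialSample α ε P)
    (h : ∃ j, ∃ q ∈ (trial α ε P (ω j)).val, IsGoodCenter α ε (P ∩ Y) c q) :
    ∑ x ∈ Y, dist x (chooseCenter α ε P ω).val ≤
      (1 + (6 * α - 4 * α ^ 2 + ε * α) / ((1 - α) * (1 - 2 * α))) * ∑ x ∈ Y, dist x c := by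
  obtain ⟨j, q, hq, hgood⟩ := h
  have hP0 : (0 : ℝ) < P.card := by exact_mod_cast hP.card_pos
  set m := ⌈(1 - α) * (P.card : ℝ)⌉₊ with hm
  have hm1 : 1 ≤ m := Nat.one_le_ceil_iff.2 (mul_pos (by linarith) hP0)
  have hmP : m ≤ P.card := Nat.ceil_le.2 (by nlinarith)
  set L := (collect (fun j => trial α ε P (ω j)) (List.finRange J)).val with hL
  have hqL : q ∈ L := mem_collect_val.2 ⟨j, List.mem_finRange j, hq⟩
  have hz : (chooseCenter α ε P ω).val = (argminTimed 0 (trimmedCost P m) L).val := rfl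
  rw [hz]
  obtain ⟨-, h2⟩ := argminTimed_spec 0 (trimmedCost P m) (List.ne_nil_of_mem hqL)
  have h3 := h2 q hqL
  generalize (argminTimed 0 (trimmedCost P m) L).val = z at *
  have htr : ∀ p, (trimmedCost P m p).val =
      (sumSmallest m (P.toList.map fun x => dist x p)).val := fun p => by
    simp only [trimmedCost, Timed.bind_val, mapTimed_val, distTimed, ops_val]
  rw [htr, htr] at h3
  obtain ⟨⟨N, hN, hNc, hNv⟩, -⟩ := sumSmallest_val P (fun x => dist x z) hm1 hmP
  obtain ⟨-, hmin⟩ := sumSmallest_val P (fun x => dist x q) hm1 hmP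
  refine sum_dist_le_of_isGoodCenter hα hα' hε hP hrate hN hNc (fun S hS hSc => ?_) hgood
  rw [← hNv]
  exact h3.trans (hmin S hS hSc)

theorem pow_numTrials_le {k : ℕ} (hk : 1 ≤ k) {δ : ℝ} (hδ : 0 < δ) :
    (0.975 : ℝ) ^ numTrials k δ ≤ δ / k := by
  have hk0 : (0 : ℝ) < k := by exact_mod_cast hk
  have hlog : Real.log 0.975 < 0 := Real.log_neg (by norm_num) (by norm_num)
  have h1 : Real.log (δ / k) / Real.log 0.975 ≤ numTrials k δ := Nat.le_ceil _
  rw [div_le_iff_of_neg hlog] at h1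
  rw [← Real.log_le_log_iff (by positivity) (by positivity), Real.log_pow]
  exact h1

theorem IsLabeledPartition.sum_eq {k : ℕ} {X : Finset (Pt d)} {Xs : Fin k → Finset (Pt d)}
    (h : IsLabeledPartition X Xs) (f : Pt d → ℝ) : ∑ x ∈ X, f x = ∑ i, ∑ x ∈ Xs i, f x := by
  classical
  have hX : X = Finset.univ.biUnion Xs := by
    ext x
    simp [h.cover x]
  rw [hX, Finset.sum_biUnion fun i _ j _ hij => h.disjoint i j hij]

theorem IsLabeledPartition.kMedianCost_le {k : ℕ} {X : Finset (Pt d)} {Xs : Fin k → Finset (Pt d)}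
    (h : IsLabeledPartition X Xs) (C : Fin k → Pt d) :
    kMedianCost X C ≤ ∑ i, ∑ x ∈ Xs i, dist x (C i) := by
  rw [kMedianCost, h.sum_eq]
  exact Finset.sum_le_sum fun i _ => Finset.sum_le_sum fun x _ =>
    Metric.infDist_le_dist_of_mem (Set.mem_range_self i)

theorem IsOptimalClustering.kMedianCost_eq {k : ℕ} {X : Finset (Pt d)} {Xs : Fin k → Finset (Pt d)}
    {cs : Fin k → Pt d} (h : IsOptimalClustering X Xs cs) :
    kMedianCost X cs = ∑ i, ∑ x ∈ Xs i, dist x (cs i) := by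
  refine le_antisymm (h.partition.kMedianCost_le cs) ?_
  rw [kMedianCost, h.partition.sum_eq]
  refine Finset.sum_le_sum fun i _ => Finset.sum_le_sum fun x hx => ?_
  refine (Metric.le_infDist ⟨cs i, Set.mem_range_self i⟩).2 ?_
  rintro _ ⟨j, rfl⟩
  exact h.nearest i x hx j

/-- The median property of the centers of an optimal clustering. -/
theorem IsOptimalClustering.sum_dist_le {k : ℕ} {X : Finset (Pt d)} {Xs : Fin k → Finset (Pt d)}
    {cs : Fin k → Pt d} (h : IsOptimalClustering X Xs cs) (i : Fin k) (p : Pt d) :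
    ∑ x ∈ Xs i, dist x (cs i) ≤ ∑ x ∈ Xs i, dist x p := by
  -- Only the `i`-th center is moved while the old assignment of points is kept, so all other
  -- clusters cancel.
  have h1 := (h.optimal (Function.update cs i p)).trans (h.partition.kMedianCost_le _)
  rw [h.kMedianCost_eq, ← Finset.add_sum_erase _ _ (Finset.mem_univ i),
    ← Finset.add_sum_erase _ (fun j => ∑ x ∈ Xs j, dist x (Function.update cs i p j))
      (Finset.mem_univ i)] at h1
  have h2 : ∑ j ∈ Finset.univ.erase i, ∑ x ∈ Xs j, dist x (Function.update cs i p j) =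
      ∑ j ∈ Finset.univ.erase i, ∑ x ∈ Xs j, dist x (cs j) :=
    Finset.sum_congr rfl fun j hj => by rw [Function.update_of_ne (Finset.ne_of_mem_erase hj)]
  rw [h2, Function.update_self] at h1
  linarith

theorem uprob_eq_card_div {Ω : Type*} [Fintype Ω] (S : Set Ω) [Fintype S] :
    uprob (· ∈ S) = (Fintype.card S : ℝ) / Fintype.card Ω := by
  classical
  rw [uprob, avg, Finset.sum_boole, ← Set.toFinset_card]
  congr 3
  ext x
  simp

/-- With high probability all clusters have a successful trial, and the output is a good
clustering. -/
theorem ofReal_le_sampleAndSearch {k : ℕ} (hk : 1 ≤ k) {α ε δ : ℝ} (hα : 0 < α)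
    (hα' : α < 1 / 2) (hε : 0 < ε) (hε' : ε < 1) (hδ : 0 < δ) {X : Finset (Pt d)}
    {Xt Xs : Fin k → Finset (Pt d)} {cs : Fin k → Pt d} [hne : ∀ i, Nonempty (Xt i)]
    (hopt : IsOptimalClustering X Xs cs) (hrate : HasErrorRate α Xt Xs) :
    ENNReal.ofReal (1 - δ) ≤ (sampleAndSearch α ε δ Xt).toOuterMeasure
      {o | kMedianCost X o.val ≤
        (1 + (6 * α - 4 * α ^ 2 + ε * α) / ((1 - α) * (1 - 2 * α))) * kMedianCost X cs} := by
  classical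
  have hP : ∀ i, (Xt i).Nonempty := fun i => Finset.nonempty_coe_sort.1 (hne i)
  have hr : ∀ i, (1 - α) * max ((Xt i).card : ℝ) ((Xs i).card : ℝ) ≤ ((Xt i ∩ Xs i).card : ℝ) :=
    fun i => by convert hrate i
  rw [sampleAndSearch, PMF.toOuterMeasure_map_apply, PMF.toOuterMeasure_uniformOfFintype_apply]
  set S := sampleAndSearchRun α ε δ Xt ⁻¹' {o | kMedianCost X o.val ≤
        (1 + (6 * α - 4 * α ^ 2 + ε * α) / ((1 - α) * (1 - 2 * α))) * kMedianCost X cs} with hS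
  have hcard : (0 : ℝ) < Fintype.card (Tape α ε δ Xt) := by
    exact_mod_cast Fintype.card_pos
  rw [← ENNReal.ofReal_natCast, ← ENNReal.ofReal_natCast, ← ENNReal.ofReal_div_of_pos hcard]
  refine ENNReal.ofReal_le_ofReal ?_
  rw [← uprob_eq_card_div]
  have hbad : uprob (fun ω : Tape α ε δ Xt => ¬ ω ∈ S) ≤ uprob fun ω : Tape α ε δ Xt =>
      ∃ i, ∀ j, ¬ ∃ q ∈ (trial α ε (Xt i) (ω i j)).val,
        IsGoodCenter α ε (Xt i ∩ Xs i) (cs i) q := by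
    refine uprob_mono fun ω hω => ?_
    by_contra hcon
    push Not at hcon
    refine hω ?_
    have hval : (sampleAndSearchRun α ε δ Xt ω).val =
        fun i => (chooseCenter α ε (Xt i) (ω i)).val := rfl
    rw [hS, Set.mem_preimage, Set.mem_ofPred_eq, hval, hopt.kMedianCost_eq, Finset.mul_sum]
    refine (hopt.partition.kMedianCost_le _).trans (Finset.sum_le_sum fun i _ => ?_)
    exact sum_dist_chooseCenter_le hα hα' hε (hP i) (hr i) (ω i) (hcon i)
  have hunion := uprob_exists_le fun (i : Fin k) (ω : Tape α ε δ Xt) =>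
    ∀ j, ¬ ∃ q ∈ (trial α ε (Xt i) (ω i j)).val, IsGoodCenter α ε (Xt i ∩ Xs i) (cs i) q
  have hone : ∀ i : Fin k, uprob (fun ω : Tape α ε δ Xt => ∀ j, ¬ ∃ q ∈
      (trial α ε (Xt i) (ω i j)).val, IsGoodCenter α ε (Xt i ∩ Xs i) (cs i) q) ≤ δ / k := by
    intro i
    rw [uprob_pi_coord (A := fun i => Fin (numTrials k δ) → TrialSample α ε (Xt i)) i fun ω =>
      ∀ j, ¬ ∃ q ∈ (trial α ε (Xt i) (ω j)).val, IsGoodCenter α ε (Xt i ∩ Xs i) (cs i) q,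
      uprob_pi_forall (A := fun _ : Fin (numTrials k δ) => TrialSample α ε (Xt i)) fun _ ω =>
        ¬ ∃ q ∈ (trial α ε (Xt i) ω).val, IsGoodCenter α ε (Xt i ∩ Xs i) (cs i) q,
      uprob_not, Finset.prod_const, Finset.card_univ, Fintype.card_fin]
    refine le_trans ?_ (pow_numTrials_le hk hδ)
    have h1 := uprob_trial hα hα' hε hε' (hP i) (hr i) (hopt.sum_dist_le i)
    have h2 := uprob_le_one fun ω : TrialSample α ε (Xt i) =>
      ∃ q ∈ (trial α ε (Xt i) ω).val, IsGoodCenter α ε (Xt i ∩ Xs i) (cs i) q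
    refine pow_le_pow_left₀ (by linarith) ?_ _
    norm_num at h1 ⊢
    linarith
  have hsum := Finset.sum_le_sum fun i (_ : i ∈ (Finset.univ : Finset (Fin k))) => hone i
  have hk0 : (k : ℝ) ≠ 0 := by
    have : k ≠ 0 := by omega
    exact_mod_cast this
  rw [Finset.sum_const, Finset.card_univ, Fintype.card_fin, nsmul_eq_mul,
    mul_div_cancel₀ _ hk0] at hsum
  rw [uprob_not] at hbad
  linarith

end Success

/-! ### The number of steps -/

section RunningTime

variable {d : ℕ}

/-- The ratio of the endpoints is `b / a = 2 * 13 ^ 4 = 57122 < 2 ^ 16`; rounding outwards adds at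
most two exponents. -/
theorem length_scales_le (v : ℝ) : (scales v).val.length ≤ 18 := by
  by_cases hv : v = 0
  · simp [scales, hv]
  · simp only [scales, Timed.bind_val, ops_val, hv, decide_false, Bool.false_eq_true, if_false,
      mapTimed_val, List.length_map, List.length_range]
    set lo := ⌊Real.logb 2 (v * (1 / (zetaInv : ℝ)) ^ 3 / 2)⌋ with hlo
    set hi := ⌈Real.logb 2 (v / (1 / (zetaInv : ℝ)))⌉ with hhi
    have h1 : Real.logb 2 (v / (1 / (zetaInv : ℝ))) ≤
        Real.logb 2 (v * (1 / (zetaInv : ℝ)) ^ 3 / 2) + 16 := by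
      have h2 : v / (1 / (zetaInv : ℝ)) = v * (1 / (zetaInv : ℝ)) ^ 3 / 2 * 57122 := by
        unfold zetaInv
        norm_num
        ring
      rw [h2, Real.logb_mul (by unfold zetaInv; positivity) (by norm_num)]
      gcongr
      rw [Real.logb_le_iff_le_rpow (by norm_num) (by norm_num)]
      norm_num
    have h3 := Int.ceil_lt_add_one (Real.logb 2 (v / (1 / (zetaInv : ℝ))))
    have h4 := Int.lt_floor_add_one (Real.logb 2 (v * (1 / (zetaInv : ℝ)) ^ 3 / 2))
    rw [← hhi] at h3
    rw [← hlo] at h4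
    have h5 : (hi : ℝ) < lo + 18 := by linarith
    have h6 : hi < lo + 18 := by exact_mod_cast h5
    omega

theorem time_scales_le (v : ℝ) : (scales v).time ≤ 65 := by
  by_cases hv : v = 0
  · simp [scales, hv]
  · have h1 := length_scales_le v
    have h2 := time_mapTimed_le (fun i : ℕ =>
        ops 2 ((2 : ℝ) ^ (⌊Real.logb 2 (v * (1 / (zetaInv : ℝ)) ^ 3 / 2)⌋ + (i : ℤ))))
      (List.range (⌈Real.logb 2 (v / (1 / (zetaInv : ℝ)))⌉ -
        ⌊Real.logb 2 (v * (1 / (zetaInv : ℝ)) ^ 3 / 2)⌋ + 1).toNat) 2 fun _ _ => le_rfl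
    simp only [scales, Timed.bind_val, ops_val, hv, decide_false, Bool.false_eq_true, if_false,
      mapTimed_val, List.length_map] at h1
    simp only [scales, ops_val, hv, decide_false, Bool.false_eq_true, if_false,
      Timed.bind_time, ops_time]
    omega

/-- The bound on the number of grid points of one candidate set. -/
noncomputable def gridSize (α ε : ℝ) : ℕ :=
  (2 * ⌊8 * (sizeR α ε : ℝ) / (α * ε)⌋₊ + 1) ^ sizeR α ε

theorem exists_trial_bound : ∃ A : ℕ, 1 ≤ A ∧ ∀ (d : ℕ) (α ε : ℝ), 1 ≤ d → α < 1 / 2 →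
    1 ≤ sizeR α ε → ∀ (P : Finset (Pt d)) (ω : TrialSample α ε P),
      (trial α ε P ω).time ≤ A * (sizeR α ε ^ 2 * gridSize α ε) * d ∧
      (trial α ε P ω).val.length ≤ A * (sizeR α ε ^ 2 * gridSize α ε) := by
  -- As `|Q| ≤ 53`, there are at most `2 ^ 53` sub-samples, listed in at most `4 ^ 54` steps; each
  -- one costs at most `1000` units of grid work.
  refine ⟨4 ^ 54 + 2 ^ 53 * 1000 + 100, Nat.le_add_left _ _, ?_⟩
  intro d α ε hd hα' hN P ω
  have hM : 1 ≤ gridSize α ε := Nat.one_le_pow _ _ (by omega)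
  set N := sizeR α ε with hNdef
  set M := gridSize α ε with hMdef
  have hQ := sizeQ_le hα'
  have hQlen : (List.ofFn fun a => (ω.2.1 a : Pt d)).length = sizeQ α := List.length_ofFn
  have hRlen : (List.ofFn fun a => (ω.2.2 a : Pt d)).length = N := List.length_ofFn
  have hct : ∀ t, (candidateSet α ε (List.ofFn fun a => (ω.2.2 a : Pt d)) t).time ≤
      40 * N ^ 2 * M * d := fun t =>
    time_candidateSet_le α ε _ t N M hRlen hN hd (by rw [hRlen]; rfl)
  have hcl : ∀ t, (candidateSet α ε (List.ofFn fun a => (ω.2.2 a : Pt d)) t).val.length ≤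
      N * M := fun t => by
    refine (length_candidateSet_le α ε _ t).trans ?_
    rw [hRlen]
    rfl
  have hNE : N * M ≤ N ^ 2 * M := Nat.mul_le_mul_right _ (Nat.le_self_pow two_ne_zero N)
  have hNE' : N ≤ N ^ 2 * M := le_trans (Nat.le_mul_of_pos_right N hM) hNE
  have hinnerT : ∀ S ∈ (subsetsTimed zetaInv (List.ofFn fun a => (ω.2.1 a : Pt d))).val,
      (do
        let v ← sumTimed (fun s => distTimed s (ω.1 : Pt d)) S
        let ts ← scales v
        collect (fun t => candidateSet α ε (List.ofFn fun a => (ω.2.2 a : Pt d)) t) ts :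
          Timed (List (Pt d))).time ≤ 900 * (N ^ 2 * M * d) := by
    intro S hS
    have hSlen := ((subsetsTimed_val _ _ _).1 hS).2
    simp only [Timed.bind_time]
    have h1 := time_sumTimed_le (fun s => distTimed s (ω.1 : Pt d)) S (3 * d) fun _ _ => le_rfl
    rw [hSlen, zetaInv] at h1
    have h2 := time_scales_le (sumTimed (fun s => distTimed s (ω.1 : Pt d)) S).val
    have h3 := time_collect_le
      (fun t => candidateSet α ε (List.ofFn fun a => (ω.2.2 a : Pt d)) t)
      (scales (sumTimed (fun s => distTimed s (ω.1 : Pt d)) S).val).val _ _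
      (fun t _ => hct t) (fun t _ => hcl t)
    have h4 := Nat.mul_le_mul_right (40 * N ^ 2 * M * d + N * M + 1)
      (length_scales_le (sumTimed (fun s => distTimed s (ω.1 : Pt d)) S).val)
    have h5 : N ^ 2 * M ≤ N ^ 2 * M * d := Nat.le_mul_of_pos_right _ hd
    have h6 : d ≤ N ^ 2 * M * d := Nat.le_mul_of_pos_left _ (by omega)
    have h7 : 40 * N ^ 2 * M * d = 40 * (N ^ 2 * M * d) := by ring
    rw [h7] at h3 h4
    omega
  have hinnerL : ∀ S ∈ (subsetsTimed zetaInv (List.ofFn fun a => (ω.2.1 a : Pt d))).val,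
      (do
        let v ← sumTimed (fun s => distTimed s (ω.1 : Pt d)) S
        let ts ← scales v
        collect (fun t => candidateSet α ε (List.ofFn fun a => (ω.2.2 a : Pt d)) t) ts :
          Timed (List (Pt d))).val.length ≤ 18 * (N ^ 2 * M) := by
    intro S _
    simp only [Timed.bind_val]
    refine (length_collect_le _ _ (N ^ 2 * M) fun t _ => (hcl t).trans hNE).trans ?_
    exact Nat.mul_le_mul_right _ (length_scales_le _)
  have hQs := (length_subsetsTimed_le zetaInv (List.ofFn fun a => (ω.2.1 a : Pt d))).trans
    (Nat.pow_le_pow_right (n := 2) (by norm_num) (hQlen.trans_le hQ))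
  have hQt := (time_subsetsTimed_le zetaInv (List.ofFn fun a => (ω.2.1 a : Pt d))).trans
    (Nat.pow_le_pow_right (n := 4) (by norm_num) (Nat.succ_le_succ (hQlen.trans_le hQ)))
  have hcolT := (time_collect_le _ _ _ _ hinnerT hinnerL).trans (Nat.mul_le_mul_right _ hQs)
  have hcolL := (length_collect_le _ _ _ hinnerL).trans (Nat.mul_le_mul_right _ hQs)
  have h5 : N ^ 2 * M ≤ N ^ 2 * M * d := Nat.le_mul_of_pos_right _ hd
  generalize hE : N ^ 2 * M = E at *
  constructor
  · simp only [trial, Timed.bind_time, ops_time, ops_val]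
    rw [mul_assoc]
    generalize hF : E * d = F at *
    simp only [Nat.succ_eq_add_one, Nat.reduceAdd] at hQt
    generalize (4 : ℕ) ^ 54 = c1 at *
    generalize (2 : ℕ) ^ 53 = c2 at *
    have hF1 : 1 ≤ F := by omega
    have h8 : c2 * (900 * F + 18 * E + 1) ≤ c2 * 1000 * F := by
      rw [mul_assoc]
      exact Nat.mul_le_mul_left _ (by omega)
    have h9 : c1 ≤ c1 * F := Nat.le_mul_of_pos_right _ hF1
    rw [add_mul, add_mul]
    omega
  · simp only [trial, Timed.bind_val, ops_val]
    refine hcolL.trans ?_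
    generalize (4 : ℕ) ^ 54 = c1 at *
    generalize (2 : ℕ) ^ 53 = c2 at *
    rw [← mul_assoc]
    exact Nat.mul_le_mul_right _ (by omega)

theorem time_trimmedCost_le {P : Finset (Pt d)} {m : ℕ} (hm : 1 ≤ m) (hmP : m ≤ P.card)
    (hd : 1 ≤ d) (c : Pt d) : (trimmedCost P m c).time ≤ 224 * (P.card * d) := by
  have h1 := time_mapTimed_le (fun x => distTimed x c) P.toList (3 * d) fun _ _ => le_rfl
  have h2 := sumSmallest_time_le (l := (mapTimed (fun x => distTimed x c) P.toList).val) hm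
    (by rw [mapTimed_val, List.length_map, Finset.length_toList]; exact hmP)
  rw [mapTimed_val, List.length_map, Finset.length_toList] at h2
  rw [Finset.length_toList] at h1
  simp only [trimmedCost, Timed.bind_time, mapTimed_val]
  have h3 : P.card ≤ P.card * d := Nat.le_mul_of_pos_right _ hd
  have h4 : P.card * (3 * d + 1) = 3 * (P.card * d) + P.card := by ring
  omega

/-- The number of steps for one cluster. -/
theorem time_chooseCenter_le {α ε : ℝ} (hα : 0 < α) (hα' : α < 1 / 2) (hd : 1 ≤ d)
    {P : Finset (Pt d)} (hP : P.Nonempty) {J B : ℕ} (hJ : 1 ≤ J) (hB : 1 ≤ B)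
    (ω : Fin J → TrialSample α ε P)
    (ht : ∀ j, (trial α ε P (ω j)).time ≤ B * d)
    (hl : ∀ j, (trial α ε P (ω j)).val.length ≤ B) :
    (chooseCenter α ε P ω).time ≤ 232 * (J * B * d * P.card) := by
  have hP0 : (0 : ℝ) < P.card := by exact_mod_cast hP.card_pos
  have hP1 : 1 ≤ P.card := hP.card_pos
  set m := ⌈(1 - α) * (P.card : ℝ)⌉₊ with hm
  have hm1 : 1 ≤ m := Nat.one_le_ceil_iff.2 (mul_pos (by linarith) hP0)
  have hmP : m ≤ P.card := Nat.ceil_le.2 (by nlinarith)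
  have h1 := time_collect_le (fun j => trial α ε P (ω j)) (List.finRange J) _ _
    (fun j _ => ht j) (fun j _ => hl j)
  have h2 := length_collect_le (fun j => trial α ε P (ω j)) (List.finRange J) _ (fun j _ => hl j)
  rw [List.length_finRange] at h1 h2
  have h3 := time_argminTimed_le 0 (trimmedCost P m)
    (collect (fun j => trial α ε P (ω j)) (List.finRange J)).val _
    (fun c => time_trimmedCost_le hm1 hmP hd c)
  have h4 := h3.trans (Nat.mul_le_mul_right _ h2)
  simp only [chooseCenter, Timed.bind_time, ops_time, ops_val, ← hm]
  set F := J * B * d * P.card with hF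
  have k1 : 1 ≤ J * B := Nat.mul_pos hJ hB
  have k2 : J * B ≤ J * B * d := Nat.le_mul_of_pos_right _ hd
  have k3 : J * B * d ≤ F := Nat.le_mul_of_pos_right _ hP1
  have k4 : J ≤ J * B := Nat.le_mul_of_pos_right _ hB
  have k5 : P.card ≤ F := Nat.le_mul_of_pos_left _ (by omega)
  have k6 : J * (B * d + B + 1) = J * B * d + J * B + J := by ring
  have k7 : J * B * (224 * (P.card * d) + 1) = 224 * F + J * B := by
    rw [hF]
    ring
  omega

/-- The number of steps of a run. -/
theorem time_sampleAndSearchRun_le {k : ℕ} (hk : 1 ≤ k) {α ε δ : ℝ} (hα : 0 < α)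
    (hα' : α < 1 / 2) (hd : 1 ≤ d) {X : Finset (Pt d)} {Xt : Fin k → Finset (Pt d)}
    [hne : ∀ i, Nonempty (Xt i)] (hX : IsLabeledPartition X Xt) {B : ℕ}
    (hJ : 1 ≤ numTrials k δ) (hB : 1 ≤ B)
    (ht : ∀ i ω, (trial α ε (Xt i) ω).time ≤ B * d)
    (hl : ∀ i ω, (trial α ε (Xt i) ω).val.length ≤ B) (ω : Tape α ε δ Xt) :
    (sampleAndSearchRun α ε δ Xt ω).time ≤ 238 * (numTrials k δ * B * d * X.card) := by
  classical
  have hP : ∀ i, (Xt i).Nonempty := fun i => Finset.nonempty_coe_sort.1 (hne i)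
  have hcard : X.card = ∑ i, (Xt i).card := by
    have h : X = Finset.univ.biUnion Xt := by
      ext x
      simp [hX.cover x]
    rw [h, Finset.card_biUnion fun i _ j _ hij => hX.disjoint i j hij]
  set F := numTrials k δ * B * d with hF
  have hF1 : 1 ≤ F := Nat.mul_pos (Nat.mul_pos hJ hB) hd
  have hX1 : 1 ≤ X.card := by
    rw [hcard]
    exact (hP ⟨0, hk⟩).card_pos.trans_le
      (Finset.single_le_sum (f := fun i => (Xt i).card) (fun _ _ => Nat.zero_le _)
        (Finset.mem_univ _))
  have h1 : ∀ i : Fin k, (chooseCenter α ε (Xt i) (ω i)).time + 1 ≤ 233 * F * (Xt i).card := by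
    intro i
    have h2 := time_chooseCenter_le hα hα' hd (hP i) hJ hB (ω i) (fun j => ht i _)
      fun j => hl i _
    rw [← hF] at h2
    have h3 : 1 ≤ F * (Xt i).card := Nat.mul_pos hF1 (hP i).card_pos
    rw [mul_assoc]
    omega
  have h2 := Finset.sum_le_sum fun i (_ : i ∈ (Finset.univ : Finset (Fin k))) => h1 i
  rw [← Finset.mul_sum, ← hcard] at h2
  have h3 : 1 ≤ F * X.card := Nat.mul_pos hF1 hX1
  have h4 : (sampleAndSearchRun α ε δ Xt ω).time =
      5 + ∑ i, ((chooseCenter α ε (Xt i) (ω i)).time + 1) := rfl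
  rw [h4]
  rw [mul_assoc] at h2
  omega

theorem one_le_numTrials {k : ℕ} (hk : 1 ≤ k) {δ : ℝ} (hδ : 0 < δ) (hδ' : δ < 1) :
    1 ≤ numTrials k δ := by
  have hk1 : (1 : ℝ) ≤ k := by exact_mod_cast hk
  refine Nat.one_le_ceil_iff.2 (div_pos_of_neg_of_neg (Real.log_neg (by positivity) ?_)
    (Real.log_neg (by norm_num) (by norm_num)))
  rw [div_lt_one (by linarith)]
  linarith

theorem numTrials_le (k : ℕ) (δ : ℝ) :
    (numTrials k δ : ℝ) ≤ 41 * max 1 (Real.log (k / δ)) := by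
  have hlog : Real.log 0.975 ≤ -(1 / 40) := by
    have := Real.log_le_sub_one_of_pos (x := 0.975) (by norm_num)
    norm_num at this ⊢
    linarith
  have h1 : Real.log (δ / k) = -Real.log (k / δ) := by
    rw [← Real.log_inv, inv_div]
  set L := max 1 (Real.log (k / δ)) with hL
  have hL1 : 1 ≤ L := le_max_left _ _
  have hL2 : Real.log (k / δ) ≤ L := le_max_right _ _
  have h2 : Real.log (δ / k) / Real.log 0.975 ≤ 40 * L := by
    rw [div_le_iff_of_neg (by linarith), h1]
    nlinarith
  have h3 : numTrials k δ ≤ ⌈40 * L⌉₊ := Nat.ceil_mono h2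
  calc (numTrials k δ : ℝ) ≤ ⌈40 * L⌉₊ := by exact_mod_cast h3
    _ ≤ 40 * L + 1 := (Nat.ceil_lt_add_one (by linarith)).le
    _ ≤ 41 * L := by linarith

theorem one_le_sizeR {α ε : ℝ} (hα : 0 < α) (hα' : α < 1 / 2) (hε : 0 < ε) (hε' : ε < 1) :
    1 ≤ sizeR α ε := by
  have hαε : α * ε < 1 / 2 := by nlinarith
  refine Nat.one_le_ceil_iff.2 (div_pos (mul_pos (by norm_num) (Real.log_pos ?_)) ?_)
  · rw [lt_div_iff₀ (by positivity)]
    linarith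
  · have : 0 < 1 - α := by linarith
    positivity

/-- The size of the grids is `2 ^ O((α ε)⁻⁴)`. -/
theorem sq_sizeR_mul_gridSize_le {α ε : ℝ} (hα : 0 < α) (hα' : α < 1 / 2) (hε : 0 < ε)
    (hε' : ε < 1) :
    (sizeR α ε : ℝ) ^ 2 * gridSize α ε ≤ (2 : ℝ) ^ (1600000 / (α * ε) ^ 4) := by
  have hαε : α * ε < 1 / 2 := by nlinarith
  have hαε0 : 0 < α * ε := mul_pos hα hε
  -- With `log s ≤ s`, each logarithm of `1/(αε)` costs only half a power: `N` is of order `s ^ 7`,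
  -- the logarithm of the box width of order `s`, and their product of order `s ^ 8 = (αε)⁻⁴`.
  set s := √(1 / (α * ε)) with hs
  have hs2 : s ^ 2 = 1 / (α * ε) := Real.sq_sqrt (by positivity)
  have hs1 : 1 ≤ s := by
    rw [hs, Real.one_le_sqrt, le_div_iff₀ hαε0]
    linarith
  have hs0 : 0 < s := by linarith
  have hone : ∀ j : ℕ, 1 ≤ s ^ j := fun j => one_le_pow₀ hs1
  have hαs : α * ε = 1 / s ^ 2 := by
    rw [hs2]
    field_simp
  have hlog : ∀ x : ℝ, 0 < x → Real.log x ≤ x := fun x hx =>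
    (Real.log_le_sub_one_of_pos hx).trans (by linarith)
  set N : ℝ := (sizeR α ε : ℝ) with hN
  have hN0 : 0 ≤ N := Nat.cast_nonneg _
  have hNs : N ≤ 257 * s ^ 7 := by
    have h1 : Real.log (1 / (α * ε / 2)) ≤ 4 * s := by
      have h2 : 1 / (α * ε / 2) = 2 * s ^ 2 := by
        rw [hαs]
        field_simp
      rw [h2, Real.log_mul (by norm_num) (by positivity), Real.log_pow]
      have := hlog s hs0
      have := hlog 2 (by norm_num)
      push_cast
      linarith
    have h3 : 4 * Real.log (1 / (α * ε / 2)) / ((1 - α) * (α * ε / 2) ^ 3) ≤ 256 * s ^ 7 := by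
      have h4 : (0 : ℝ) < 1 - α := by linarith
      rw [div_le_iff₀ (by positivity)]
      have h5 : 256 * s ^ 7 * ((1 - α) * (α * ε / 2) ^ 3) = 32 * s * (1 - α) := by
        rw [hαs]
        field_simp
        norm_num
      rw [h5]
      nlinarith
    have h6 : N ≤ 256 * s ^ 7 + 1 := by
      have h7 : (sizeR α ε : ℝ) ≤ ⌈256 * s ^ 7⌉₊ := by exact_mod_cast Nat.ceil_mono h3
      exact h7.trans (Nat.ceil_lt_add_one (by positivity)).le
    linarith [hone 7]
  have hM : (gridSize α ε : ℝ) ≤ Real.exp (N * (4122 * s)) := by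
    set b : ℝ := 2 * (⌊8 * N / (α * ε)⌋₊ : ℝ) + 1 with hb
    have hb0 : 0 < b := by positivity
    have hbs : b ≤ 4113 * s ^ 9 := by
      have h1 : (⌊8 * N / (α * ε)⌋₊ : ℝ) ≤ 8 * N / (α * ε) :=
        Nat.floor_le (by positivity)
      have h2 : 8 * N / (α * ε) = 8 * N * s ^ 2 := by
        rw [hαs]
        field_simp
      have h3 : 8 * N * s ^ 2 ≤ 8 * (257 * s ^ 7) * s ^ 2 := by gcongr
      have h4 : 8 * (257 * s ^ 7) * s ^ 2 = 2056 * s ^ 9 := by ring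
      linarith [hone 9]
    have hlogb : Real.log b ≤ 4122 * s := by
      have h1 : Real.log b ≤ Real.log (4113 * s ^ 9) := Real.log_le_log hb0 hbs
      rw [Real.log_mul (by norm_num) (by positivity), Real.log_pow] at h1
      have h2 := hlog 4113 (by norm_num)
      have h3 := hlog s hs0
      push_cast at h1
      linarith
    have h5 : (gridSize α ε : ℝ) = b ^ sizeR α ε := by
      rw [gridSize]
      push_cast
      rfl
    rw [h5, ← Real.exp_log hb0, ← Real.exp_nat_mul]
    exact Real.exp_le_exp.2 (mul_le_mul_of_nonneg_left hlogb hN0)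
  have hN2 : N ^ 2 ≤ Real.exp (N * (2 * s)) := by
    have h1 : N ≤ Real.exp N := by linarith [Real.add_one_le_exp N]
    calc N ^ 2 ≤ Real.exp N ^ 2 := by gcongr
      _ = Real.exp (N * 2) := by
        rw [← Real.exp_nat_mul]
        push_cast
        ring_nf
      _ ≤ _ := by
        refine Real.exp_le_exp.2 (mul_le_mul_of_nonneg_left (by linarith) hN0)
  calc N ^ 2 * gridSize α ε ≤ Real.exp (N * (2 * s)) * Real.exp (N * (4122 * s)) := by gcongr
    _ = Real.exp (4124 * (N * s)) := by
        rw [← Real.exp_add]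
        ring_nf
    _ ≤ Real.exp (Real.log 2 * (1600000 / (α * ε) ^ 4)) := by
        refine Real.exp_le_exp.2 ?_
        have h1 : 1600000 / (α * ε) ^ 4 = 1600000 * s ^ 8 := by
          rw [hαs]
          field_simp
        rw [h1]
        have h2 : N * s ≤ 257 * s ^ 8 := by
          calc N * s ≤ 257 * s ^ 7 * s := by gcongr
            _ = _ := by ring
        -- The constant 1600000 is chosen so that `4124 * 257 < 0.69 * 1600000`.
        have h3 : 0.69 * (1600000 * s ^ 8) ≤ Real.log 2 * (1600000 * s ^ 8) := by
          gcongr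
          linarith [Real.log_two_gt_d9]
        linarith [hone 8]
    _ = _ := by rw [Real.rpow_def_of_pos (by norm_num)]

end RunningTime

theorem theorem2p1 :
    ∃ K : ℝ, 0 < K ∧
      ∀ (d k : ℕ) (_ : 1 ≤ d) (_ : 1 ≤ k) (α ε δ : ℝ)
        (_ : 0 < α) (_ : α < 1 / 2) (_ : 0 < ε) (_ : ε < 1) (_ : 0 < δ) (_ : δ < 1)
        (X : Finset (Pt d)) (Xt Xs : Fin k → Finset (Pt d)) (cs : Fin k → Pt d)
        [∀ i, Nonempty (Xt i)],
        IsLabeledPartition X Xt → IsOptimalClustering X Xs cs → HasErrorRate α Xt Xs →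
        ENNReal.ofReal (1 - δ) ≤ (sampleAndSearch α ε δ Xt).toOuterMeasure
            {o | kMedianCost X o.val ≤
              (1 + (6 * α - 4 * α ^ 2 + ε * α) / ((1 - α) * (1 - 2 * α))) * kMedianCost X cs} ∧
        ∀ o ∈ (sampleAndSearch α ε δ Xt).support,
          (o.time : ℝ) ≤
            K * (2 : ℝ) ^ (K / (α * ε) ^ 4) * X.card * d * max 1 (Real.log (k / δ)) := by
  obtain ⟨A, hA, hbound⟩ := exists_trial_bound
  -- `9758 = 238 * 41` combines the cost per trial with the bound on the number of trials; one
  -- constant serves both as factor and in the exponent.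
  refine ⟨9758 * A + 1600000, by positivity, ?_⟩
  intro d k hd hk α ε δ hα hα' hε hε' hδ hδ' X Xt Xs cs _ hXt hopt hrate
  refine ⟨ofReal_le_sampleAndSearch hk hα hα' hε hε' hδ hopt hrate, ?_⟩
  intro o ho
  obtain ⟨ω, -, rfl⟩ := (PMF.mem_support_map_iff _ _ _).1 ho
  have hN := one_le_sizeR hα hα' hε hε'
  have hE : 1 ≤ sizeR α ε ^ 2 * gridSize α ε :=
    Nat.mul_pos (by positivity) (Nat.one_le_pow _ _ (by omega))
  have htime := time_sampleAndSearchRun_le hk hα hα' hd hXt (one_le_numTrials hk hδ hδ')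
    (Nat.mul_pos hA hE) (fun i ω => (hbound d α ε hd hα' hN (Xt i) ω).1)
    (fun i ω => (hbound d α ε hd hα' hN (Xt i) ω).2) ω
  have hA0 : (0 : ℝ) ≤ A := Nat.cast_nonneg _
  have hpow : (2 : ℝ) ^ (1600000 / (α * ε) ^ 4) ≤
      (2 : ℝ) ^ ((9758 * A + 1600000) / (α * ε) ^ 4) := by
    refine Real.rpow_le_rpow_of_exponent_le (by norm_num) ?_
    gcongr
    linarith
  set L := max 1 (Real.log (k / δ)) with hL
  have hL0 : 0 ≤ L := zero_le_one.trans (le_max_left _ _)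
  calc ((sampleAndSearchRun α ε δ Xt ω).time : ℝ)
      ≤ 238 * (numTrials k δ * (A * (sizeR α ε ^ 2 * gridSize α ε)) * d * X.card) := by
        exact_mod_cast htime
    _ ≤ 238 * (41 * L * (A * (2 : ℝ) ^ ((9758 * A + 1600000) / (α * ε) ^ 4)) * d * X.card) := by
        gcongr
        · exact numTrials_le k δ
        · exact (sq_sizeR_mul_gridSize_le hα hα' hε hε').trans hpow
    _ = 9758 * A * (2 : ℝ) ^ ((9758 * A + 1600000) / (α * ε) ^ 4) * X.card * d * L := by ring
    _ ≤ _ := by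
        gcongr
        linarith
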